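/- Let $m,\hbar,c>0$ and $Q\in\mathbb{R}\setminus\{0\}$. Let $H^1=H^1(\mathbb{R}^3;\mathbb{C}^2)$ be the usual Sobolev space, and let $D^1$ be the space of locally integrable functions $A$ on $\mathbb{R}^3$ that have distributional first order derivatives in $L^2$ and vanish at infinity in the sense that $\{x : |A(x)|>t\}$ has finite Lebesgue measure for every $t>0$; below, $\mathbf{A}\in D^1$ is $\mathbb{R}^3$-valued. Let $K_S$ be the optimal constant in the Sobolev inequality $\|A\|_{L^6}\le K_S\|\nabla A\|_{L^2}$ for real-valued $A\in D^1$. For $\psi\in H^1$ and $\mathbf{A}\in D^1$ put $\nabla_{\mathrm S,\mathbf A}\psi=i\hbar\nabla\psi+\frac{Q}{c}\mathbf{A}\psi$ and $\nabla_{\mathrm P,\mathbf A}\psi=\boldsymbol\sigma\cdot\nabla_{\mathrm S,\mathbf A}\psi$, where $\boldsymbol\sigma=(\sigma^1,\sigma^2,\sigma^3)$ is the vector of Pauli matrices. For $j\in\{\mathrm S,\mathrm P\}$ and $\mathbf v\in\mathbb{R}^3$ define $$\mathscr{E}_j^{\mathbf v}(\psi,\mathbf A)=\frac{1}{2m}\|\nabla_{j,\mathbf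 A}\psi\|_{L^2}^2+\frac{1}{8\pi}\Bigl(\|\nabla\otimes\mathbf A\|_{L^2}^2-\Bigl\|\Bigl(\frac{\mathbf v}{c}\cdot\nabla\Bigr)\mathbf A\Bigr\|_{L^2}^2\Bigr)+(\psi,i\hbar\,\mathbf v\cdot\nabla\psi)_{L^2},$$ where $\nabla\otimes\mathbf A$ is the $9$-vector of all first derivatives $\partial_kA^\ell$. For $\lambda>0$ let $$\mathcal{S}_\lambda=\{(\psi,\mathbf A)\in H^1\times D^1 : \|\psi\|_{L^2}^2=\lambda,\ \operatorname{div}\mathbf A=0\},$$ let $\Theta_{\mathrm S,+}^\lambda=c$ and $$\Theta_{\mathrm P,+}^\lambda=-\frac{8\pi K_S^3Q^2\lambda}{\hbar}+\sqrt{\frac{(8\pi)^2K_S^6Q^4\lambda^2}{\hbar^2}+c^2},$$ and let $\Lambda_j^{\mathbf v}=\{\lambda>0 : |\mathbf v|<\Theta_{j,+}^\lambda\}$. Theorem. Let $j\in\{\mathrm S,\mathrm P\}$, let $\mathbf v\in\mathbb{R}^3$ satisfy $0<|\mathbf v|<c$, and let $\lambda\in\Lambda_j^{\mathbf v}$. Then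 $\mathscr{E}_j^{\mathbf v}$ is bounded from below on $\mathcal{S}_\lambda$, and there exists a pair $(\psi,\mathbf A)\in\mathcal{S}_\lambda$ such that $\mathscr{E}_j^{\mathbf v}(\psi,\mathbf A)=I_j^\lambda:=\inf\{\mathscr{E}_j^{\mathbf v}(\phi,\mathbf B) : (\phi,\mathbf B)\in\mathcal{S}_\lambda\}$. -/

import Mathlib

open MeasureTheory
open scoped ContDiff

noncomputable section

namespace MaxwellPauli

/-- Physical space `ℝ³` with its Euclidean norm and Lebesgue measure. -/
abbrev R3 : Type := EuclideanSpace ℝ (Fin 3)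

/-- Spinor space `ℂ²` with its Hermitian norm. -/
abbrev C2 : Type := EuclideanSpace ℂ (Fin 2)

/-- `j = S`: Maxwell–Schrödinger; `j = P`: Maxwell–Pauli. -/
inductive Model : Type
  | S
  | P

section Sobolev

variable {F : Type*} [NormedAddCommGroup F] [NormedSpace ℝ F]

/-- `g` is the distributional derivative `∂ₖ f` of the locally integrable function `f`. -/
def IsWeakPartial (k : Fin 3) (f g : R3 → F) : Prop :=
  LocallyIntegrable f volume ∧ LocallyIntegrable g volume ∧
    ∀ φ : R3 → ℝ, ContDiff ℝ ∞ φ → HasCompactSupport φ →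
      ∫ x, (fderiv ℝ φ x (EuclideanSpace.single k 1)) • f x = -∫ x, φ x • g x

open Classical in
/-- The distributional derivative `∂ₖ f` when it is a locally integrable function (it is then
unique up to a null set), and `0` otherwise. -/
def weakPartial (k : Fin 3) (f : R3 → F) : R3 → F :=
  if h : ∃ g, IsWeakPartial k f g then h.choose else 0

/-- The distributional first order derivatives of `f` are square integrable functions. -/
def HasL2Derivatives (f : R3 → F) : Prop :=
  ∀ k : Fin 3, ∃ g : R3 → F, IsWeakPartial k f g ∧ MemLp g 2 volume

/-- Membership in the Sobolev space `H¹`. -/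
def MemH1 (f : R3 → F) : Prop :=
  MemLp f 2 volume ∧ HasL2Derivatives f

/-- Membership in `D¹`: locally integrable functions with distributional first order derivatives
in `L²` that vanish at infinity. -/
def MemD1 (f : R3 → F) : Prop :=
  LocallyIntegrable f volume ∧ HasL2Derivatives f ∧
    ∀ t : ℝ, 0 < t → volume {x | t < ‖f x‖} < ⊤

/-- `‖f‖²` in `L²`. -/
def normSqL2 (f : R3 → F) : ℝ := ∫ x, ‖f x‖ ^ 2

/-- `‖∇ ⊗ f‖²` in `L²`: the sum over all first derivatives of all components of `f`. -/
def gradNormSqL2 (f : R3 → F) : ℝ := ∑ k : Fin 3, normSqL2 (weakPartial k f)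

end Sobolev

/-- The (optimal) constant `K_S` in the Sobolev inequality `‖A‖_{L⁶} ≤ K_S ‖∇A‖_{L²}` on `D¹`. -/
def sobolevConst : ℝ :=
  sInf {K : ℝ | 0 ≤ K ∧ ∀ A : R3 → ℝ, MemD1 A →
    eLpNorm A 6 volume ≤ ENNReal.ofReal (K * Real.sqrt (gradNormSqL2 A))}

/-- The critical speed `Θ_{j,+}^λ`. -/
def thetaPlus (hbar c Q : ℝ) (j : Model) (lam : ℝ) : ℝ :=
  match j with
  | .S => c
  | .P => -(8 * Real.pi * sobolevConst ^ 3 * Q ^ 2 * lam / hbar) +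
      Real.sqrt ((8 * Real.pi) ^ 2 * sobolevConst ^ 6 * Q ^ 4 * lam ^ 2 / hbar ^ 2 + c ^ 2)

/-- The set `Λ_j^v` of admissible masses. -/
def Lam (hbar c Q : ℝ) (j : Model) (v : R3) : Set ℝ :=
  {lam | 0 < lam ∧ ‖v‖ < thetaPlus hbar c Q j lam}

/-- The Pauli matrices `σ¹, σ², σ³`. -/
def pauli : Fin 3 → Matrix (Fin 2) (Fin 2) ℂ :=
  ![!![0, 1; 1, 0], !![0, -Complex.I; Complex.I, 0], !![1, 0; 0, -1]]

/-- The `k`-th component of `∇_{S,A} ψ = iħ∇ψ + (Q/c) A ψ`. -/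
def covDeriv (hbar c Q : ℝ) (A : R3 → R3) (ψ : R3 → C2) (k : Fin 3) (x : R3) : C2 :=
  (Complex.I * (hbar : ℂ)) • weakPartial k ψ x + ((Q / c * A x k : ℝ) : ℂ) • ψ x

/-- `∇_{P,A} ψ = σ · ∇_{S,A} ψ`. -/
def pauliDeriv (hbar c Q : ℝ) (A : R3 → R3) (ψ : R3 → C2) (x : R3) : C2 :=
  ∑ k : Fin 3, Matrix.toEuclideanLin (pauli k) (covDeriv hbar c Q A ψ k x)

/-- `‖∇_{j,A} ψ‖²` in `L²`. -/
def kineticNormSq (hbar c Q : ℝ) (j : Model) (A : R3 → R3) (ψ : R3 → C2) : ℝ :=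
  match j with
  | .S => ∑ k : Fin 3, normSqL2 (covDeriv hbar c Q A ψ k)
  | .P => normSqL2 (pauliDeriv hbar c Q A ψ)

/-- The functional `ℰ_j^v(ψ, A)`. The inner product `(ψ, iħ v·∇ψ)` in `L²` is a real number for
`ψ ∈ H¹`; `Complex.re` only turns it into an element of `ℝ`. -/
def energy (m hbar c Q : ℝ) (j : Model) (v : R3) (p : (R3 → C2) × (R3 → R3)) : ℝ :=
  1 / (2 * m) * kineticNormSq hbar c Q j p.2 p.1
    + 1 / (8 * Real.pi) *
      (gradNormSqL2 p.2 - normSqL2 fun x => ∑ k : Fin 3, (v k / c) • weakPartial k p.2 x)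
    + (∫ x, inner ℂ (p.1 x)
        ((Complex.I * (hbar : ℂ)) • ∑ k : Fin 3, ((v k : ℝ) : ℂ) • weakPartial k p.1 x)).re

/-- The constraint set `S_λ ⊆ H¹ × D¹`: `‖ψ‖² = λ` in `L²` and `div A = 0`. -/
def constraintSet (lam : ℝ) : Set ((R3 → C2) × (R3 → R3)) :=
  {p | MemH1 p.1 ∧ MemD1 p.2 ∧ normSqL2 p.1 = lam ∧
    ∀ᵐ x, ∑ k : Fin 3, weakPartial k p.2 x k = 0}

/-- `I_j^λ`, the infimum of `ℰ_j^v` on `S_λ`. -/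
def infEnergy (m hbar c Q : ℝ) (j : Model) (v : R3) (lam : ℝ) : ℝ :=
  sInf (energy m hbar c Q j v '' constraintSet lam)

end MaxwellPauli

end

set_option linter.unusedSectionVars false

noncomputable section

/-! The functional is invariant under translations, so a minimizing sequence need not be compact.
The proof combines coercivity, a strict energy inequality that excludes vanishing, and a scaling
argument that excludes loss of mass in the weak limit.

Coercivity (`coercive`). Since |v| < c, the field energy dominates (1 - |v|²/c²)‖∇A‖²/(8π). For j =
S the momentum term is rewritten with the covariant derivative, which leaves the coupling -(Q/c)(ψ,
v·Aψ). Hölder, Sobolev and the diamagnetic inequality bound ‖Aψ‖² by a constant times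
‖∇A‖²‖∇_{S,A}ψ‖, so the coupling is absorbed for every mass. For j = P the diamagnetic inequality is
not at hand; instead ħ‖∇ψ‖ is at most 2‖∇_{P,A}ψ‖ plus a multiple of ‖∇A‖². The momentum term then
costs |v|√λ times that multiple, which must fit into half of the field energy; the definition of
Θ_{P,+} expresses exactly this (`lam_condition`). For this reason the constants of the Pauli
estimates are kept sharp.

No vanishing. Completing the square in the kinetic term gives E ≥ -m|v|²λ/2 - (Q/c)(ψ, v·Aψ)
(`energy_ge_coupling`). A wide modulated wave packet in a weak field parallel to v lies strictly
below -m|v|²λ/2 (`exists_trial`), because the gain from the coupling is linear in the field strength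
and the cost is quadratic. Hence ‖Aψ‖ stays bounded below along a minimizing sequence. A Lions type
estimate (`exists_mixNorm_bound`) then finds a translate of a fixed ball on which ψ has a fixed
amount of mass; after translation the weak limit ψ₀ is nonzero.

No loss of mass. By local compactness the energy of (ψₙ, Aₙ) is asymptotically the energy of the
weak limit (ψ₀, A₀) plus that of the remainder (`tendsto_energy_split`). All terms but the field
energy F are quadratic in ψ, so rescaling ψ to mass λ yields E(ρ, B) ≥ (μ/λ) I + (1 - μ/λ) F(B) with
μ = ‖ρ‖² (`energy_ge_of_mass_le`). Let α = ‖ψ₀‖² and apply this to the limit and to the remainder.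
The multiples of I add up to I in the limit; if α < λ, this forces F(A₀) = 0 and F(Aₙ - A₀) → 0,
hence ∇Aₙ → 0, which contradicts the lower bound on ‖Aₙψₙ‖. So α = λ, the remainder has
asymptotically nonnegative energy, and (ψ₀, A₀) is a minimizer. -/

namespace MaxwellPauli

open Filter Topology
open scoped ENNReal NNReal

/-! ### Calculus of weak derivatives -/

section WeakDerivatives

/-- The `k`-th coordinate vector of `ℝ³`. -/
abbrev coordVec (k : Fin 3) : R3 := EuclideanSpace.single k 1

variable {F : Type*} [NormedAddCommGroup F] [NormedSpace ℝ F]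
variable {F' : Type*} [NormedAddCommGroup F'] [NormedSpace ℝ F']

lemma integrable_smul_of_hasCompactSupport {φ : R3 → ℝ} {f : R3 → F} (hφ : Continuous φ)
    (hs : HasCompactSupport φ) (hf : LocallyIntegrable f volume) :
    Integrable (fun x => φ x • f x) :=
  hf.integrable_smul_left_of_hasCompactSupport hφ hs

lemma continuous_partial {φ : R3 → F} {n : WithTop ℕ∞} (hφ : ContDiff ℝ n φ) (hn : n ≠ 0)
    (v : R3) : Continuous fun x => fderiv ℝ φ x v :=
  (hφ.continuous_fderiv hn).clm_apply continuous_const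

lemma hasCompactSupport_partial {φ : R3 → F} (hs : HasCompactSupport φ) (v : R3) :
    HasCompactSupport fun x => fderiv ℝ φ x v :=
  (hs.fderiv (𝕜 := ℝ)).comp_left (g := fun L : R3 →L[ℝ] F => L v) (by simp)

lemma IsWeakPartial.ae_unique [CompleteSpace F] {k : Fin 3} {f g g' : R3 → F}
    (h : IsWeakPartial k f g) (h' : IsWeakPartial k f g') : g =ᵐ[volume] g' := by
  refine ae_eq_of_integral_contDiff_smul_eq h.2.1 h'.2.1 fun φ hφ hs => ?_
  exact neg_injective ((h.2.2 φ hφ hs).symm.trans (h'.2.2 φ hφ hs))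

lemma IsWeakPartial.isWeakPartial_weakPartial {k : Fin 3} {f g : R3 → F}
    (h : IsWeakPartial k f g) : IsWeakPartial k f (weakPartial k f) := by
  have hex : ∃ g, IsWeakPartial k f g := ⟨g, h⟩
  rw [weakPartial, dif_pos hex]
  exact hex.choose_spec

/-- This makes the choice in `weakPartial` harmless: any weak derivative that can be exhibited
agrees with it almost everywhere. -/
lemma IsWeakPartial.weakPartial_ae_eq [CompleteSpace F] {k : Fin 3} {f g : R3 → F}
    (h : IsWeakPartial k f g) : weakPartial k f =ᵐ[volume] g :=
  h.isWeakPartial_weakPartial.ae_unique h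

lemma HasL2Derivatives.isWeakPartial {f : R3 → F} (h : HasL2Derivatives f) (k : Fin 3) :
    IsWeakPartial k f (weakPartial k f) :=
  (h k).choose_spec.1.isWeakPartial_weakPartial

lemma HasL2Derivatives.memLp [CompleteSpace F] {f : R3 → F} (h : HasL2Derivatives f)
    (k : Fin 3) : MemLp (weakPartial k f) 2 volume :=
  (h k).choose_spec.2.ae_eq (h k).choose_spec.1.weakPartial_ae_eq.symm

lemma IsWeakPartial.add {k : Fin 3} {f f' g g' : R3 → F} (h : IsWeakPartial k f g)
    (h' : IsWeakPartial k f' g') : IsWeakPartial k (f + f') (g + g') := by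
  refine ⟨h.1.add h'.1, h.2.1.add h'.2.1, fun φ hφ hs => ?_⟩
  have c1 := continuous_partial hφ (by simp) (coordVec k)
  have c2 := hasCompactSupport_partial hs (coordVec k)
  simp only [Pi.add_apply, smul_add]
  rw [integral_add (integrable_smul_of_hasCompactSupport c1 c2 h.1)
      (integrable_smul_of_hasCompactSupport c1 c2 h'.1),
    integral_add (integrable_smul_of_hasCompactSupport hφ.continuous hs h.2.1)
      (integrable_smul_of_hasCompactSupport hφ.continuous hs h'.2.1),
    h.2.2 φ hφ hs, h'.2.2 φ hφ hs]
  abel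

lemma locallyIntegrable_clm_comp {f : R3 → F} (L : F →L[ℝ] F')
    (hf : LocallyIntegrable f volume) : LocallyIntegrable (fun x => L (f x)) volume := by
  intro x
  obtain ⟨U, hU, hi⟩ := hf x
  exact ⟨U, hU, L.integrable_comp hi⟩

lemma IsWeakPartial.clm_comp [CompleteSpace F] [CompleteSpace F'] {k : Fin 3} {f g : R3 → F}
    (h : IsWeakPartial k f g) (L : F →L[ℝ] F') :
    IsWeakPartial k (fun x => L (f x)) (fun x => L (g x)) := by
  refine ⟨locallyIntegrable_clm_comp L h.1, locallyIntegrable_clm_comp L h.2.1,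
    fun φ hφ hs => ?_⟩
  have c1 := continuous_partial hφ (by simp) (coordVec k)
  have c2 := hasCompactSupport_partial hs (coordVec k)
  simp only [← map_smul]
  rw [L.integral_comp_comm (integrable_smul_of_hasCompactSupport c1 c2 h.1),
    L.integral_comp_comm (integrable_smul_of_hasCompactSupport hφ.continuous hs h.2.1),
    h.2.2 φ hφ hs, map_neg]

lemma IsWeakPartial.const_smul [CompleteSpace F] {k : Fin 3} {f g : R3 → F}
    (h : IsWeakPartial k f g) (a : ℝ) :
    IsWeakPartial k (fun x => a • f x) (fun x => a • g x) :=
  h.clm_comp (a • ContinuousLinearMap.id ℝ F)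

lemma IsWeakPartial.sub [CompleteSpace F] {k : Fin 3} {f f' g g' : R3 → F}
    (h : IsWeakPartial k f g)
    (h' : IsWeakPartial k f' g') : IsWeakPartial k (f - f') (g - g') := by
  have := h.add (h'.const_smul (-1))
  convert this using 1 <;> (ext x; simp [sub_eq_add_neg])

lemma locallyIntegrable_comp_add {f : R3 → F} (hf : LocallyIntegrable f volume) (y : R3) :
    LocallyIntegrable (fun x => f (x + y)) volume := by
  intro x
  obtain ⟨U, hU, hi⟩ := hf (x + y)
  refine ⟨(fun x => x + y) ⁻¹' U, (continuous_id.add continuous_const).continuousAt hU, ?_⟩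
  exact ((measurePreserving_add_right volume y).integrableOn_comp_preimage
    (MeasurableEquiv.addRight y).measurableEmbedding).2 hi

lemma IsWeakPartial.translate {k : Fin 3} {f g : R3 → F} (h : IsWeakPartial k f g) (y : R3) :
    IsWeakPartial k (fun x => f (x + y)) (fun x => g (x + y)) := by
  refine ⟨locallyIntegrable_comp_add h.1 y, locallyIntegrable_comp_add h.2.1 y,
    fun φ hφ hs => ?_⟩
  have := h.2.2 (fun x => φ (x - y)) (hφ.comp (contDiff_id.sub contDiff_const))
    (hs.comp_homeomorph (Homeomorph.subRight y))
  rw [← integral_add_right_eq_self _ y, ← integral_add_right_eq_self (fun x => _ • g x) y] at this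
  simpa [fderiv_comp_sub] using this

lemma isWeakPartial_of_contDiff [CompleteSpace F] {f : R3 → F} (hf : ContDiff ℝ 1 f)
    (k : Fin 3) : IsWeakPartial k f (fun x => fderiv ℝ f x (coordVec k)) := by
  have c := continuous_partial hf (by simp) (coordVec k)
  refine ⟨hf.continuous.locallyIntegrable, c.locallyIntegrable, fun φ hφ hs => ?_⟩
  have c1 := continuous_partial hφ (by simp) (coordVec k)
  have c2 := hasCompactSupport_partial hs (coordVec k)
  rw [integral_smul_fderiv_eq_neg_fderiv_smul_of_integrable (𝕜 := ℝ)
    (integrable_smul_of_hasCompactSupport c1 c2 hf.continuous.locallyIntegrable)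
    (integrable_smul_of_hasCompactSupport hφ.continuous hs c.locallyIntegrable)
    (integrable_smul_of_hasCompactSupport hφ.continuous hs hf.continuous.locallyIntegrable)
    (fun x _ => (hφ.differentiable (by simp)).differentiableAt)
    (fun x _ => (hf.differentiable (by simp)).differentiableAt), neg_neg]

lemma locallyIntegrable_smul_of_continuous {χ : R3 → ℝ} {f : R3 → F} (hχ : Continuous χ)
    (hf : LocallyIntegrable f volume) : LocallyIntegrable (fun x => χ x • f x) volume := by
  rw [locallyIntegrable_iff] at hf ⊢
  intro K hK
  exact (hf K hK).continuousOn_smul hχ.continuousOn hK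

lemma IsWeakPartial.smul_of_contDiff {k : Fin 3} {f g : R3 → F} (h : IsWeakPartial k f g)
    {χ : R3 → ℝ} (hχ : ContDiff ℝ ∞ χ) :
    IsWeakPartial k (fun x => χ x • f x)
      (fun x => fderiv ℝ χ x (coordVec k) • f x + χ x • g x) := by
  have c0 := continuous_partial hχ (by simp) (coordVec k)
  refine ⟨locallyIntegrable_smul_of_continuous hχ.continuous h.1,
    (locallyIntegrable_smul_of_continuous c0 h.1).add
      (locallyIntegrable_smul_of_continuous hχ.continuous h.2.1), fun φ hφ hs => ?_⟩
  have c1 := continuous_partial hφ (by simp) (coordVec k)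
  have c2 := hasCompactSupport_partial hs (coordVec k)
  -- The Leibniz rule for χ f against φ is the definition of the weak derivative of f against the
  -- test function φ χ.
  have key := h.2.2 (fun x => φ x * χ x) (hφ.mul hχ) hs.mul_right
  have e : ∀ x, fderiv ℝ (fun x => φ x * χ x) x (EuclideanSpace.single k 1) • f x
      = fderiv ℝ φ x (EuclideanSpace.single k 1) • χ x • f x
        + φ x • fderiv ℝ χ x (coordVec k) • f x := by
    intro x
    rw [fderiv_fun_mul (hφ.differentiable (by simp)).differentiableAt
      (hχ.differentiable (by simp)).differentiableAt]
    simp only [add_apply, smul_apply, smul_eq_mul,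
      smul_smul, ← add_smul]
    congr 1; ring
  simp only [e] at key
  have i1 := integrable_smul_of_hasCompactSupport c1 c2
    (locallyIntegrable_smul_of_continuous hχ.continuous h.1)
  have i2 := integrable_smul_of_hasCompactSupport hφ.continuous hs
    (locallyIntegrable_smul_of_continuous c0 h.1)
  have i3 := integrable_smul_of_hasCompactSupport hφ.continuous hs
    (locallyIntegrable_smul_of_continuous hχ.continuous h.2.1)
  rw [integral_add i1 i2] at key
  simp only [smul_add, mul_smul] at key ⊢
  rw [integral_add i2 i3, eq_sub_of_add_eq key]
  abel

end WeakDerivatives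

/-! ### Mollification and translation estimates in L² -/

section Mollification

open ContinuousLinearMap

variable {F : Type*} [NormedAddCommGroup F] [NormedSpace ℝ F]

lemma eLpNorm_two_sq {α : Type*} {_ : MeasurableSpace α} (μ : Measure α) {E : Type*}
    [NormedAddCommGroup E] (f : α → E) :
    eLpNorm f 2 μ ^ 2 = ∫⁻ x, ‖f x‖ₑ ^ 2 ∂μ := by
  have := eLpNorm_nnreal_pow_eq_lintegral (f := f) (μ := μ) (p := 2) (by norm_num)
  simpa using this

lemma lintegral_sq_le_lintegral_sq {α : Type*} {_ : MeasurableSpace α} {μ : Measure α}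
    [IsProbabilityMeasure μ] {h : α → ℝ≥0∞} (hh : AEMeasurable h μ) :
    (∫⁻ y, h y ∂μ) ^ 2 ≤ ∫⁻ y, h y ^ 2 ∂μ := by
  have := ENNReal.lintegral_mul_le_Lp_mul_Lq μ (Real.HolderConjugate.two_two) hh
    (aemeasurable_const (b := (1 : ℝ≥0∞)))
  simp only [Pi.mul_apply, mul_one, ENNReal.one_rpow, lintegral_const, measure_univ] at this
  calc (∫⁻ y, h y ∂μ) ^ 2 ≤ ((∫⁻ y, h y ^ (2 : ℝ) ∂μ) ^ (1 / 2 : ℝ)) ^ 2 := by gcongr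
    _ = ∫⁻ y, h y ^ 2 ∂μ := by
      rw [← ENNReal.rpow_natCast, ← ENNReal.rpow_mul]
      norm_num

/-- An average of functions has at most the averaged `L²` size. -/
lemma lintegral_enorm_average_sq_le {α : Type*} {_ : MeasurableSpace α} {μ : Measure α}
    [IsProbabilityMeasure μ] {Φ : R3 → α → F}
    (hΦ : AEStronglyMeasurable (Function.uncurry Φ) (volume.prod μ)) :
    ∫⁻ x, ‖∫ y, Φ x y ∂μ‖ₑ ^ 2 ≤ ∫⁻ y, (∫⁻ x, ‖Φ x y‖ₑ ^ 2) ∂μ := by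
  rw [← lintegral_lintegral_swap (f := fun x y => ‖Φ x y‖ₑ ^ 2) (hΦ.enorm.pow_const 2)]
  refine lintegral_mono_ae ?_
  filter_upwards [hΦ.prodMk_left] with x hx
  calc ‖∫ y, Φ x y ∂μ‖ₑ ^ 2 ≤ (∫⁻ y, ‖Φ x y‖ₑ ∂μ) ^ 2 := by
        gcongr; exact enorm_integral_le_lintegral_enorm _
    _ ≤ _ := lintegral_sq_le_lintegral_sq (AEStronglyMeasurable.enorm hx)

/-- A smooth bump function supported in the ball of radius `1 / (n + 1)`. -/
def bump (n : ℕ) : ContDiffBump (0 : R3) where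
  rIn := 1 / (n + 1) / 2
  rOut := 1 / (n + 1)
  rIn_pos := by positivity
  rIn_lt_rOut := by
    have : (0 : ℝ) < 1 / (n + 1) := by positivity
    linarith

/-- The mollifier: a normalized smooth bump function. -/
def mollKernel (n : ℕ) : R3 → ℝ := (bump n).normed volume

/-- Convolution with the mollifier. -/
def moll (n : ℕ) (f : R3 → F) : R3 → F :=
  convolution (mollKernel n) f (lsmul ℝ ℝ) volume

/-- The probability measure with the mollifier as density. -/
def mollMeasure (n : ℕ) : Measure R3 :=
  volume.withDensity fun y => ENNReal.ofReal (mollKernel n y)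

lemma mollKernel_nonneg (n : ℕ) (y : R3) : 0 ≤ mollKernel n y := (bump n).nonneg_normed y

lemma contDiff_mollKernel (n : ℕ) : ContDiff ℝ ∞ (mollKernel n) := (bump n).contDiff_normed

lemma hasCompactSupport_mollKernel (n : ℕ) : HasCompactSupport (mollKernel n) :=
  (bump n).hasCompactSupport_normed

lemma mollKernel_eq_zero {n : ℕ} {y : R3} (hy : 1 / ((n : ℝ) + 1) ≤ ‖y‖) :
    mollKernel n y = 0 := by
  by_contra h
  have : y ∈ Function.support ((bump n).normed volume) := h
  rw [(bump n).support_normed_eq] at this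
  simp only [Metric.mem_ball, dist_zero_right] at this
  exact absurd this (not_lt.2 hy)

lemma measurable_mollKernel (n : ℕ) : Measurable (mollKernel n) :=
  (contDiff_mollKernel n).continuous.measurable

instance (n : ℕ) : IsProbabilityMeasure (mollMeasure n) := by
  refine ⟨?_⟩
  rw [mollMeasure, withDensity_apply _ MeasurableSet.univ, Measure.restrict_univ]
  have := ofReal_integral_eq_lintegral_ofReal (f := mollKernel n) (bump n).integrable_normed
      (Eventually.of_forall (mollKernel_nonneg n))
  rw [← this]
  simp [mollKernel, (bump n).integral_normed]

lemma integral_mollMeasure (n : ℕ) (h : R3 → F) :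
    ∫ y, h y ∂(mollMeasure n) = ∫ y, mollKernel n y • h y := by
  rw [mollMeasure, integral_withDensity_eq_integral_toReal_smul
    (measurable_mollKernel n).ennreal_ofReal (by simp)]
  simp [ENNReal.toReal_ofReal (mollKernel_nonneg n _)]

/-- Seen as an average of translates against a probability measure, mollification obeys its L²
bounds by Jensen's inequality. -/
lemma moll_eq_integral (n : ℕ) (f : R3 → F) (x : R3) :
    moll n f x = ∫ y, f (x - y) ∂(mollMeasure n) := by
  rw [integral_mollMeasure]; rfl

lemma moll_eq_integral_swap (n : ℕ) (f : R3 → F) (x : R3) :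
    moll n f x = ∫ t, mollKernel n (x - t) • f t := by
  rw [moll, convolution_eq_swap]; rfl

lemma contDiff_moll (n : ℕ) {f : R3 → F} (hf : LocallyIntegrable f volume) :
    ContDiff ℝ ∞ (moll n f) :=
  (hasCompactSupport_mollKernel n).contDiff_convolution_left _ (contDiff_mollKernel n) hf

lemma hasCompactSupport_moll [CompleteSpace F] (n : ℕ) {f : R3 → F} (hf : HasCompactSupport f) :
    HasCompactSupport (moll n f) :=
  (hasCompactSupport_mollKernel n).convolution _ hf

/-- The derivative of the convolution falls on the kernel, and t ↦ `mollKernel n (x - t)` is an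
admissible test function, so it can be moved onto f. -/
lemma fderiv_moll [CompleteSpace F] (n : ℕ) {k : Fin 3} {f g : R3 → F}
    (h : IsWeakPartial k f g) (x : R3) :
    fderiv ℝ (moll n f) x (coordVec k) = moll n g x := by
  have h1 := (hasCompactSupport_mollKernel n).hasFDerivAt_convolution_left (lsmul ℝ ℝ)
    ((contDiff_mollKernel n).of_le (by simp)) h.1 x
  have hd : ∀ t, fderiv ℝ (fun t => mollKernel n (x - t)) t (coordVec k)
      = - fderiv ℝ (mollKernel n) (x - t) (coordVec k) := by
    intro t
    have := ((contDiff_mollKernel n).differentiable (by simp) (x - t)).hasFDerivAt.comp t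
      ((hasFDerivAt_id t).const_sub x)
    rw [show (fun t => mollKernel n (x - t)) = mollKernel n ∘ HSub.hSub x from rfl,
      this.fderiv]
    simp
  have key := h.2.2 (fun t => mollKernel n (x - t))
    ((contDiff_mollKernel n).comp (contDiff_const.sub contDiff_id))
    ((hasCompactSupport_mollKernel n).comp_homeomorph (Homeomorph.subLeft x))
  simp only [hd, neg_smul, integral_neg, neg_inj] at key
  rw [moll_eq_integral_swap, ← key]
  unfold moll
  rw [h1.fderiv, convolution_eq_swap]
  rw [← ContinuousLinearMap.apply_apply (coordVec k), ← ContinuousLinearMap.integral_comp_comm]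
  · rfl
  · have := ((hasCompactSupport_mollKernel n).fderiv (𝕜 := ℝ)).convolutionExists_left
      (precompL R3 (lsmul ℝ ℝ)) ((contDiff_mollKernel n).continuous_fderiv (by simp)) h.1 x
    exact this.integrable_swap

lemma rOut_bump_tendsto : Tendsto (fun n => (bump n).rOut) atTop (𝓝 0) :=
  tendsto_one_div_add_atTop_nhds_zero_nat

lemma moll_tendsto_ae [CompleteSpace F] {f : R3 → F} (hf : LocallyIntegrable f volume) :
    ∀ᵐ x, Tendsto (fun n => moll n f x) atTop (𝓝 (f x)) :=
  ContDiffBump.ae_convolution_tendsto_right_of_locallyIntegrable (K := 2) rOut_bump_tendsto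
    (Eventually.of_forall fun n => by simp [bump]; field_simp; rfl) hf

lemma mollMeasure_ac (n : ℕ) : mollMeasure n ≪ volume := withDensity_absolutelyContinuous _ _

lemma aestronglyMeasurable_sub_prod {f : R3 → F} (hf : AEStronglyMeasurable f volume)
    {μ : Measure R3} [SFinite μ] (hμ : μ ≪ volume) :
    AEStronglyMeasurable (Function.uncurry fun x y : R3 => f (x - y)) (volume.prod μ) := by
  have h1 : AEStronglyMeasurable (fun p : R3 × R3 => f (p.1 - p.2)) (volume.prod volume) :=
    hf.comp_quasiMeasurePreserving (quasiMeasurePreserving_sub volume volume)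
  exact h1.mono_ac (Measure.AbsolutelyContinuous.rfl.prod hμ)

lemma lintegral_comp_sub (h : R3 → ℝ≥0∞) (y : R3) :
    ∫⁻ x, h (x - y) = ∫⁻ x, h x := lintegral_sub_right_eq_self h y

lemma le_of_sq_le_sq {a b : ℝ≥0∞} (h : a ^ 2 ≤ b ^ 2) : a ≤ b :=
  (ENNReal.pow_le_pow_left_iff (by norm_num)).1 h

lemma eLpNorm_moll_le (n : ℕ) {f : R3 → F} (hf : AEStronglyMeasurable f volume) :
    eLpNorm (moll n f) 2 volume ≤ eLpNorm f 2 volume := by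
  apply le_of_sq_le_sq
  rw [eLpNorm_two_sq, eLpNorm_two_sq]
  simp only [moll_eq_integral]
  refine (lintegral_enorm_average_sq_le
    (aestronglyMeasurable_sub_prod hf (mollMeasure_ac n))).trans ?_
  simp only [lintegral_comp_sub (fun x => ‖f x‖ₑ ^ 2), lintegral_const, measure_univ, mul_one]
  exact le_rfl

lemma ae_mollMeasure_norm_lt (n : ℕ) : ∀ᵐ y ∂(mollMeasure n), ‖y‖ < 1 / ((n : ℝ) + 1) := by
  rw [mollMeasure, ae_withDensity_iff (measurable_mollKernel n).ennreal_ofReal]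
  refine Eventually.of_forall fun y hy => ?_
  by_contra h
  exact hy (by rw [mollKernel_eq_zero (not_lt.1 h), ENNReal.ofReal_zero])

lemma integrable_translate_mollMeasure (n : ℕ) {f : R3 → F} (hf : LocallyIntegrable f volume)
    (x : R3) : Integrable (fun y => f (x - y)) (mollMeasure n) := by
  have h : Integrable (fun y => mollKernel n y • f (x - y)) volume :=
    (hasCompactSupport_mollKernel n).convolutionExists_left (lsmul ℝ ℝ)
      (contDiff_mollKernel n).continuous hf x
  rw [mollMeasure, integrable_withDensity_iff_integrable_smul'
    (measurable_mollKernel n).ennreal_ofReal (by simp)]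
  simpa [ENNReal.toReal_ofReal (mollKernel_nonneg n _)] using h

/-- The difference f - f∗η is the average of f - f(· - y) over |y| < 1/(n+1), so a uniform bound on
these differences passes to it. -/
lemma eLpNorm_sub_moll_le [CompleteSpace F] (n : ℕ) {f : R3 → F}
    (hf : LocallyIntegrable f volume) {D : ℝ≥0∞}
    (hD : ∀ y, ‖y‖ < 1 / ((n : ℝ) + 1) → eLpNorm (fun x => f x - f (x - y)) 2 volume ≤ D) :
    eLpNorm (fun x => f x - moll n f x) 2 volume ≤ D := by
  apply le_of_sq_le_sq
  rw [eLpNorm_two_sq]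
  have e : ∀ x, f x - moll n f x = ∫ y, (f x - f (x - y)) ∂(mollMeasure n) := by
    intro x
    rw [integral_sub (integrable_const _) (integrable_translate_mollMeasure n hf x),
      moll_eq_integral]
    simp
  simp only [e]
  have hm := aestronglyMeasurable_sub_prod hf.aestronglyMeasurable (mollMeasure_ac n)
  refine (lintegral_enorm_average_sq_le (hf.aestronglyMeasurable.comp_fst.sub hm)).trans ?_
  calc _ ≤ ∫⁻ _, D ^ 2 ∂(mollMeasure n) := by
        refine lintegral_mono_ae ?_
        filter_upwards [ae_mollMeasure_norm_lt n] with y hy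
        rw [← eLpNorm_two_sq volume fun x => f x - f (x - y)]
        gcongr; exact hD y hy
    _ = D ^ 2 := by simp

lemma sum_coord_smul (y : R3) : y = ∑ k, y k • coordVec k := by
  have := (EuclideanSpace.basisFun (Fin 3) ℝ).sum_repr y
  simpa using this.symm

lemma norm_fderiv_apply_le {h : R3 → F} (x y : R3) :
    ‖fderiv ℝ h x y‖ ≤ ‖y‖ * ∑ k, ‖fderiv ℝ h x (coordVec k)‖ := by
  conv_lhs => rw [sum_coord_smul y]
  rw [map_sum, Finset.mul_sum]
  refine (norm_sum_le _ _).trans (Finset.sum_le_sum fun k _ => ?_)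
  rw [map_smul, norm_smul]
  gcongr
  exact PiLp.norm_apply_le y k

/-- The fundamental theorem of calculus on the segment from x - y to x, Jensen in the segment
parameter and translation invariance of Lebesgue measure. -/
lemma eLpNorm_sub_translate_le_of_contDiff [CompleteSpace F] {h : R3 → F}
    (hh : ContDiff ℝ 1 h) (y : R3) :
    eLpNorm (fun x => h x - h (x - y)) 2 volume ≤
      ENNReal.ofReal ‖y‖ * ∑ k, eLpNorm (fun x => fderiv ℝ h x (coordVec k)) 2 volume := by
  have hc : Continuous fun p : R3 × ℝ => fderiv ℝ h (p.1 - y + p.2 • y) y :=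
    ((hh.continuous_fderiv (by simp)).comp (by fun_prop)).clm_apply continuous_const
  have e : ∀ x, h x - h (x - y) =
      ∫ s, fderiv ℝ h (x - y + s • y) y ∂(volume.restrict (Set.Ioc (0:ℝ) 1)) := by
    intro x
    rw [← intervalIntegral.integral_of_le zero_le_one]
    have hd : ∀ s ∈ Set.uIcc (0:ℝ) 1, HasDerivAt (fun s : ℝ => h (x - y + s • y))
        (fderiv ℝ h (x - y + s • y) y) s := by
      intro s _
      have h1 : HasDerivAt (fun s : ℝ => x - y + s • y) y s := by
        simpa using ((hasDerivAt_id s).smul_const y).const_add (x - y)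
      exact ((hh.differentiable (by simp)) _).hasFDerivAt.comp_hasDerivAt s h1
    rw [intervalIntegral.integral_eq_sub_of_hasDerivAt hd]
    · simp
    · exact (hc.comp (by fun_prop : Continuous fun s : ℝ => (x, s))).intervalIntegrable _ _
  have : IsProbabilityMeasure (volume.restrict (Set.Ioc (0:ℝ) 1)) := ⟨by simp⟩
  have b1 : eLpNorm (fun x => h x - h (x - y)) 2 volume
      ≤ eLpNorm (fun x => fderiv ℝ h x y) 2 volume := by
    apply le_of_sq_le_sq
    rw [eLpNorm_two_sq, eLpNorm_two_sq]
    simp only [e]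
    refine (lintegral_enorm_average_sq_le (Φ := fun x s => fderiv ℝ h (x - y + s • y) y)
      hc.aestronglyMeasurable).trans ?_
    have : ∀ s : ℝ, ∫⁻ x, ‖fderiv ℝ h (x - y + s • y) y‖ₑ ^ 2
        = ∫⁻ x, ‖fderiv ℝ h x y‖ₑ ^ 2 := by
      intro s
      simp only [sub_add]
      exact lintegral_comp_sub (fun x => ‖fderiv ℝ h x y‖ₑ ^ 2) _
    simp [this]
  refine b1.trans ?_
  have hcont : ∀ k, AEStronglyMeasurable (fun x => ‖fderiv ℝ h x (coordVec k)‖) volume :=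
    fun k => (continuous_partial hh (by simp) _).norm.aestronglyMeasurable
  calc eLpNorm (fun x => fderiv ℝ h x y) 2 volume
      ≤ eLpNorm (‖y‖ • fun x => ∑ k, ‖fderiv ℝ h x (coordVec k)‖) 2 volume := by
        refine eLpNorm_mono fun x => ?_
        refine (norm_fderiv_apply_le x y).trans (le_abs_self _)
    _ ≤ ENNReal.ofReal ‖y‖ * ∑ k, eLpNorm (fun x => ‖fderiv ℝ h x (coordVec k)‖) 2 volume := by
        rw [eLpNorm_const_smul, ← ofReal_norm, norm_norm]
        gcongr
        have := eLpNorm_sum_le (s := Finset.univ) (fun k _ => hcont k)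
          (p := 2) (by norm_num : (1:ℝ≥0∞) ≤ 2)
        rwa [show (∑ k, fun x => ‖fderiv ℝ h x (coordVec k)‖)
          = fun x => ∑ k, ‖fderiv ℝ h x (coordVec k)‖ by ext x; simp] at this
    _ = _ := by simp only [eLpNorm_norm]

/-- `‖f - f(· - y)‖₂ ≤ |y| ∑ₖ ‖∂ₖ f‖₂` for a locally integrable function with weak gradient. -/
lemma eLpNorm_sub_translate_le [CompleteSpace F] {f : R3 → F} {g : Fin 3 → R3 → F}
    (h : ∀ k, IsWeakPartial k f (g k)) (y : R3) :
    eLpNorm (fun x => f x - f (x - y)) 2 volume ≤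
      ENNReal.ofReal ‖y‖ * ∑ k, eLpNorm (g k) 2 volume := by
  -- The mollified functions obey the bound uniformly, and Fatou's lemma carries it to their almost
  -- everywhere limit. No integrability of f itself is needed.
  have hf := (h 0).1
  have hae : ∀ᵐ x, Tendsto (fun n => moll n f x - moll n f (x - y)) atTop
      (𝓝 (f x - f (x - y))) := by
    have h1 := moll_tendsto_ae hf
    have h2 := (measurePreserving_sub_right volume y).quasiMeasurePreserving.ae h1
    filter_upwards [h1, h2] with x hx hx2 using hx.sub hx2
  have hbd : ∀ n, eLpNorm (fun x => moll n f x - moll n f (x - y)) 2 volume ≤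
      ENNReal.ofReal ‖y‖ * ∑ k, eLpNorm (g k) 2 volume := by
    intro n
    refine (eLpNorm_sub_translate_le_of_contDiff
      ((contDiff_moll n hf).of_le (by simp)) y).trans ?_
    gcongr with k
    simp only [fderiv_moll n (h k)]
    exact eLpNorm_moll_le n (h k).2.1.aestronglyMeasurable
  refine (Lp.eLpNorm_lim_le_liminf_eLpNorm (fun n => ?_) _ hae).trans ?_
  · have := (contDiff_moll n hf).continuous
    exact (by fun_prop : Continuous fun x => moll n f x - moll n f (x - y)).aestronglyMeasurable
  · exact liminf_le_of_le (by isBoundedDefault) fun b hb => by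
      obtain ⟨n, hn⟩ := hb.exists
      exact hn.trans (hbd n)

lemma eLpNorm_sub_moll_le_grad [CompleteSpace F] (n : ℕ) {f : R3 → F} {g : Fin 3 → R3 → F}
    (h : ∀ k, IsWeakPartial k f (g k)) :
    eLpNorm (fun x => f x - moll n f x) 2 volume ≤
      ENNReal.ofReal (1 / ((n : ℝ) + 1)) * ∑ k, eLpNorm (g k) 2 volume := by
  refine eLpNorm_sub_moll_le n (h 0).1 fun y hy => (eLpNorm_sub_translate_le h y).trans ?_
  gcongr

/-- Mollification converges in `L²`. -/
lemma eLpNorm_sub_moll_tendsto [CompleteSpace F] {f : R3 → F} (hf : MemLp f 2 volume) :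
    Tendsto (fun n => eLpNorm (fun x => f x - moll n f x) 2 volume) atTop (𝓝 0) := by
  have hloc : LocallyIntegrable f volume := hf.locallyIntegrable (by norm_num)
  have hmp : ∀ y : R3, MeasurePreserving
      (⟨fun x => x - y, by fun_prop⟩ : C(R3, R3)) volume volume :=
    fun y => measurePreserving_sub_right volume y
  -- Continuity of translations in L² makes f - f(· - y) small for small y, which is the input of
  -- the averaging estimate.
  have hcont : Continuous fun y : R3 => Lp.compMeasurePreserving _ (hmp y) (hf.toLp f) := by
    refine Continuous.compMeasurePreservingLp continuous_const ?_ hmp (by norm_num)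
    exact ContinuousMap.continuous_of_continuous_uncurry _ (by
      change Continuous fun p : R3 × R3 => p.2 - p.1
      fun_prop)
  rw [ENNReal.tendsto_atTop_zero]
  intro ε hε
  have h0 := (EMetric.tendsto_nhds.1 (hcont.tendsto 0)) ε hε
  obtain ⟨δ, hδ, hb⟩ := Metric.eventually_nhds_iff.1 h0
  obtain ⟨N, hN⟩ := exists_nat_one_div_lt hδ
  refine ⟨N, fun n hn => eLpNorm_sub_moll_le n hloc fun y hy => ?_⟩
  have hy' : ‖y‖ < δ := by
    refine hy.trans (lt_of_le_of_lt ?_ hN)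
    gcongr
  have := hb (by simpa using hy')
  rw [edist_comm, Lp.edist_def] at this
  refine (le_of_eq (eLpNorm_congr_ae ?_)).trans this.le
  have a0 := Lp.coeFn_compMeasurePreserving (hf.toLp f) (hmp 0)
  have ay := Lp.coeFn_compMeasurePreserving (hf.toLp f) (hmp y)
  have c0 := (hmp 0).quasiMeasurePreserving.ae_eq_comp hf.coeFn_toLp
  have cy := (hmp y).quasiMeasurePreserving.ae_eq_comp hf.coeFn_toLp
  filter_upwards [a0, ay, c0, cy] with x h1 h2 h3 h4
  simp only [Pi.sub_apply, h1, h2]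
  rw [h3, h4]
  simp

end Mollification

/-! ### The Sobolev inequality for functions vanishing at infinity -/

section Sobolev

variable {F : Type*} [NormedAddCommGroup F] [NormedSpace ℝ F]

/-- A fixed smooth cutoff: `1` on the unit ball, `0` outside the ball of radius `2`. -/
def unitBump : ContDiffBump (0 : R3) where
  rIn := 1
  rOut := 2
  rIn_pos := one_pos
  rIn_lt_rOut := one_lt_two

/-- Smooth cutoffs exhausting `ℝ³`. -/
def cutoff (n : ℕ) (x : R3) : ℝ := unitBump (((n : ℝ) + 1)⁻¹ • x)

lemma contDiff_cutoff (n : ℕ) : ContDiff ℝ ∞ (cutoff n) :=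
  unitBump.contDiff.comp (contDiff_id.const_smul _)

lemma cutoff_nonneg (n : ℕ) (x : R3) : 0 ≤ cutoff n x := unitBump.nonneg

lemma cutoff_le_one (n : ℕ) (x : R3) : cutoff n x ≤ 1 := unitBump.le_one

lemma norm_cutoff_le_one (n : ℕ) (x : R3) : ‖cutoff n x‖ ≤ 1 := by
  rw [Real.norm_of_nonneg (cutoff_nonneg n x)]; exact cutoff_le_one n x

lemma cutoff_eq_one {n : ℕ} {x : R3} (hx : ‖x‖ ≤ n + 1) : cutoff n x = 1 := by
  apply unitBump.one_of_mem_closedBall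
  have : (0 : ℝ) < n + 1 := by positivity
  simp only [Metric.mem_closedBall, dist_zero_right, norm_smul, norm_inv,
    Real.norm_of_nonneg this.le]
  change _ ≤ (1 : ℝ)
  rw [inv_mul_le_iff₀ this]; linarith

lemma hasCompactSupport_cutoff (n : ℕ) : HasCompactSupport (cutoff n) :=
  unitBump.hasCompactSupport.comp_homeomorph
    (Homeomorph.smulOfNeZero (((n : ℝ) + 1)⁻¹) (by positivity))

lemma eventually_cutoff_eq_one (x : R3) : ∀ᶠ n in atTop, cutoff n x = 1 := by
  obtain ⟨N, hN⟩ := exists_nat_ge ‖x‖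
  filter_upwards [eventually_ge_atTop N] with n hn
  apply cutoff_eq_one
  have : (N : ℝ) ≤ n := by exact_mod_cast hn
  linarith

lemma exists_partial_cutoff_bound :
    ∃ D : ℝ, 0 ≤ D ∧ ∀ n x k, ‖fderiv ℝ (cutoff n) x (coordVec k)‖ ≤ D / ((n : ℝ) + 1) := by
  obtain ⟨D, hD⟩ := (unitBump.hasCompactSupport.fderiv (𝕜 := ℝ)).exists_bound_of_continuous
    ((unitBump.contDiff (n := ⊤)).continuous_fderiv (by simp))
  have hD0 : 0 ≤ D := (norm_nonneg _).trans (hD 0)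
  refine ⟨D, hD0, fun n x k => ?_⟩
  have hp : (0 : ℝ) < n + 1 := by positivity
  have h1 : HasFDerivAt (cutoff n) _ x :=
    (((unitBump.contDiff (n := ⊤)).differentiable (by simp)) _).hasFDerivAt.comp x
      ((hasFDerivAt_id x).const_smul (((n : ℝ) + 1)⁻¹))
  rw [h1.fderiv]
  simp only [ContinuousLinearMap.coe_comp, Function.comp_apply, smul_apply,
    ContinuousLinearMap.coe_id', id_eq, map_smul, norm_smul, norm_inv,
    Real.norm_of_nonneg hp.le]
  rw [div_eq_inv_mul]
  gcongr
  refine (ContinuousLinearMap.le_opNorm _ _).trans ?_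
  simpa using hD _

lemma eLpNorm_fderiv_le_sum {u : R3 → F} (hu : ContDiff ℝ 1 u) :
    eLpNorm (fderiv ℝ u) 2 volume ≤
      ∑ k, eLpNorm (fun x => fderiv ℝ u x (coordVec k)) 2 volume := by
  have hcont : ∀ k ∈ Finset.univ,
      AEStronglyMeasurable (fun x => ‖fderiv ℝ u x (coordVec k)‖) volume :=
    fun k _ => (continuous_partial hu (by simp) _).norm.aestronglyMeasurable
  have := eLpNorm_sum_le hcont (p := 2) (by norm_num : (1:ℝ≥0∞) ≤ 2)
  rw [show (∑ k, fun x => ‖fderiv ℝ u x (coordVec k)‖)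
    = fun x => ∑ k, ‖fderiv ℝ u x (coordVec k)‖ by ext x; simp] at this
  simp only [eLpNorm_norm] at this
  refine le_trans (eLpNorm_mono fun x => ?_) this
  refine le_trans ?_ (le_abs_self _)
  refine ContinuousLinearMap.opNorm_le_bound _ (by positivity) fun y => ?_
  rw [mul_comm]
  exact norm_fderiv_apply_le x y

/-- The Gagliardo-Nirenberg-Sobolev inequality with 1/6 = 1/2 - 1/3. It is extended in three stages:
by cutoffs to C¹ functions in L², by truncation of values to C¹ functions vanishing at infinity, and
by mollification to weak derivatives. -/
lemma exists_sobolev_compactSupport : ∃ C : ℝ≥0, ∀ u : R3 → ℝ, ContDiff ℝ 1 u →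
    HasCompactSupport u → eLpNorm u 6 volume ≤
      C * ∑ k, eLpNorm (fun x => fderiv ℝ u x (coordVec k)) 2 volume := by
  refine ⟨SNormLESNormFDerivOfEqConst ℝ (volume : Measure R3) 2, fun u hu hs => ?_⟩
  have := eLpNorm_le_eLpNorm_fderiv_of_eq (μ := volume) hu hs (p := 2) (p' := 6)
    (by norm_num) (by simp) (by simp; norm_num)
  refine le_trans (by simpa using this) ?_
  gcongr
  exact eLpNorm_fderiv_le_sum hu

/-- Fatou's lemma for `Lᵖ` norms. -/
lemma eLpNorm_le_of_tendsto_ae {E : Type*} [NormedAddCommGroup E] {p : ℝ≥0∞} {f : ℕ → R3 → E}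
    {f₀ : R3 → E} {b : ℕ → ℝ≥0∞} {B : ℝ≥0∞} (hf : ∀ n, AEStronglyMeasurable (f n) volume)
    (hlim : ∀ᵐ x, Tendsto (fun n => f n x) atTop (𝓝 (f₀ x)))
    (hb : ∀ n, eLpNorm (f n) p volume ≤ b n) (hB : Tendsto b atTop (𝓝 B)) :
    eLpNorm f₀ p volume ≤ B := by
  refine (Lp.eLpNorm_lim_le_liminf_eLpNorm hf _ hlim).trans ?_
  rw [← hB.liminf_eq]
  exact liminf_le_liminf (Eventually.of_forall hb)

lemma eLpNorm_cutoff_smul_le (n : ℕ) (p : ℝ≥0∞) (f : R3 → F) :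
    eLpNorm (fun x => cutoff n x • f x) p volume ≤ eLpNorm f p volume := by
  refine eLpNorm_mono fun x => ?_
  rw [norm_smul]
  exact mul_le_of_le_one_left (norm_nonneg _) (norm_cutoff_le_one n x)

lemma eLpNorm_partial_cutoff_smul_le {D : ℝ} (hD0 : 0 ≤ D)
    (hD : ∀ n x k, ‖fderiv ℝ (cutoff n) x (coordVec k)‖ ≤ D / ((n : ℝ) + 1)) (n : ℕ) (k : Fin 3)
    (f : R3 → F) :
    eLpNorm (fun x => fderiv ℝ (cutoff n) x (coordVec k) • f x) 2 volume ≤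
      ENNReal.ofReal (D / ((n : ℝ) + 1)) * eLpNorm f 2 volume := by
  have : ENNReal.ofReal (D / ((n : ℝ) + 1)) * eLpNorm f 2 volume
      = eLpNorm ((D / ((n : ℝ) + 1)) • f) 2 volume := by
    rw [eLpNorm_const_smul, ← ofReal_norm, Real.norm_of_nonneg (by positivity)]
  rw [this]
  refine eLpNorm_mono fun x => ?_
  simp only [Pi.smul_apply, norm_smul]
  gcongr
  exact (hD n x k).trans (le_abs_self _)

lemma tendsto_ofReal_div_mul {D : ℝ} {a : ℝ≥0∞} (ha : a ≠ ⊤) :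
    Tendsto (fun n : ℕ => ENNReal.ofReal (D / ((n : ℝ) + 1)) * a) atTop (𝓝 0) := by
  have h1 : Tendsto (fun n : ℕ => D / ((n : ℝ) + 1)) atTop (𝓝 0) := by
    have := (tendsto_one_div_add_atTop_nhds_zero_nat (𝕜 := ℝ)).const_mul D
    simpa only [mul_one_div, mul_zero] using this
  have h2 := ENNReal.tendsto_ofReal h1
  rw [ENNReal.ofReal_zero] at h2
  simpa using ENNReal.Tendsto.mul_const h2 (Or.inr ha)

/-- Multiplying by `cutoff n` costs at most D/(n+1) ‖u‖₂ in the gradient, which disappears as n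
grows since u is in L². -/
lemma exists_sobolev_contDiff_memLp : ∃ C : ℝ≥0, ∀ u : R3 → ℝ, ContDiff ℝ 1 u →
    MemLp u 2 volume → eLpNorm u 6 volume ≤
      C * ∑ k, eLpNorm (fun x => fderiv ℝ u x (coordVec k)) 2 volume := by
  obtain ⟨C, hC⟩ := exists_sobolev_compactSupport
  obtain ⟨D, hD0, hD⟩ := exists_partial_cutoff_bound
  refine ⟨C, fun u hu hu2 => ?_⟩
  have hcd : ∀ n, ContDiff ℝ 1 fun x => cutoff n x • u x :=
    fun n => ((contDiff_cutoff n).of_le (by simp)).smul hu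
  have hfd : ∀ n k x, fderiv ℝ (fun x => cutoff n x • u x) x (coordVec k)
      = fderiv ℝ (cutoff n) x (coordVec k) • u x
        + cutoff n x • fderiv ℝ u x (coordVec k) := by
    intro n k x
    rw [fderiv_fun_smul ((contDiff_cutoff n).differentiable (by simp) x)
      (hu.differentiable (by simp) x)]
    simp only [add_apply, smul_apply, ContinuousLinearMap.smulRight_apply]
    rw [add_comm]
  refine eLpNorm_le_of_tendsto_ae (f := fun n x => cutoff n x • u x)
    (fun n => (hcd n).continuous.aestronglyMeasurable)
    (Eventually.of_forall fun x => ?_) (b := fun n => C * ∑ k,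
      (ENNReal.ofReal (D / ((n : ℝ) + 1)) * eLpNorm u 2 volume
        + eLpNorm (fun x => fderiv ℝ u x (coordVec k)) 2 volume)) (fun n => ?_) ?_
  · refine tendsto_const_nhds.congr' ?_
    filter_upwards [eventually_cutoff_eq_one x] with n hn
    simp [hn]
  · refine (hC _ (hcd n) (hasCompactSupport_cutoff n).smul_right).trans ?_
    gcongr with k
    simp only [hfd]
    have c1 := continuous_partial (contDiff_cutoff n) (by simp) (coordVec k)
    have c2 := continuous_partial hu (by simp) (coordVec k)
    refine (eLpNorm_add_le (c1.smul hu.continuous).aestronglyMeasurable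
      ((contDiff_cutoff n).continuous.smul c2).aestronglyMeasurable (by norm_num)).trans ?_
    gcongr
    · exact eLpNorm_partial_cutoff_smul_le hD0 hD n k u
    · exact eLpNorm_cutoff_smul_le n 2 _
  · refine ENNReal.Tendsto.const_mul (tendsto_finsetSum _ fun k _ => ?_)
      (Or.inr ENNReal.coe_ne_top)
    simpa using (tendsto_ofReal_div_mul (D := D) hu2.2.ne).add
      (tendsto_const_nhds (x := eLpNorm (fun x => fderiv ℝ u x (coordVec k)) 2 volume))

/-- A smooth function vanishing near `0` and equal to the identity far away. -/
def coreCut (s : ℝ) : ℝ := s * Real.smoothTransition (s ^ 2 - 1)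

lemma contDiff_coreCut : ContDiff ℝ ∞ coreCut :=
  contDiff_id.mul (Real.smoothTransition.contDiff.comp ((contDiff_id.pow 2).sub contDiff_const))

lemma coreCut_eq_zero {s : ℝ} (hs : |s| ≤ 1) : coreCut s = 0 := by
  rw [coreCut, Real.smoothTransition.zero_of_nonpos, mul_zero]
  nlinarith [sq_abs s, abs_nonneg s]

lemma coreCut_eq_self {s : ℝ} (hs : 2 ≤ |s|) : coreCut s = s := by
  rw [coreCut, Real.smoothTransition.one_of_one_le, mul_one]
  nlinarith [sq_abs s, abs_nonneg s]

lemma exists_deriv_coreCut_bound : ∃ B : ℝ, 0 ≤ B ∧ ∀ s, |deriv coreCut s| ≤ B := by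
  have hq : ContDiff ℝ ∞ fun s => coreCut s - s := contDiff_coreCut.sub contDiff_id
  have hs : HasCompactSupport fun s => coreCut s - s := by
    refine HasCompactSupport.intro (isCompact_Icc (a := (-2 : ℝ)) (b := 2)) fun s hs => ?_
    rw [coreCut_eq_self, sub_self]
    by_contra h
    exact hs (abs_le.1 (not_le.1 h).le)
  obtain ⟨B, hB⟩ := hs.deriv.exists_bound_of_continuous (hq.continuous_deriv (by simp))
  refine ⟨B + 1, by linarith [(norm_nonneg _).trans (hB 0)], fun s => ?_⟩
  have h1 : deriv coreCut s = deriv (fun s => coreCut s - s) s + 1 := by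
    rw [deriv_fun_sub (contDiff_coreCut.differentiable (by simp) s) differentiableAt_fun_id]
    simp
  rw [h1]
  refine (abs_add_le _ _).trans ?_
  have := hB s
  rw [Real.norm_eq_abs] at this
  simpa using this

/-- A bounded smooth truncation of the real line that vanishes near `0`. -/
def trunc (n : ℕ) (s : ℝ) : ℝ :=
  (n + 1) * Real.arctan (coreCut ((n + 1) * s) / (n + 1) ^ 2)

lemma contDiff_trunc (n : ℕ) : ContDiff ℝ 1 (trunc n) :=
  contDiff_const.mul (Real.contDiff_arctan.comp
    (((contDiff_coreCut.of_le (by simp)).comp (contDiff_const.mul contDiff_id)).div_const _))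

lemma trunc_eq_zero {n : ℕ} {s : ℝ} (hs : |s| ≤ 1 / ((n : ℝ) + 1)) : trunc n s = 0 := by
  have hp : (0 : ℝ) < n + 1 := by positivity
  rw [trunc, coreCut_eq_zero, zero_div, Real.arctan_zero, mul_zero]
  rw [abs_mul, abs_of_pos hp]
  rwa [le_div_iff₀ hp, mul_comm] at hs

lemma abs_trunc_le (n : ℕ) (s : ℝ) : |trunc n s| ≤ (n + 1) * (Real.pi / 2) := by
  rw [trunc, abs_mul, abs_of_pos (by positivity : (0 : ℝ) < n + 1)]
  gcongr
  exact abs_le.2 ⟨(Real.neg_pi_div_two_lt_arctan _).le, (Real.arctan_lt_pi_div_two _).le⟩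

lemma abs_deriv_trunc_le {B : ℝ} (hB : ∀ s, |deriv coreCut s| ≤ B) (n : ℕ) (s : ℝ) :
    |deriv (trunc n) s| ≤ B := by
  have hp : (0 : ℝ) < n + 1 := by positivity
  have h1 : HasDerivAt (fun s : ℝ => coreCut ((n + 1) * s))
      (deriv coreCut ((n + 1) * s) * ((n + 1) * 1)) s :=
    HasDerivAt.comp s (contDiff_coreCut.differentiable (by simp) _).hasDerivAt
      ((hasDerivAt_id s).const_mul _)
  have h2 := ((h1.div_const ((n + 1) ^ 2)).arctan).const_mul ((n : ℝ) + 1)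
  have h3 : deriv (trunc n) s = _ := h2.deriv
  rw [h3]
  have e : ((n : ℝ) + 1) * (1 / (1 + (coreCut ((n + 1) * s) / (n + 1) ^ 2) ^ 2) *
      (deriv coreCut ((n + 1) * s) * ((n + 1) * 1) / (n + 1) ^ 2))
      = deriv coreCut ((n + 1) * s) / (1 + (coreCut ((n + 1) * s) / (n + 1) ^ 2) ^ 2) := by
    field_simp
  rw [e, abs_div, abs_of_pos (by positivity :
    (0:ℝ) < 1 + (coreCut ((n + 1) * s) / (n + 1) ^ 2) ^ 2)]
  refine (div_le_self (abs_nonneg _) ?_).trans (hB _)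
  nlinarith [sq_nonneg (coreCut ((n + 1) * s) / (n + 1) ^ 2)]

/-- For s ≠ 0 and n ≥ 2/|s| the value is (n+1) arctan(s/(n+1)), which is s times a difference
quotient of arctan at 0. -/
lemma trunc_tendsto (s : ℝ) : Tendsto (fun n => trunc n s) atTop (𝓝 s) := by
  by_cases hs : s = 0
  · subst hs
    refine tendsto_const_nhds.congr fun n => (trunc_eq_zero (by simp; positivity)).symm
  have h0 : Tendsto (fun n : ℕ => s * (1 / ((n : ℝ) + 1))) atTop (𝓝[≠] 0) := by
    refine tendsto_nhdsWithin_iff.2 ⟨?_, Eventually.of_forall fun n => ?_⟩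
    · simpa using (tendsto_one_div_add_atTop_nhds_zero_nat (𝕜 := ℝ)).const_mul s
    · have : (0 : ℝ) < 1 / (n + 1) := by positivity
      exact mul_ne_zero hs this.ne'
  have h1 := (hasDerivAt_iff_tendsto_slope_zero.1 (Real.hasDerivAt_arctan 0)).comp h0
  have h2 := h1.const_mul s
  simp only [Function.comp_def, zero_add, Real.arctan_zero, sub_zero, smul_eq_mul] at h2
  norm_num at h2
  refine h2.congr' ?_
  obtain ⟨N, hN⟩ := exists_nat_ge (2 / |s|)
  filter_upwards [eventually_ge_atTop N] with n hn
  have hp : (0 : ℝ) < n + 1 := by positivity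
  have : (N : ℝ) ≤ n := by exact_mod_cast hn
  rw [trunc, coreCut_eq_self]
  · rw [show ((n : ℝ) + 1) * s / (n + 1) ^ 2 = s * ((n : ℝ) + 1)⁻¹ by field_simp]
    field_simp
  · rw [abs_mul, abs_of_pos hp]
    rw [div_le_iff₀ (abs_pos.2 hs)] at hN
    nlinarith [abs_nonneg s]

/-- `trunc n ∘ u` is bounded and vanishes where |u| ≤ 1/(n+1). Its support therefore has finite
measure and it lies in L², while its gradient exceeds that of u by at most a factor independent of
n. -/
lemma exists_sobolev_contDiff : ∃ C : ℝ≥0, ∀ u : R3 → ℝ, ContDiff ℝ 1 u →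
    (∀ t : ℝ, 0 < t → volume {x | t < ‖u x‖} < ⊤) → eLpNorm u 6 volume ≤
      C * ∑ k, eLpNorm (fun x => fderiv ℝ u x (coordVec k)) 2 volume := by
  obtain ⟨C, hC⟩ := exists_sobolev_contDiff_memLp
  obtain ⟨B, hB0, hB⟩ := exists_deriv_coreCut_bound
  refine ⟨C * B.toNNReal, fun u hu hlev => ?_⟩
  have hcd : ∀ n, ContDiff ℝ 1 fun x => trunc n (u x) := fun n => (contDiff_trunc n).comp hu
  refine eLpNorm_le_of_tendsto_ae (f := fun n x => trunc n (u x))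
    (fun n => (hcd n).continuous.aestronglyMeasurable)
    (Eventually.of_forall fun x => trunc_tendsto (u x)) (fun n => ?_) tendsto_const_nhds
  have hL2 : MemLp (fun x => trunc n (u x)) 2 volume := by
    have hS : MeasurableSet {x | 1 / ((n : ℝ) + 1) < ‖u x‖} :=
      measurableSet_lt measurable_const hu.continuous.norm.measurable
    have hi : MemLp ({x | 1 / ((n : ℝ) + 1) < ‖u x‖}.indicator
        fun _ => ((n : ℝ) + 1) * (Real.pi / 2)) 2 volume :=
      memLp_indicator_const 2 hS _ (Or.inr (hlev _ (by positivity)).ne)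
    refine hi.mono (hcd n).continuous.aestronglyMeasurable (Eventually.of_forall fun x => ?_)
    by_cases hx : 1 / ((n : ℝ) + 1) < ‖u x‖
    · rw [Set.indicator_of_mem (by exact hx)]
      exact (abs_trunc_le n (u x)).trans (le_abs_self _)
    · rw [trunc_eq_zero (not_lt.1 hx)]; simp
  refine (hC _ (hcd n) hL2).trans ?_
  rw [ENNReal.coe_mul, mul_assoc]
  refine mul_le_mul_right ?_ _
  rw [Finset.mul_sum]
  gcongr with k
  have : (B.toNNReal : ℝ≥0∞) * eLpNorm (fun x => fderiv ℝ u x (coordVec k)) 2 volume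
      = eLpNorm (B • fun x => fderiv ℝ u x (coordVec k)) 2 volume := by
    rw [eLpNorm_const_smul, ← ofReal_norm, Real.norm_of_nonneg hB0, ENNReal.ofReal]
  rw [this]
  refine eLpNorm_mono fun x => ?_
  have hd : HasFDerivAt (fun x => trunc n (u x)) _ x :=
    ((contDiff_trunc n).differentiable (by simp) (u x)).hasDerivAt.comp_hasFDerivAt x
      (hu.differentiable (by simp) x).hasFDerivAt
  rw [hd.fderiv]
  simp only [smul_apply, Pi.smul_apply, norm_smul]
  gcongr
  exact (abs_deriv_trunc_le hB n _).trans (le_abs_self _)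

lemma measure_level_lt_top {f : R3 → F} {p : ℝ≥0∞} (hp : p ≠ 0) (hp' : p ≠ ⊤)
    (hf : MemLp f p volume) {t : ℝ} (ht : 0 < t) : volume {x | t < ‖f x‖} < ⊤ := by
  have h := meas_ge_le_mul_pow_eLpNorm_enorm volume hp hp' hf.1
    (ε := ENNReal.ofReal t) (by simpa using ht) (by simp)
  refine lt_of_le_of_lt (measure_mono fun x hx => ?_) (h.trans_lt ?_)
  · simp only [Set.mem_ofPred_eq] at hx ⊢
    rw [← ofReal_norm]
    exact ENNReal.ofReal_le_ofReal hx.le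
  · refine ENNReal.mul_lt_top ?_ ?_
    · refine ENNReal.rpow_lt_top_of_nonneg ENNReal.toReal_nonneg ?_
      simpa using ht
    · exact ENNReal.rpow_lt_top_of_nonneg ENNReal.toReal_nonneg hf.2.ne

/-- The Sobolev inequality for functions vanishing at infinity. -/
lemma exists_sobolev_weak : ∃ C : ℝ≥0, ∀ (f : R3 → ℝ) (g : Fin 3 → R3 → ℝ),
    (∀ k, IsWeakPartial k f (g k)) → (∀ k, MemLp (g k) 2 volume) →
    (∀ t : ℝ, 0 < t → volume {x | t < ‖f x‖} < ⊤) →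
    eLpNorm f 6 volume ≤ C * ∑ k, eLpNorm (g k) 2 volume := by
  obtain ⟨C, hC⟩ := exists_sobolev_contDiff
  refine ⟨C, fun f g h hg hlev => ?_⟩
  have hloc := (h 0).1
  refine eLpNorm_le_of_tendsto_ae (f := fun n => moll n f)
    (fun n => (contDiff_moll n hloc).continuous.aestronglyMeasurable)
    (moll_tendsto_ae hloc) (fun n => ?_) tendsto_const_nhds
  -- The mollification differs from f by an L² function, because the gradient is in L². Superlevel
  -- sets of L² functions have finite measure, so the mollification again vanishes at infinity.
  have hd : MemLp (fun x => f x - moll n f x) 2 volume := by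
    refine ⟨hloc.aestronglyMeasurable.sub
      (contDiff_moll n hloc).continuous.aestronglyMeasurable,
      (eLpNorm_sub_moll_le_grad n h).trans_lt ?_⟩
    refine ENNReal.mul_lt_top (by simp) ?_
    exact ENNReal.sum_lt_top.2 fun k _ => (hg k).2
  refine (hC _ ((contDiff_moll n hloc).of_le (by simp)) fun t ht => ?_).trans ?_
  · refine lt_of_le_of_lt (measure_mono (t := {x | t / 2 < ‖f x‖} ∪
      {x | t / 2 < ‖f x - moll n f x‖}) fun x hx => ?_) ?_
    · by_contra hn
      simp only [Set.mem_union, Set.mem_ofPred_eq, not_or, not_lt] at hn hx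
      have : ‖moll n f x‖ ≤ ‖f x‖ + ‖f x - moll n f x‖ := by
        have := norm_sub_le (f x) (f x - moll n f x)
        simpa using this
      linarith [hn.1, hn.2]
    · exact (measure_union_le _ _).trans_lt (ENNReal.add_lt_top.2
        ⟨hlev _ (by positivity), measure_level_lt_top (by norm_num) (by norm_num) hd
          (by positivity)⟩)
  · gcongr with k
    simp only [fderiv_moll n (h k)]
    exact eLpNorm_moll_le n (h k).2.1.aestronglyMeasurable

end Sobolev

/-! ### Passage from functions to classes in L² -/

section L2

variable {F : Type*} [NormedAddCommGroup F]

open Classical in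
/-- The class in `L²` of a square integrable function (and `0` otherwise). -/
def toL2 (f : R3 → F) : Lp F 2 (volume : Measure R3) :=
  if h : MemLp f 2 volume then h.toLp f else 0

lemma toL2_eq {f : R3 → F} (h : MemLp f 2 volume) : toL2 f = h.toLp f := dif_pos h

lemma coeFn_toL2 {f : R3 → F} (h : MemLp f 2 volume) : toL2 f =ᵐ[volume] f := by
  rw [toL2_eq h]; exact h.coeFn_toLp

lemma toL2_congr {f g : R3 → F} (hf : MemLp f 2 volume) (h : f =ᵐ[volume] g) :
    toL2 f = toL2 g := by
  rw [toL2_eq hf, toL2_eq (hf.ae_eq h)]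
  exact (MemLp.toLp_eq_toLp_iff _ _).2 h

lemma toL2_add {f g : R3 → F} (hf : MemLp f 2 volume) (hg : MemLp g 2 volume) :
    toL2 (fun x => f x + g x) = toL2 f + toL2 g := by
  rw [toL2_eq hf, toL2_eq hg, ← MemLp.toLp_add]
  exact toL2_eq (hf.add hg)

lemma toL2_sub {f g : R3 → F} (hf : MemLp f 2 volume) (hg : MemLp g 2 volume) :
    toL2 (fun x => f x - g x) = toL2 f - toL2 g := by
  rw [toL2_eq hf, toL2_eq hg, ← MemLp.toLp_sub]
  exact toL2_eq (hf.sub hg)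

lemma toL2_smul {𝕜 : Type*} [NormedRing 𝕜] [Module 𝕜 F] [IsBoundedSMul 𝕜 F] (a : 𝕜)
    {f : R3 → F} (hf : MemLp f 2 volume) : toL2 (fun x => a • f x) = a • toL2 f := by
  rw [toL2_eq hf, ← MemLp.toLp_const_smul]
  exact toL2_eq (hf.const_smul a)

lemma memLp_sum {ι : Type*} (s : Finset ι) {f : ι → R3 → F} {p : ℝ≥0∞}
    (hf : ∀ i ∈ s, MemLp (f i) p volume) : MemLp (fun x => ∑ i ∈ s, f i x) p volume :=
  memLp_finsetSum s hf

lemma toL2_zero : toL2 (fun _ : R3 => (0 : F)) = 0 := by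
  have h : MemLp (0 : R3 → F) 2 volume := MemLp.zero
  exact (toL2_eq h).trans (MemLp.toLp_zero h)

lemma toL2_sum {ι : Type*} (s : Finset ι) {f : ι → R3 → F}
    (hf : ∀ i ∈ s, MemLp (f i) 2 volume) :
    toL2 (fun x => ∑ i ∈ s, f i x) = ∑ i ∈ s, toL2 (f i) := by
  classical
  induction s using Finset.induction_on with
  | empty => simpa only [Finset.sum_empty] using toL2_zero
  | insert i s hi ih =>
    simp only [Finset.sum_insert hi]
    rw [toL2_add (hf i (by simp)) (memLp_sum s fun j hj => hf j (by simp [hj])),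
      ih fun j hj => hf j (by simp [hj])]

lemma norm_toL2 {f : R3 → F} (h : MemLp f 2 volume) :
    ‖toL2 f‖ = (eLpNorm f 2 volume).toReal := by
  rw [toL2_eq h, Lp.norm_toLp]

lemma ofReal_norm_toL2 {f : R3 → F} (h : MemLp f 2 volume) :
    ENNReal.ofReal ‖toL2 f‖ = eLpNorm f 2 volume := by
  rw [norm_toL2 h, ENNReal.ofReal_toReal h.2.ne]

lemma norm_toL2_sq {f : R3 → F} (h : MemLp f 2 volume) : ‖toL2 f‖ ^ 2 = normSqL2 f := by
  rw [norm_toL2 h, ← ENNReal.toReal_pow, eLpNorm_two_sq, normSqL2,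
    integral_eq_lintegral_of_nonneg_ae (f := fun x => ‖f x‖ ^ 2)
      (Eventually.of_forall fun x => by positivity) (h.1.norm.pow 2)]
  congr 2
  ext x
  rw [ENNReal.ofReal_pow (norm_nonneg _), ofReal_norm]

lemma normSqL2_nonneg (f : R3 → F) : 0 ≤ normSqL2 f :=
  integral_nonneg fun x => by positivity

lemma norm_toL2_le {F' : Type*} [NormedAddCommGroup F'] {f : R3 → F} {g : R3 → F'}
    (hf : MemLp f 2 volume) (hg : MemLp g 2 volume) (h : ∀ᵐ x, ‖f x‖ ≤ ‖g x‖) :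
    ‖toL2 f‖ ≤ ‖toL2 g‖ := by
  rw [norm_toL2 hf, norm_toL2 hg]
  exact ENNReal.toReal_mono hg.2.ne (eLpNorm_mono_ae h)

lemma inner_toL2 [InnerProductSpace ℝ F] {f g : R3 → F} (hf : MemLp f 2 volume)
    (hg : MemLp g 2 volume) : inner ℝ (toL2 f) (toL2 g) = ∫ x, inner ℝ (f x) (g x) := by
  rw [L2.inner_def]
  refine integral_congr_ae ?_
  filter_upwards [coeFn_toL2 hf, coeFn_toL2 hg] with x h1 h2
  rw [h1, h2]

lemma toL2_coeFn (f : Lp F 2 (volume : Measure R3)) : toL2 (f : R3 → F) = f := by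
  rw [toL2_eq (Lp.memLp f), Lp.toLp_coeFn]

lemma toL2_clm {𝕜 : Type*} [NontriviallyNormedField 𝕜] {F' : Type*} [NormedAddCommGroup F']
    [NormedSpace 𝕜 F] [NormedSpace 𝕜 F'] (L : F →L[𝕜] F') {f : R3 → F}
    (hf : MemLp f 2 volume) : toL2 (fun x => L (f x)) = L.compLp (toL2 f) := by
  have hL : MemLp (fun x => L (f x)) 2 volume := L.comp_memLp' hf
  rw [toL2_eq hL]
  apply Lp.ext
  filter_upwards [hL.coeFn_toLp, L.coeFn_compLp (toL2 f), coeFn_toL2 hf] with x h1 h2 h3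
  rw [h1, h2, h3]

end L2

/-! ### The sharp Sobolev constant and its use for vector valued functions -/

section SobolevConst

instance : ENNReal.HolderTriple 3 6 2 := ⟨by
  rw [← ENNReal.toReal_eq_toReal_iff' (by simp) (by simp),
    ENNReal.toReal_add (by simp) (by simp)]
  simp; norm_num⟩

instance : ENNReal.HolderTriple 6 3 2 := ⟨by
  rw [← ENNReal.toReal_eq_toReal_iff' (by simp) (by simp),
    ENNReal.toReal_add (by simp) (by simp)]
  simp; norm_num⟩

lemma norm_toL2_eq_sqrt {F : Type*} [NormedAddCommGroup F] {f : R3 → F}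
    (h : MemLp f 2 volume) : ‖toL2 f‖ = Real.sqrt (normSqL2 f) := by
  rw [← norm_toL2_sq h, Real.sqrt_sq (norm_nonneg _)]

lemma gradNormSqL2_nonneg {F : Type*} [NormedAddCommGroup F] [NormedSpace ℝ F] (f : R3 → F) :
    0 ≤ gradNormSqL2 f := Finset.sum_nonneg fun _ _ => normSqL2_nonneg _

lemma sum_eLpNorm_weakPartial_le {F : Type*} [NormedAddCommGroup F] [NormedSpace ℝ F]
    [CompleteSpace F] {f : R3 → F} (h : HasL2Derivatives f) :
    ∑ k, eLpNorm (weakPartial k f) 2 volume ≤ ENNReal.ofReal (3 * Real.sqrt (gradNormSqL2 f)) := by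
  have : ∀ k ∈ Finset.univ, eLpNorm (weakPartial k f) 2 volume ≤
      ENNReal.ofReal (Real.sqrt (gradNormSqL2 f)) := by
    intro k _
    rw [← ofReal_norm_toL2 (h.memLp k), norm_toL2_eq_sqrt (h.memLp k)]
    refine ENNReal.ofReal_le_ofReal (Real.sqrt_le_sqrt ?_)
    exact Finset.single_le_sum (f := fun k => normSqL2 (weakPartial k f))
      (fun i _ => normSqL2_nonneg _) (Finset.mem_univ k)
  refine (Finset.sum_le_card_nsmul _ _ _ this).trans ?_
  rw [ENNReal.ofReal_mul (by norm_num)]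
  simp

/-- The set of admissible constants is nonempty by the Sobolev inequality just proved, bounded below
by 0 and closed, so it contains its infimum. -/
lemma sobolevConst_nonneg_and_spec : 0 ≤ sobolevConst ∧ ∀ A : R3 → ℝ, MemD1 A →
    eLpNorm A 6 volume ≤ ENNReal.ofReal (sobolevConst * Real.sqrt (gradNormSqL2 A)) := by
  set S := {K : ℝ | 0 ≤ K ∧ ∀ A : R3 → ℝ, MemD1 A →
    eLpNorm A 6 volume ≤ ENNReal.ofReal (K * Real.sqrt (gradNormSqL2 A))} with hS
  have hne : S.Nonempty := by
    obtain ⟨C, hC⟩ := exists_sobolev_weak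
    refine ⟨C * 3, by positivity, fun A hA => ?_⟩
    refine (hC A _ (fun k => hA.2.1.isWeakPartial k) (fun k => hA.2.1.memLp k) hA.2.2).trans ?_
    rw [mul_assoc, ENNReal.ofReal_mul (by positivity), ENNReal.ofReal_coe_nnreal]
    gcongr
    exact sum_eLpNorm_weakPartial_le hA.2.1
  have hbdd : BddBelow S := ⟨0, fun K hK => hK.1⟩
  have hclosed : IsClosed S := by
    have : S = {K : ℝ | 0 ≤ K} ∩ ⋂ A : R3 → ℝ, ⋂ _ : MemD1 A,
        {K : ℝ | eLpNorm A 6 volume ≤ ENNReal.ofReal (K * Real.sqrt (gradNormSqL2 A))} := by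
      ext K; simp [hS]
    rw [this]
    refine (isClosed_le continuous_const continuous_id).inter ?_
    refine isClosed_iInter fun A => isClosed_iInter fun _ => ?_
    exact isClosed_le continuous_const
      (ENNReal.continuous_ofReal.comp (continuous_id.mul continuous_const))
  exact hclosed.csInf_mem hne hbdd

lemma sobolevConst_nonneg : 0 ≤ sobolevConst := sobolevConst_nonneg_and_spec.1

variable {F : Type*} [NormedAddCommGroup F] [InnerProductSpace ℝ F] [FiniteDimensional ℝ F]

lemma MemH1.memD1 {F : Type*} [NormedAddCommGroup F] [NormedSpace ℝ F] {f : R3 → F}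
    (h : MemH1 f) : MemD1 f :=
  ⟨h.1.locallyIntegrable (by norm_num), h.2,
    fun _ ht => measure_level_lt_top (by norm_num) (by norm_num) h.1 ht⟩

lemma MemD1.inner_const {f : R3 → F} (h : MemD1 f) {e : F} (he : ‖e‖ = 1) :
    MemD1 fun x => inner ℝ e (f x) := by
  refine ⟨locallyIntegrable_clm_comp (innerSL ℝ e) h.1, fun k => ⟨_,
    (h.2.1.isWeakPartial k).clm_comp (innerSL ℝ e), (h.2.1.memLp k).const_inner e⟩,
    fun t ht => lt_of_le_of_lt (measure_mono fun x hx => ?_) (h.2.2 t ht)⟩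
  have hx' : t < ‖inner ℝ e (f x)‖ := hx
  refine lt_of_lt_of_le hx' ?_
  simpa [he] using norm_inner_le_norm (𝕜 := ℝ) e (f x)

lemma gradNormSqL2_eq_sum_inner {ι : Type*} [Fintype ι] (b : OrthonormalBasis ι ℝ F)
    {f : R3 → F} (h : MemD1 f) :
    gradNormSqL2 f = ∑ i, gradNormSqL2 fun x => inner ℝ (b i) (f x) := by
  simp only [gradNormSqL2]
  rw [Finset.sum_comm]
  refine Finset.sum_congr rfl fun k _ => ?_
  have e : ∀ i, normSqL2 (weakPartial k fun x => inner ℝ (b i) (f x))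
      = ∫ x, ‖inner ℝ (b i) (weakPartial k f x)‖ ^ 2 := by
    intro i
    refine integral_congr_ae ?_
    filter_upwards [((h.2.1.isWeakPartial k).clm_comp (innerSL ℝ (b i))).weakPartial_ae_eq]
      with x hx
    simp only [innerSL_apply_apply] at hx
    rw [hx]
  simp only [e]
  rw [← integral_finsetSum, normSqL2]
  · refine integral_congr_ae (Eventually.of_forall fun x => ?_)
    simp only [b.sum_sq_norm_inner_right]
  · intro i _
    have := (h.2.1.memLp k).const_inner (𝕜 := ℝ) (b i)
    exact (memLp_two_iff_integrable_sq_norm this.1).1 this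

lemma eLpNorm_sq_norm {E : Type*} [NormedAddCommGroup E] (f : R3 → E) :
    eLpNorm (fun x => ‖f x‖ ^ 2) 3 volume = eLpNorm f 6 volume ^ 2 := by
  have := eLpNorm_norm_rpow (p := 3) (μ := volume) f (q := 2) (by norm_num)
  have e : (3 : ℝ≥0∞) * ENNReal.ofReal 2 = 6 := by
    rw [ENNReal.ofReal_ofNat]; norm_num
  rw [e] at this
  simpa using this

/-- The Sobolev inequality for vector valued functions, with the scalar constant. -/
lemma MemD1.sobolev {f : R3 → F} (h : MemD1 f) :
    eLpNorm f 6 volume ≤ ENNReal.ofReal (sobolevConst * Real.sqrt (gradNormSqL2 f)) := by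
  set b := stdOrthonormalBasis ℝ F
  have hK := sobolevConst_nonneg
  apply le_of_sq_le_sq
  -- Minkowski's inequality is applied in L³ to |f|² = Σ|fᵢ|² rather than in L⁶ to f. This keeps the
  -- scalar constant, with no factor depending on the number of components.
  rw [← eLpNorm_sq_norm]
  have h1 : (fun x => ‖f x‖ ^ 2) = ∑ i, fun x => ‖inner ℝ (b i) (f x)‖ ^ 2 := by
    ext x; simp [← b.sum_sq_norm_inner_right]
  have hm : ∀ i, AEStronglyMeasurable (fun x => inner ℝ (b i) (f x)) volume := fun i =>
    (h.inner_const (b.orthonormal.1 i)).1.aestronglyMeasurable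
  rw [h1]
  refine (eLpNorm_sum_le (fun i _ => (hm i).norm.pow 2) (by norm_num)).trans ?_
  refine (Finset.sum_congr rfl fun i _ =>
    eLpNorm_sq_norm (fun x => inner ℝ (b i) (f x))).le.trans ?_
  have h2 : ∀ i, eLpNorm (fun x => inner ℝ (b i) (f x)) 6 volume ^ 2 ≤
      ENNReal.ofReal (sobolevConst ^ 2 * gradNormSqL2 fun x => inner ℝ (b i) (f x)) := by
    intro i
    refine (pow_le_pow_left' (sobolevConst_nonneg_and_spec.2 _
      (h.inner_const (b.orthonormal.1 i))) 2).trans ?_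
    rw [← ENNReal.ofReal_pow (by positivity), mul_pow, Real.sq_sqrt (gradNormSqL2_nonneg _)]
  refine (Finset.sum_le_sum fun i _ => h2 i).trans ?_
  rw [← ENNReal.ofReal_sum_of_nonneg
    (fun i _ => mul_nonneg (sq_nonneg _) (gradNormSqL2_nonneg _)),
    ← ENNReal.ofReal_pow (by positivity), ← Finset.mul_sum, ← gradNormSqL2_eq_sum_inner b h,
    mul_pow, Real.sq_sqrt (gradNormSqL2_nonneg _)]

lemma MemD1.memLp_six {f : R3 → F} (h : MemD1 f) : MemLp f 6 volume :=
  ⟨h.1.aestronglyMeasurable, h.sobolev.trans_lt ENNReal.ofReal_lt_top⟩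

/-- The `L⁶` norm. -/
def normL6 {F : Type*} [NormedAddCommGroup F] (f : R3 → F) : ℝ := (eLpNorm f 6 volume).toReal

lemma normL6_nonneg {F : Type*} [NormedAddCommGroup F] (f : R3 → F) : 0 ≤ normL6 f :=
  ENNReal.toReal_nonneg

lemma MemD1.normL6_le {f : R3 → F} (h : MemD1 f) :
    normL6 f ≤ sobolevConst * Real.sqrt (gradNormSqL2 f) :=
  ENNReal.toReal_le_of_le_ofReal (mul_nonneg sobolevConst_nonneg (Real.sqrt_nonneg _)) h.sobolev

/-- Split |ab|² as (a²|b|)·|b|, apply Cauchy-Schwarz, and then Hölder with exponents 3 and 6 to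
a²|b|. In the application b = |ψ|, so one factor is the fixed mass and the other is controlled by a
gradient. -/
lemma eLpNorm_mul_sq_le {a b : R3 → ℝ} (ha : AEStronglyMeasurable a volume)
    (hb : AEStronglyMeasurable b volume) :
    eLpNorm (fun x => a x * b x) 2 volume ^ 2 ≤
      eLpNorm a 6 volume ^ 2 * (eLpNorm b 2 volume * eLpNorm b 6 volume) := by
  have e1 : eLpNorm (fun x => a x * b x) 2 volume ^ 2
      = eLpNorm ((fun x => ‖a x‖ ^ 2 * ‖b x‖) • fun x => ‖b x‖) 1 volume := by
    rw [eLpNorm_two_sq, eLpNorm_one_eq_lintegral_enorm]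
    refine lintegral_congr fun x => ?_
    simp only [Pi.smul_apply', smul_eq_mul, enorm_mul, enorm_pow, enorm_norm]
    ring
  rw [e1]
  have hm : AEStronglyMeasurable (fun x => ‖a x‖ ^ 2 * ‖b x‖) volume :=
    (ha.norm.pow 2).mul hb.norm
  refine (eLpNorm_smul_le_mul_eLpNorm (p := 2) (q := 2) hb.norm hm).trans ?_
  have h2 := eLpNorm_smul_le_mul_eLpNorm (p := 3) (q := 6) (r := 2) hb.norm (ha.norm.pow 2)
  have h3 := eLpNorm_sq_norm a
  rw [eLpNorm_norm]
  refine (mul_le_mul_left h2 _).trans ?_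
  rw [eLpNorm_norm, show (fun x => ‖a x‖) ^ 2 = fun x => ‖a x‖ ^ 2 from rfl, h3]
  refine le_of_eq ?_
  ring

lemma memLp_mul_of_six {a b : R3 → ℝ} (ha : MemLp a 6 volume) (hb2 : MemLp b 2 volume)
    (hb6 : MemLp b 6 volume) : MemLp (fun x => a x * b x) 2 volume := by
  refine ⟨ha.1.mul hb2.1, ?_⟩
  have := (eLpNorm_mul_sq_le ha.1 hb2.1).trans_lt (ENNReal.mul_lt_top
    (ENNReal.pow_lt_top ha.2) (ENNReal.mul_lt_top hb2.2 hb6.2))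
  exact (ENNReal.pow_lt_top_iff.1 this).resolve_right (by norm_num)

end SobolevConst

/-! ### Density of test functions in H¹ -/

section Density

variable {F : Type*} [NormedAddCommGroup F] [NormedSpace ℝ F] [CompleteSpace F]

lemma tendsto_zero_of_sq {u : ℕ → ℝ≥0∞} (h : Tendsto (fun n => u n ^ 2) atTop (𝓝 0)) :
    Tendsto u atTop (𝓝 0) := by
  rw [ENNReal.tendsto_atTop_zero] at h ⊢
  intro ε hε
  obtain ⟨N, hN⟩ := h (ε ^ 2) (by positivity)
  exact ⟨N, fun n hn => le_of_sq_le_sq (hN n hn)⟩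

lemma eLpNorm_sub_cutoff_tendsto {f : R3 → F} (hf : MemLp f 2 volume) :
    Tendsto (fun n => eLpNorm (fun x => f x - cutoff n x • f x) 2 volume) atTop (𝓝 0) := by
  apply tendsto_zero_of_sq
  simp only [eLpNorm_two_sq]
  have h0 : (0 : ℝ≥0∞) = ∫⁻ _ : R3, 0 := by simp
  rw [h0]
  refine tendsto_lintegral_of_dominated_convergence' (fun x => ‖f x‖ₑ ^ 2) (fun n => ?_)
    (fun n => Eventually.of_forall fun x => ?_) ?_ (Eventually.of_forall fun x => ?_)
  · exact (hf.1.sub ((contDiff_cutoff n).continuous.aestronglyMeasurable.smul hf.1)).enorm.pow_const 2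
  · have h1 : f x - cutoff n x • f x = (1 - cutoff n x) • f x := by rw [sub_smul, one_smul]
    simp only [h1]
    gcongr
    rw [enorm_smul]
    refine mul_le_of_le_one_left (by positivity) ?_
    rw [← ofReal_norm, Real.norm_of_nonneg (by linarith [cutoff_le_one n x])]
    exact ENNReal.ofReal_le_one.2 (by linarith [cutoff_nonneg n x])
  · rw [← eLpNorm_two_sq]
    exact (ENNReal.pow_lt_top hf.2).ne
  · refine tendsto_const_nhds.congr' ?_
    filter_upwards [eventually_cutoff_eq_one x] with n hn
    simp [hn]

lemma memLp_cutoff_smul (n : ℕ) {p : ℝ≥0∞} {f : R3 → F} (hf : MemLp f p volume) :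
    MemLp (fun x => cutoff n x • f x) p volume :=
  ⟨(contDiff_cutoff n).continuous.aestronglyMeasurable.smul hf.1,
    (eLpNorm_cutoff_smul_le n p f).trans_lt hf.2⟩

lemma eLpNorm_sub_le_add {f g h : R3 → F} (hf : AEStronglyMeasurable f volume)
    (hg : AEStronglyMeasurable g volume) (hh : AEStronglyMeasurable h volume) :
    eLpNorm (fun x => f x - h x) 2 volume ≤
      eLpNorm (fun x => f x - g x) 2 volume + eLpNorm (fun x => g x - h x) 2 volume := by
  refine le_trans (le_of_eq ?_) (eLpNorm_add_le (hf.sub hg) (hg.sub hh) (by norm_num))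
  congr 1
  ext x
  simp

/-- Smooth compactly supported functions are dense in `H¹`. -/
lemma exists_contDiff_approx {f : R3 → F} {g : Fin 3 → R3 → F} (hf : MemLp f 2 volume)
    (h : ∀ k, IsWeakPartial k f (g k)) (hg : ∀ k, MemLp (g k) 2 volume) {ε : ℝ≥0∞}
    (hε : 0 < ε) : ∃ φ : R3 → F, ContDiff ℝ ∞ φ ∧ HasCompactSupport φ ∧
      eLpNorm (fun x => f x - φ x) 2 volume ≤ ε ∧
      ∀ k, eLpNorm (fun x => g k x - fderiv ℝ φ x (coordVec k)) 2 volume ≤ ε := by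
  obtain ⟨D, hD0, hD⟩ := exists_partial_cutoff_bound
  have hε3 : 0 < ε / 3 := ENNReal.div_pos hε.ne' (by norm_num)
  have e3 : ε / 3 + (ε / 3 + ε / 3) = ε := by rw [← add_assoc, ENNReal.add_thirds]
  have ev1 := ENNReal.tendsto_nhds_zero.1 (eLpNorm_sub_cutoff_tendsto hf) _ hε3
  have ev2 := eventually_all.2 fun k =>
    ENNReal.tendsto_nhds_zero.1 (eLpNorm_sub_cutoff_tendsto (hg k)) _ hε3
  have ev3 := ENNReal.tendsto_nhds_zero.1 (tendsto_ofReal_div_mul (D := D) hf.2.ne) _ hε3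
  obtain ⟨N, h1, h2, h3⟩ := (ev1.and (ev2.and ev3)).exists
  -- The cutoff comes first, so that the subsequent mollification has compact support.
  set f1 : R3 → F := fun x => cutoff N x • f x with hf1
  set g1 : Fin 3 → R3 → F := fun k x =>
    fderiv ℝ (cutoff N) x (coordVec k) • f x + cutoff N x • g k x with hg1
  have hw : ∀ k, IsWeakPartial k f1 (g1 k) := fun k => (h k).smul_of_contDiff (contDiff_cutoff N)
  have hm1 : MemLp f1 2 volume := memLp_cutoff_smul N hf
  have hmp : ∀ k, MemLp (fun x => fderiv ℝ (cutoff N) x (coordVec k) • f x) 2 volume := fun k =>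
    ⟨(continuous_partial (contDiff_cutoff N) (by simp) _).aestronglyMeasurable.smul hf.1,
      (eLpNorm_partial_cutoff_smul_le hD0 hD N k f).trans_lt
        (ENNReal.mul_lt_top ENNReal.ofReal_lt_top hf.2)⟩
  have hmg : ∀ k, MemLp (g1 k) 2 volume := fun k =>
    (hmp k).add (memLp_cutoff_smul N (hg k))
  have ev4 := ENNReal.tendsto_nhds_zero.1 (eLpNorm_sub_moll_tendsto hm1) _ hε3
  have ev5 := eventually_all.2 fun k =>
    ENNReal.tendsto_nhds_zero.1 (eLpNorm_sub_moll_tendsto (hmg k)) _ hε3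
  obtain ⟨n, h4, h5⟩ := (ev4.and ev5).exists
  have hloc : LocallyIntegrable f1 volume := hm1.locallyIntegrable (by norm_num)
  have hcm := contDiff_moll n hloc
  refine ⟨moll n f1, hcm, hasCompactSupport_moll n (hasCompactSupport_cutoff N).smul_right,
    ?_, fun k => ?_⟩
  · refine (eLpNorm_sub_le_add hf.1 hm1.1 hcm.continuous.aestronglyMeasurable).trans ?_
    refine (add_le_add h1 h4).trans ?_
    exact (add_le_add le_rfl le_self_add).trans e3.le
  · simp only [fderiv_moll n (hw k)]
    have hloc' : LocallyIntegrable (g1 k) volume := (hmg k).locallyIntegrable (by norm_num)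
    refine (eLpNorm_sub_le_add (hg k).1 (hmg k).1
      (contDiff_moll n hloc').continuous.aestronglyMeasurable).trans ?_
    have h6 : eLpNorm (fun x => g k x - g1 k x) 2 volume ≤ ε / 3 + ε / 3 := by
      refine (eLpNorm_sub_le_add (hg k).1 (memLp_cutoff_smul N (hg k)).1 (hmg k).1).trans ?_
      refine add_le_add (h2 k) (le_trans (le_of_eq ?_)
        ((eLpNorm_partial_cutoff_smul_le hD0 hD N k f).trans h3))
      rw [← eLpNorm_neg]
      congr 1
      ext x
      simp [hg1]
    refine (add_le_add h6 (h5 k)).trans ?_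
    rw [add_assoc, e3]

lemma norm_toL2_sub_le {f φ : R3 → F} (hf : MemLp f 2 volume) (hφ : MemLp φ 2 volume) {ε : ℝ}
    (hε : 0 ≤ ε) (h : eLpNorm (fun x => f x - φ x) 2 volume ≤ ENNReal.ofReal ε) :
    ‖toL2 φ - toL2 f‖ ≤ ε := by
  rw [norm_sub_rev, ← toL2_sub hf hφ, norm_toL2 (f := fun x => f x - φ x) (hf.sub hφ)]
  exact ENNReal.toReal_le_of_le_ofReal hε h

/-- `H¹` functions are limits of smooth compactly supported functions. -/
lemma MemH1.exists_seq {f : R3 → F} (hf : MemH1 f) : ∃ φ : ℕ → R3 → F,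
    (∀ n, ContDiff ℝ ∞ (φ n)) ∧ (∀ n, HasCompactSupport (φ n)) ∧
    Tendsto (fun n => toL2 (φ n)) atTop (𝓝 (toL2 f)) ∧
    ∀ k, Tendsto (fun n => toL2 fun x => fderiv ℝ (φ n) x (coordVec k)) atTop
      (𝓝 (toL2 (weakPartial k f))) := by
  choose φ h1 h2 h3 h4 using fun n : ℕ => exists_contDiff_approx hf.1 hf.2.isWeakPartial
    hf.2.memLp (ε := ENNReal.ofReal (1 / ((n : ℝ) + 1))) (by simp; positivity)
  refine ⟨φ, h1, h2, ?_, fun k => ?_⟩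
  · rw [tendsto_iff_norm_sub_tendsto_zero]
    refine squeeze_zero (fun _ => norm_nonneg _) (fun n => ?_)
      tendsto_one_div_add_atTop_nhds_zero_nat
    exact norm_toL2_sub_le hf.1 ((h1 n).continuous.memLp_of_hasCompactSupport (h2 n))
      (by positivity) (h3 n)
  · rw [tendsto_iff_norm_sub_tendsto_zero]
    refine squeeze_zero (fun _ => norm_nonneg _) (fun n => ?_)
      tendsto_one_div_add_atTop_nhds_zero_nat
    exact norm_toL2_sub_le (hf.2.memLp k) ((continuous_partial (h1 n) (by simp)
      _).memLp_of_hasCompactSupport (hasCompactSupport_partial (h2 n) _))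
      (by positivity) (h4 n k)

end Density

/-! ### Integration by parts for quadratic forms on H¹ -/

section IntegrationByParts

variable {F : Type*} [NormedAddCommGroup F] [InnerProductSpace ℝ F] [CompleteSpace F]

/-- The operator on `L²` acting pointwise by `T`. -/
def pointwiseOp (T : F →L[ℝ] F) : Lp F 2 (volume : Measure R3) →L[ℝ] Lp F 2 (volume : Measure R3) :=
  T.compLpL 2 volume

lemma pointwiseOp_toL2 (T : F →L[ℝ] F) {f : R3 → F} (hf : MemLp f 2 volume) :
    pointwiseOp T (toL2 f) = toL2 fun x => T (f x) := (toL2_clm T hf).symm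

lemma pointwiseOp_coeFn (T : F →L[ℝ] F) (f : Lp F 2 (volume : Measure R3)) :
    pointwiseOp T f =ᵐ[volume] fun x => T (f x) := T.coeFn_compLp f

lemma inner_pointwiseOp (T T' : F →L[ℝ] F) (h : ∀ x y, inner ℝ (T x) y = inner ℝ x (T' y))
    (x y : Lp F 2 (volume : Measure R3)) :
    inner ℝ (pointwiseOp T x) y = inner ℝ x (pointwiseOp T' y) := by
  rw [L2.inner_def, L2.inner_def]
  refine integral_congr_ae ?_
  filter_upwards [pointwiseOp_coeFn T x, pointwiseOp_coeFn T' y] with z h1 h2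
  rw [h1, h2, h]

lemma integrable_of_compactSupport {φ ψ : R3 → F} (hφ : Continuous φ) (hs : HasCompactSupport φ)
    (hψ : Continuous ψ) : Integrable fun x => inner ℝ (φ x) (ψ x) := by
  refine (hφ.inner hψ).integrable_of_hasCompactSupport (hs.mono fun x hx => ?_)
  contrapose! hx
  simp only [Function.mem_support, not_not] at hx ⊢
  simp [hx]

lemma integral_inner_partial_right (T : F →L[ℝ] F) {φ ψ : R3 → F} (hφ : ContDiff ℝ 1 φ)
    (hs : HasCompactSupport φ) (hψ : ContDiff ℝ 1 ψ) (v : R3) :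
    ∫ x, inner ℝ (φ x) (T (fderiv ℝ ψ x v)) = - ∫ x, inner ℝ (fderiv ℝ φ x v) (T (ψ x)) := by
  let B : F →L[ℝ] F →L[ℝ] ℝ :=
    (ContinuousLinearMap.compL ℝ F F ℝ).flip T ∘L (innerSL ℝ : F →L[ℝ] F →L[ℝ] ℝ)
  exact integral_bilinear_fderiv_right_eq_neg_left_of_integrable (B := B) (v := v)
    (integrable_of_compactSupport (continuous_partial hφ (by simp) v)
      (hasCompactSupport_partial hs v) (T.continuous.comp hψ.continuous))
    (integrable_of_compactSupport hφ.continuous hs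
      (T.continuous.comp (continuous_partial hψ (by simp) v)))
    (integrable_of_compactSupport hφ.continuous hs (T.continuous.comp hψ.continuous))
    (fun x _ => hφ.differentiable (by simp) x) (fun x _ => hψ.differentiable (by simp) x)

lemma memLp_of_contDiff {φ : R3 → F} (hφ : Continuous φ) (hs : HasCompactSupport φ) :
    MemLp φ 2 volume := hφ.memLp_of_hasCompactSupport hs

/-- `(f, T ∂ₖ f) = 0` for symmetric `T`. -/
lemma MemH1.inner_symm_partial {f : R3 → F} (hf : MemH1 f) (T : F →L[ℝ] F)
    (hT : ∀ x y, inner ℝ (T x) y = inner ℝ x (T y)) (k : Fin 3) :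
    inner ℝ (toL2 f) (pointwiseOp T (toL2 (weakPartial k f))) = 0 := by
  obtain ⟨φ, h1, h2, h3, h4⟩ := hf.exists_seq
  have hlim := h3.inner (((pointwiseOp T).continuous.tendsto _).comp (h4 k)) (𝕜 := ℝ)
  refine tendsto_nhds_unique hlim (tendsto_const_nhds.congr fun n => ?_)
  have hc := continuous_partial (h1 n) (by simp) (coordVec k)
  have hsp := hasCompactSupport_partial (h2 n) (coordVec k)
  have hm := memLp_of_contDiff hc hsp
  have hm0 := memLp_of_contDiff (h1 n).continuous (h2 n)
  simp only [Function.comp_def]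
  rw [pointwiseOp_toL2 T hm, inner_toL2 (g := fun x => T (fderiv ℝ (φ n) x (coordVec k))) hm0 (T.comp_memLp' hm)]
  -- Integration by parts gives (φ, T∂φ) = -(∂φ, Tφ), and by symmetry of T the right side is -(φ,
  -- T∂φ).
  have key := integral_inner_partial_right T ((h1 n).of_le (by simp)) (h2 n)
    ((h1 n).of_le (by simp)) (coordVec k)
  have e : ∫ x, inner ℝ (fderiv ℝ (φ n) x (coordVec k)) (T (φ n x))
      = ∫ x, inner ℝ (φ n x) (T (fderiv ℝ (φ n) x (coordVec k))) := by
    congr 1; ext x; rw [← hT, real_inner_comm]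
  rw [e] at key
  linarith

/-- `(∂ₐ f, S ∂ᵦ f) = 0` for antisymmetric `S`. -/
lemma MemH1.inner_antisymm_partial {f : R3 → F} (hf : MemH1 f) (S : F →L[ℝ] F)
    (hS : ∀ x y, inner ℝ (S x) y = - inner ℝ x (S y)) (a b : Fin 3) :
    inner ℝ (toL2 (weakPartial a f)) (pointwiseOp S (toL2 (weakPartial b f))) = 0 := by
  obtain ⟨φ, h1, h2, h3, h4⟩ := hf.exists_seq
  have hlim := (h4 a).inner (((pointwiseOp S).continuous.tendsto _).comp (h4 b)) (𝕜 := ℝ)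
  refine tendsto_nhds_unique hlim (tendsto_const_nhds.congr fun n => ?_)
  have hd : ∀ k, ContDiff ℝ 1 fun x => fderiv ℝ (φ n) x (coordVec k) := fun k =>
    (((h1 n).fderiv_right (m := (⊤ : ℕ∞)) (by simp)).of_le (by simp)).clm_apply contDiff_const
  have hsp := fun k => hasCompactSupport_partial (h2 n) (coordVec k)
  have hm := fun k => memLp_of_contDiff (hd k).continuous (hsp k)
  simp only [Function.comp_def]
  rw [pointwiseOp_toL2 S (hm b), inner_toL2
    (g := fun x => S (fderiv ℝ (φ n) x (coordVec b))) (hm a) (S.comp_memLp' (hm b))]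
  -- Two integrations by parts and the symmetry of second derivatives exchange a and b; the
  -- antisymmetry of S then equates the expression with its own negative.
  have k1 := integral_inner_partial_right S (hd a) (hsp a) ((h1 n).of_le (by simp)) (coordVec b)
  have k2 := integral_inner_partial_right S (hd b) (hsp b) ((h1 n).of_le (by simp)) (coordVec a)
  have hsymm : ∀ x, fderiv ℝ (fun x => fderiv ℝ (φ n) x (coordVec a)) x (coordVec b)
      = fderiv ℝ (fun x => fderiv ℝ (φ n) x (coordVec b)) x (coordVec a) := by
    intro x
    have hdd : DifferentiableAt ℝ (fderiv ℝ (φ n)) x :=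
      ((h1 n).fderiv_right (m := (⊤ : ℕ∞)) (by simp)).differentiable (by simp) x
    have hk : ∀ u w : R3, fderiv ℝ (fun x => fderiv ℝ (φ n) x u) x w
        = fderiv ℝ (fderiv ℝ (φ n)) x w u := by
      intro u w
      rw [fderiv_clm_apply hdd (differentiableAt_const _)]
      simp
    rw [hk, hk]
    exact ((h1 n).contDiffAt.isSymmSndFDerivAt (by
      simp only [minSmoothness_of_isRCLikeNormedField]
      exact WithTop.coe_le_coe.2 (le_top : (2 : ℕ∞) ≤ ⊤))) _ _
  simp only [hsymm] at k1
  have e : ∫ x, inner ℝ (fderiv ℝ (φ n) x (coordVec b)) (S (fderiv ℝ (φ n) x (coordVec a)))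
      = - ∫ x, inner ℝ (fderiv ℝ (φ n) x (coordVec a)) (S (fderiv ℝ (φ n) x (coordVec b))) := by
    rw [← integral_neg]
    congr 1; ext x; rw [← hS, real_inner_comm]
  linarith

end IntegrationByParts

/-! ### Pauli matrices and the identity for constant vector potentials -/

section Pauli

/-- The Pauli matrices as real linear maps. -/
def pauliR (k : Fin 3) : C2 →L[ℝ] C2 :=
  (LinearMap.toContinuousLinearMap (Matrix.toEuclideanLin (pauli k))).restrictScalars ℝ

/-- Multiplication by `i` as a real linear map. -/
def imulR : C2 →L[ℝ] C2 := (Complex.I • ContinuousLinearMap.id ℂ C2).restrictScalars ℝ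

lemma pauliR_apply (k : Fin 3) (x : C2) : pauliR k x = Matrix.toEuclideanLin (pauli k) x := rfl

lemma imulR_apply (x : C2) : imulR x = Complex.I • x := rfl

lemma inner_C2 (x y : C2) : (inner ℝ x y : ℝ) = (x 0).re * (y 0).re + (x 0).im * (y 0).im
    + ((x 1).re * (y 1).re + (x 1).im * (y 1).im) := by
  simp [PiLp.inner_apply, Fin.sum_univ_two, Complex.inner, Complex.mul_re]
  ring

lemma pauliR_zero_apply (x : C2) : pauliR 0 x = !₂[x 1, x 0] := by
  ext i
  fin_cases i <;> simp [pauliR_apply, Matrix.toLpLin_apply, pauli, dotProduct]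

lemma pauliR_one_apply (x : C2) : pauliR 1 x = !₂[-Complex.I * x 1, Complex.I * x 0] := by
  ext i
  fin_cases i <;> simp [pauliR_apply, Matrix.toLpLin_apply, pauli, dotProduct]

lemma pauliR_two_apply (x : C2) : pauliR 2 x = !₂[x 0, -x 1] := by
  ext i
  fin_cases i <;> simp [pauliR_apply, Matrix.toLpLin_apply, pauli, dotProduct]

lemma pauliR_symm (k : Fin 3) (x y : C2) :
    inner ℝ (pauliR k x) y = inner ℝ x (pauliR k y) := by
  rw [inner_C2, inner_C2]
  fin_cases k
  · simp [pauliR_zero_apply]; ring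
  · simp [pauliR_one_apply]; ring
  · simp [pauliR_two_apply]

lemma pauliR_sq (k : Fin 3) (x : C2) : pauliR k (pauliR k x) = x := by
  fin_cases k
  · ext i; fin_cases i <;> simp [pauliR_zero_apply]
  · ext i; fin_cases i <;> simp [pauliR_one_apply, ← mul_assoc]
  · ext i; fin_cases i <;> simp [pauliR_two_apply]

lemma pauliR_anticomm {a b : Fin 3} (hab : a ≠ b) (x : C2) :
    pauliR a (pauliR b x) = - pauliR b (pauliR a x) := by
  fin_cases a <;> fin_cases b <;>
    first
    | exact absurd rfl hab
    | (ext i; fin_cases i <;> simp [pauliR_zero_apply, pauliR_one_apply, pauliR_two_apply])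

lemma pauliR_smul (k : Fin 3) (a : ℂ) (x : C2) : pauliR k (a • x) = a • pauliR k x := by
  simp [pauliR_apply]

lemma norm_pauliR (k : Fin 3) (x : C2) : ‖pauliR k x‖ = ‖x‖ := by
  have : ‖pauliR k x‖ ^ 2 = ‖x‖ ^ 2 := by
    rw [← real_inner_self_eq_norm_sq, pauliR_symm, pauliR_sq, real_inner_self_eq_norm_sq]
  exact (sq_eq_sq₀ (norm_nonneg _) (norm_nonneg _)).1 this

/-- For a ≠ b the product of the two matrices is antisymmetric for the real inner product, since the
factors are symmetric and anticommute. -/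
lemma inner_pauliR_ne {a b : Fin 3} (hab : a ≠ b) (x : C2) :
    inner ℝ (pauliR a x) (pauliR b x) = 0 := by
  have h1 : inner ℝ (pauliR a x) (pauliR b x) = inner ℝ x (pauliR a (pauliR b x)) :=
    pauliR_symm a x _
  have h2 : inner ℝ (pauliR b x) (pauliR a x) = inner ℝ x (pauliR b (pauliR a x)) :=
    pauliR_symm b x _
  rw [pauliR_anticomm hab, inner_neg_right, ← h2, real_inner_comm (pauliR a x)] at h1
  linarith

/-- `|(σ · a) x| = |a| |x|` for real vectors `a`. -/
lemma norm_sum_pauliR (a : R3) (x : C2) : ‖∑ k, a k • pauliR k x‖ = ‖a‖ * ‖x‖ := by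
  have h : ‖∑ k, a k • pauliR k x‖ ^ 2 = (‖a‖ * ‖x‖) ^ 2 := by
    rw [← real_inner_self_eq_norm_sq, mul_pow, EuclideanSpace.norm_sq_eq]
    simp only [Fin.sum_univ_three, inner_add_left, inner_add_right, real_inner_smul_left,
      real_inner_smul_right, inner_pauliR_ne (show (0 : Fin 3) ≠ 1 by decide),
      inner_pauliR_ne (show (0 : Fin 3) ≠ 2 by decide),
      inner_pauliR_ne (show (1 : Fin 3) ≠ 0 by decide),
      inner_pauliR_ne (show (1 : Fin 3) ≠ 2 by decide),
      inner_pauliR_ne (show (2 : Fin 3) ≠ 0 by decide),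
      inner_pauliR_ne (show (2 : Fin 3) ≠ 1 by decide), real_inner_self_eq_norm_sq,
      norm_smul, mul_pow, norm_pauliR, Real.norm_eq_abs, sq_abs]
    ring
  exact (sq_eq_sq₀ (norm_nonneg _) (by positivity)).1 h

lemma imulR_antisymm (x y : C2) : inner ℝ (imulR x) y = - inner ℝ x (imulR y) := by
  rw [inner_C2, inner_C2]
  simp [imulR_apply]
  ring

lemma imulR_imulR (x : C2) : imulR (imulR x) = -x := by
  simp [imulR_apply, smul_smul]

lemma pauliR_imulR (k : Fin 3) (x : C2) : pauliR k (imulR x) = imulR (pauliR k x) :=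
  pauliR_smul k _ x

/-- The Hilbert space of square integrable spinors. -/
abbrev HC : Type := Lp C2 2 (volume : Measure R3)

/-- The Hilbert space of square integrable vector fields. -/
abbrev HR : Type := Lp R3 2 (volume : Measure R3)

lemma pointwiseOp_comp {F : Type*} [NormedAddCommGroup F] [InnerProductSpace ℝ F] [CompleteSpace F]
    (T S : F →L[ℝ] F) (x : Lp F 2 (volume : Measure R3)) :
    pointwiseOp (T ∘L S) x = pointwiseOp T (pointwiseOp S x) := by
  apply Lp.ext
  filter_upwards [pointwiseOp_coeFn (T ∘L S) x, pointwiseOp_coeFn T (pointwiseOp S x),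
    pointwiseOp_coeFn S x] with z h1 h2 h3
  rw [h1, h2, h3]; rfl

lemma pointwiseOp_imulR (x : HC) : pointwiseOp imulR x = Complex.I • x := by
  apply Lp.ext
  filter_upwards [pointwiseOp_coeFn imulR x, Lp.coeFn_smul Complex.I x] with z h1 h2
  rw [h1, h2]; rfl

lemma real_smul_HC (r : ℝ) (x : HC) : ((r : ℂ)) • x = r • x := by
  apply Lp.ext
  filter_upwards [Lp.coeFn_smul (r : ℂ) x, Lp.coeFn_smul r x] with z h1 h2
  rw [h1, h2]; ext i; simp

lemma I_mul_smul_HC (r : ℝ) (x : HC) :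
    (Complex.I * (r : ℂ)) • x = r • pointwiseOp imulR x := by
  rw [mul_comm, mul_smul, real_smul_HC, pointwiseOp_imulR]

/-- Off-diagonal terms of `‖σ · (iħ∇ + b) ψ‖²` vanish. -/
lemma MemH1.inner_pauli_ne {ψ : R3 → C2} (hψ : MemH1 ψ) (hbar : ℝ) (b : R3) {k l : Fin 3}
    (hkl : k ≠ l) :
    inner ℝ (pointwiseOp (pauliR k) ((Complex.I * (hbar : ℂ)) • toL2 (weakPartial k ψ)
        + b k • toL2 ψ))
      (pointwiseOp (pauliR l) ((Complex.I * (hbar : ℂ)) • toL2 (weakPartial l ψ)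
        + b l • toL2 ψ)) = 0 := by
  set S : C2 →L[ℝ] C2 := pauliR k ∘L pauliR l with hS
  set T : C2 →L[ℝ] C2 := S ∘L imulR with hT
  -- S = σₖσₗ is antisymmetric and commutes with i, hence T = S∘i is symmetric. The terms with two
  -- derivatives vanish by the antisymmetric rule, the mixed terms by the symmetric one, and (ψ, Sψ)
  -- = 0 pointwise.
  have hSa : ∀ x y, inner ℝ (S x) y = - inner ℝ x (S y) := by
    intro x y
    simp only [hS, ContinuousLinearMap.comp_apply]
    rw [pauliR_symm, pauliR_symm, pauliR_anticomm hkl.symm, inner_neg_right]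
  have hSI : ∀ x, S (imulR x) = imulR (S x) := fun x => by
    simp only [hS, ContinuousLinearMap.comp_apply, pauliR_imulR]
  have hTs : ∀ x y, inner ℝ (T x) y = inner ℝ x (T y) := by
    intro x y
    simp only [hT, ContinuousLinearMap.comp_apply]
    rw [hSa, imulR_antisymm, neg_neg, hSI]
  rw [inner_pointwiseOp (pauliR k) (pauliR k) (pauliR_symm k), ← pointwiseOp_comp, ← hS]
  have t1 := hψ.inner_antisymm_partial S hSa k l
  have t2 := hψ.inner_symm_partial T hTs k
  have t3 := hψ.inner_symm_partial T hTs l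
  have t4 : inner ℝ (toL2 ψ) (pointwiseOp S (toL2 ψ)) = 0 := by
    have := inner_pointwiseOp S (-S) (fun x y => by simp [hSa]) (toL2 ψ) (toL2 ψ)
    have e : pointwiseOp (-S) (toL2 ψ) = - pointwiseOp S (toL2 ψ) := by
      apply Lp.ext
      filter_upwards [pointwiseOp_coeFn (-S) (toL2 ψ), pointwiseOp_coeFn S (toL2 ψ),
        Lp.coeFn_neg (pointwiseOp S (toL2 ψ))] with z h1 h2 h3
      rw [h1, h3, Pi.neg_apply, h2]; rfl
    rw [e, inner_neg_right, real_inner_comm] at this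
    linarith
  have c1 : inner ℝ (pointwiseOp imulR (toL2 (weakPartial k ψ)))
      (pointwiseOp S (pointwiseOp imulR (toL2 (weakPartial l ψ)))) = 0 := by
    rw [← t1, ← pointwiseOp_comp, L2.inner_def, L2.inner_def]
    refine integral_congr_ae ?_
    filter_upwards [pointwiseOp_coeFn imulR (toL2 (weakPartial k ψ)),
      pointwiseOp_coeFn (S ∘L imulR) (toL2 (weakPartial l ψ)),
      pointwiseOp_coeFn S (toL2 (weakPartial l ψ))] with z h1 h2 h3
    rw [h1, h2, h3, ContinuousLinearMap.comp_apply, hSI, imulR_antisymm, imulR_imulR,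
      inner_neg_right, neg_neg]
  have c2 : inner ℝ (pointwiseOp imulR (toL2 (weakPartial k ψ)))
      (pointwiseOp S (toL2 ψ)) = 0 := by
    rw [← neg_eq_zero, ← t2, L2.inner_def, L2.inner_def, ← integral_neg]
    refine integral_congr_ae ?_
    filter_upwards [pointwiseOp_coeFn imulR (toL2 (weakPartial k ψ)),
      pointwiseOp_coeFn T (toL2 (weakPartial k ψ)),
      pointwiseOp_coeFn S (toL2 ψ)] with z h1 h2 h3
    rw [h1, h2, h3, ← hSa, real_inner_comm]
    rfl
  have c3 : inner ℝ (toL2 ψ)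
      (pointwiseOp S (pointwiseOp imulR (toL2 (weakPartial l ψ)))) = 0 := by
    rw [← pointwiseOp_comp]; exact t3
  simp only [I_mul_smul_HC, map_add, map_smul, inner_add_left, inner_add_right,
    real_inner_smul_left, real_inner_smul_right, c1, c2, c3, t4]
  simp

lemma norm_pointwiseOp_pauliR (k : Fin 3) (x : HC) : ‖pointwiseOp (pauliR k) x‖ = ‖x‖ := by
  have : ‖pointwiseOp (pauliR k) x‖ ^ 2 = ‖x‖ ^ 2 := by
    rw [← real_inner_self_eq_norm_sq, ← real_inner_self_eq_norm_sq, L2.inner_def, L2.inner_def]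
    refine integral_congr_ae ?_
    filter_upwards [pointwiseOp_coeFn (pauliR k) x] with z h1
    rw [h1, pauliR_symm, pauliR_sq]
  exact (sq_eq_sq₀ (norm_nonneg _) (norm_nonneg _)).1 this

/-- `‖σ · (iħ∇ + b) ψ‖ = ‖(iħ∇ + b) ψ‖` for constant real `b`. -/
lemma MemH1.pauli_identity {ψ : R3 → C2} (hψ : MemH1 ψ) (hbar : ℝ) (b : R3) :
    ‖∑ k, pointwiseOp (pauliR k) ((Complex.I * (hbar : ℂ)) • toL2 (weakPartial k ψ)
        + b k • toL2 ψ)‖ ^ 2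
      = ∑ k, ‖(Complex.I * (hbar : ℂ)) • toL2 (weakPartial k ψ) + b k • toL2 ψ‖ ^ 2 := by
  rw [← real_inner_self_eq_norm_sq, sum_inner]
  refine Finset.sum_congr rfl fun k _ => ?_
  rw [inner_sum, Finset.sum_eq_single k]
  · rw [real_inner_self_eq_norm_sq, norm_pointwiseOp_pauliR]
  · exact fun l _ hl => hψ.inner_pauli_ne hbar b hl.symm
  · simp

end Pauli

/-! ### The energy as an expression in Hilbert space -/

section HilbertEnergy

/-- The `L²` class of `A_k ψ`. -/
def prodL (A : R3 → R3) (ψ : R3 → C2) (k : Fin 3) : HC := toL2 fun x => A x k • ψ x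

/-- The `L²` class of `∂ₖ f`. -/
def gradL {F : Type*} [NormedAddCommGroup F] [NormedSpace ℝ F] (f : R3 → F) (k : Fin 3) :
    Lp F 2 (volume : Measure R3) := toL2 (weakPartial k f)

/-- The `k`-th covariant derivative in terms of `∂ₖψ` and `A_kψ`. -/
def covL (hbar c Q : ℝ) (d e : Fin 3 → HC) (k : Fin 3) : HC :=
  (Complex.I * (hbar : ℂ)) • d k + (Q / c) • e k

/-- `σ · w`. -/
def sigmaDot (w : Fin 3 → HC) : HC := ∑ k, pointwiseOp (pauliR k) (w k)

/-- The kinetic term as a function of the covariant derivatives. -/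
def kinL (j : Model) (w : Fin 3 → HC) : ℝ :=
  match j with
  | .S => ∑ k, ‖w k‖ ^ 2
  | .P => ‖sigmaDot w‖ ^ 2

/-- The field energy as a function of the derivatives of `A`. -/
def fieldL (c : ℝ) (v : R3) (g : Fin 3 → HR) : ℝ :=
  1 / (8 * Real.pi) * (∑ k, ‖g k‖ ^ 2 - ‖∑ k, (v k / c) • g k‖ ^ 2)

/-- The momentum term. -/
def momL (hbar : ℝ) (v : R3) (u : HC) (d : Fin 3 → HC) : ℝ :=
  inner ℝ u (∑ k, v k • (Complex.I * (hbar : ℂ)) • d k)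

lemma kinL_nonneg (j : Model) (w : Fin 3 → HC) : 0 ≤ kinL j w := by
  cases j
  · exact Finset.sum_nonneg fun k _ => sq_nonneg _
  · exact sq_nonneg _

lemma memLp_norm_mul_norm {A : R3 → R3} {ψ : R3 → C2} (hA : MemLp A 6 volume)
    (h2 : MemLp ψ 2 volume) (h6 : MemLp ψ 6 volume) :
    MemLp (fun x => ‖A x‖ * ‖ψ x‖) 2 volume :=
  memLp_mul_of_six hA.norm h2.norm h6.norm

lemma abs_coord_le (a : R3) (k : Fin 3) : |a k| ≤ ‖a‖ := by
  simpa using PiLp.norm_apply_le a k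

lemma aestronglyMeasurable_coord {A : R3 → R3} (hA : AEStronglyMeasurable A volume) (k : Fin 3) :
    AEStronglyMeasurable (fun x => A x k) volume :=
  (EuclideanSpace.proj k : R3 →L[ℝ] ℝ).continuous.comp_aestronglyMeasurable hA

lemma memLp_coord_smul {A : R3 → R3} {ψ : R3 → C2} (hA : MemLp A 6 volume)
    (h2 : MemLp ψ 2 volume) (h6 : MemLp ψ 6 volume) (k : Fin 3) :
    MemLp (fun x => A x k • ψ x) 2 volume := by
  refine (memLp_norm_mul_norm hA h2 h6).mono
    ((aestronglyMeasurable_coord hA.1 k).smul h2.1) (Eventually.of_forall fun x => ?_)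
  rw [norm_smul, Real.norm_of_nonneg (by positivity : 0 ≤ ‖A x‖ * ‖ψ x‖)]
  gcongr
  exact abs_coord_le _ _

/-- `‖ |A| |ψ| ‖` in `L²`. -/
def mixNorm (A : R3 → R3) (ψ : R3 → C2) : ℝ := ‖toL2 fun x => ‖A x‖ * ‖ψ x‖‖

lemma mixNorm_sq_le {A : R3 → R3} {ψ : R3 → C2} (hA : MemLp A 6 volume)
    (h2 : MemLp ψ 2 volume) (h6 : MemLp ψ 6 volume) :
    mixNorm A ψ ^ 2 ≤ normL6 A ^ 2 * (‖toL2 ψ‖ * normL6 ψ) := by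
  have h := eLpNorm_mul_sq_le hA.norm.1 h2.norm.1
  simp only [eLpNorm_norm] at h
  rw [mixNorm, norm_toL2 (memLp_norm_mul_norm hA h2 h6), norm_toL2 h2, normL6, normL6,
    ← ENNReal.toReal_pow, ← ENNReal.toReal_pow, ← ENNReal.toReal_mul, ← ENNReal.toReal_mul]
  exact ENNReal.toReal_mono (ENNReal.mul_lt_top
    (ENNReal.pow_lt_top hA.2) (ENNReal.mul_lt_top h2.2 h6.2)).ne h

lemma norm_prodL_le {A : R3 → R3} {ψ : R3 → C2} (hA : MemLp A 6 volume)
    (h2 : MemLp ψ 2 volume) (h6 : MemLp ψ 6 volume) (k : Fin 3) :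
    ‖prodL A ψ k‖ ≤ mixNorm A ψ := by
  refine norm_toL2_le (memLp_coord_smul hA h2 h6 k) (memLp_norm_mul_norm hA h2 h6)
    (Eventually.of_forall fun x => ?_)
  rw [norm_smul, Real.norm_of_nonneg (by positivity : 0 ≤ ‖A x‖ * ‖ψ x‖)]
  gcongr
  exact abs_coord_le _ _

lemma sum_norm_prodL_sq {A : R3 → R3} {ψ : R3 → C2} (hA : MemLp A 6 volume)
    (h2 : MemLp ψ 2 volume) (h6 : MemLp ψ 6 volume) :
    ∑ k, ‖prodL A ψ k‖ ^ 2 = mixNorm A ψ ^ 2 := by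
  have hm := memLp_coord_smul hA h2 h6
  rw [mixNorm, norm_toL2_sq (memLp_norm_mul_norm hA h2 h6)]
  simp only [prodL, norm_toL2_sq (hm _), normSqL2]
  rw [← integral_finsetSum _ fun k _ => (memLp_two_iff_integrable_sq_norm (hm k).1).1 (hm k)]
  refine integral_congr_ae (Eventually.of_forall fun x => ?_)
  simp only [norm_smul, mul_pow, norm_mul, norm_norm, ← Finset.sum_mul]
  rw [EuclideanSpace.norm_sq_eq (A x)]

/-- An equality and not merely a bound, since (σ·a)² = |a|² for real vectors a. The sharp threshold
in the Pauli case relies on this. -/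
lemma norm_sigmaDot_prodL {A : R3 → R3} {ψ : R3 → C2} (hA : MemLp A 6 volume)
    (h2 : MemLp ψ 2 volume) (h6 : MemLp ψ 6 volume) :
    ‖sigmaDot (prodL A ψ)‖ = mixNorm A ψ := by
  have hm := memLp_coord_smul hA h2 h6
  have e : sigmaDot (prodL A ψ) = toL2 fun x => ∑ k, A x k • pauliR k (ψ x) := by
    rw [toL2_sum Finset.univ (f := fun k x => A x k • pauliR k (ψ x)), sigmaDot]
    · refine Finset.sum_congr rfl fun k _ => ?_
      rw [prodL, pointwiseOp_toL2 _ (hm k)]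
      simp only [map_smul]
    · intro k _
      simpa only [Function.comp_def, map_smul] using (pauliR k).comp_memLp' (hm k)
  have hm' : MemLp (fun x => ∑ k, A x k • pauliR k (ψ x)) 2 volume :=
    memLp_sum _ fun k _ => by
      simpa only [Function.comp_def, map_smul] using (pauliR k).comp_memLp' (hm k)
  have hn := memLp_norm_mul_norm hA h2 h6
  rw [e, mixNorm]
  refine le_antisymm (norm_toL2_le hm' hn (Eventually.of_forall fun x => ?_))
    (norm_toL2_le hn hm' (Eventually.of_forall fun x => ?_)) <;>
  simp only [norm_sum_pauliR, norm_mul, norm_norm, le_refl]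

lemma MemH1.memLp_six {F : Type*} [NormedAddCommGroup F] [InnerProductSpace ℝ F]
    [FiniteDimensional ℝ F] {ψ : R3 → F} (h : MemH1 ψ) : MemLp ψ 6 volume := h.memD1.memLp_six

lemma gradNormSqL2_eq {F : Type*} [NormedAddCommGroup F] [NormedSpace ℝ F] [CompleteSpace F]
    {f : R3 → F} (h : HasL2Derivatives f) : gradNormSqL2 f = ∑ k, ‖gradL f k‖ ^ 2 := by
  simp only [gradNormSqL2, gradL, norm_toL2_sq (h.memLp _)]

lemma memLp_smulC {f : R3 → C2} (a : ℂ) (h : MemLp f 2 volume) :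
    MemLp (fun x => a • f x) 2 volume := h.const_smul a

lemma toL2_covDeriv {hbar c Q : ℝ} {A : R3 → R3} {ψ : R3 → C2} (hψ : MemH1 ψ) (hA : MemD1 A)
    (k : Fin 3) : MemLp (covDeriv hbar c Q A ψ k) 2 volume ∧
      toL2 (covDeriv hbar c Q A ψ k) = covL hbar c Q (gradL ψ) (prodL A ψ) k := by
  have hm := memLp_coord_smul hA.memLp_six hψ.1 hψ.memLp_six k
  have h1 := memLp_smulC (Complex.I * (hbar : ℂ)) (hψ.2.memLp k)
  have h2 : MemLp (fun x => (Q / c) • (A x k • ψ x)) 2 volume := hm.const_smul (Q / c)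
  have e : covDeriv hbar c Q A ψ k = fun x =>
      (Complex.I * (hbar : ℂ)) • weakPartial k ψ x + (Q / c) • (A x k • ψ x) := by
    ext x i
    simp [covDeriv]
    ring
  rw [e]
  exact ⟨h1.add h2, by rw [toL2_add h1 h2, toL2_smul _ (hψ.2.memLp k), toL2_smul _ hm]; rfl⟩

/-- Every later estimate and limit uses this form: each term is a quadratic expression in the L²
classes of ψ, ∂ₖψ, Aₖψ and ∂ₖA, to which weak convergence applies. -/
lemma energy_eq (m hbar c Q : ℝ) (j : Model) (v : R3) {A : R3 → R3} {ψ : R3 → C2}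
    (hψ : MemH1 ψ) (hA : MemD1 A) :
    energy m hbar c Q j v (ψ, A) = 1 / (2 * m) * kinL j (covL hbar c Q (gradL ψ) (prodL A ψ))
      + fieldL c v (gradL A) + momL hbar v (toL2 ψ) (gradL ψ) := by
  rw [energy]
  congr 1
  · congr 1
    · congr 1
      cases j
      · refine Finset.sum_congr rfl fun k _ => ?_
        rw [← (toL2_covDeriv hψ hA k).2, norm_toL2_sq (toL2_covDeriv hψ hA k).1]
      · have hp : ∀ k, MemLp (fun x => pauliR k (covDeriv hbar c Q A ψ k x)) 2 volume :=
          fun k => (pauliR k).comp_memLp' (toL2_covDeriv hψ hA k).1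
        have e : sigmaDot (covL hbar c Q (gradL ψ) (prodL A ψ))
            = toL2 (pauliDeriv hbar c Q A ψ) := by
          rw [show pauliDeriv hbar c Q A ψ = fun x => ∑ k, pauliR k (covDeriv hbar c Q A ψ k x)
            from rfl, toL2_sum _ fun k _ => hp k, sigmaDot]
          refine Finset.sum_congr rfl fun k _ => ?_
          rw [← (toL2_covDeriv hψ hA k).2, pointwiseOp_toL2 _ (toL2_covDeriv hψ hA k).1]
        rw [kinL, e, norm_toL2_sq (f := pauliDeriv hbar c Q A ψ)
          (memLp_sum Finset.univ fun k _ => hp k)]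
        rfl
    · rw [fieldL, gradNormSqL2_eq hA.2.1]
      congr 2
      have h1 : ∀ k ∈ Finset.univ, MemLp (fun x => (v k / c) • weakPartial k A x) 2 volume :=
        fun k _ => (hA.2.1.memLp k).const_smul (v k / c)
      rw [← norm_toL2_sq (memLp_sum Finset.univ h1), toL2_sum _ h1]
      congr 2
      exact Finset.sum_congr rfl fun k _ => toL2_smul _ (hA.2.1.memLp k)
  · have h1 : ∀ k ∈ Finset.univ, MemLp (fun x => v k • (Complex.I * (hbar : ℂ)) •
        weakPartial k ψ x) 2 volume :=
      fun k _ => (memLp_smulC _ (hψ.2.memLp k)).const_smul (v k)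
    have e : ∀ x, (Complex.I * (hbar : ℂ)) • ∑ k : Fin 3, ((v k : ℝ) : ℂ) • weakPartial k ψ x
        = ∑ k, v k • (Complex.I * (hbar : ℂ)) • weakPartial k ψ x := by
      intro x
      rw [Finset.smul_sum]
      refine Finset.sum_congr rfl fun k _ => ?_
      rw [smul_comm]
      ext i; simp
    have e2 : ∑ k, v k • (Complex.I * (hbar : ℂ)) • gradL ψ k
        = toL2 fun x => ∑ k, v k • (Complex.I * (hbar : ℂ)) • weakPartial k ψ x := by
      rw [toL2_sum _ h1]
      refine Finset.sum_congr rfl fun k _ => ?_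
      rw [toL2_smul _ (memLp_smulC _ (hψ.2.memLp k)), toL2_smul _ (hψ.2.memLp k)]
      rfl
    have hs := memLp_sum Finset.univ h1
    rw [momL, e2, inner_toL2 hψ.1 hs]
    simp only [e]
    have hi : Integrable (fun x => inner ℂ (ψ x)
        (∑ k, v k • (Complex.I * (hbar : ℂ)) • weakPartial k ψ x)) := by
      refine (L2.integrable_inner (𝕜 := ℂ) (toL2 ψ) (toL2 fun x => ∑ k, v k •
        (Complex.I * (hbar : ℂ)) • weakPartial k ψ x)).congr ?_
      filter_upwards [coeFn_toL2 hψ.1, coeFn_toL2 hs] with x h1 h2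
      rw [h1, h2]
    exact (integral_re hi).symm

lemma le_of_sq_le_sq_real {a b : ℝ} (h : a ^ 2 ≤ b ^ 2) (hb : 0 ≤ b) : a ≤ b :=
  (le_abs_self a).trans (abs_le_of_sq_le_sq h hb)

lemma norm_sum_smul_sq_le {H : Type*} [NormedAddCommGroup H] [NormedSpace ℝ H] (a : Fin 3 → ℝ)
    (g : Fin 3 → H) : ‖∑ k, a k • g k‖ ^ 2 ≤ (∑ k, a k ^ 2) * ∑ k, ‖g k‖ ^ 2 := by
  have h1 : ‖∑ k, a k • g k‖ ≤ ∑ k, |a k| * ‖g k‖ :=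
    (norm_sum_le _ _).trans (Finset.sum_le_sum fun k _ => by rw [norm_smul]; rfl)
  calc _ ≤ (∑ k, |a k| * ‖g k‖) ^ 2 := by gcongr
    _ ≤ (∑ k, |a k| ^ 2) * ∑ k, ‖g k‖ ^ 2 := Finset.sum_mul_sq_le_sq_mul_sq _ _ _
    _ = _ := by simp only [sq_abs]

/-- The coercivity constant of the field energy. -/
def fieldConst (c : ℝ) (v : R3) : ℝ := 1 / (8 * Real.pi) * (1 - ‖v‖ ^ 2 / c ^ 2)

lemma fieldConst_pos {c : ℝ} {v : R3} (hvc : ‖v‖ < c) : 0 < fieldConst c v := by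
  have hc : 0 < c := (norm_nonneg v).trans_lt hvc
  refine mul_pos (by positivity) ?_
  rw [sub_pos, div_lt_one (by positivity)]
  gcongr

/-- Cauchy-Schwarz over the three derivatives bounds the subtracted term by |v|²/c² times the full
gradient. -/
lemma fieldConst_mul_le (c : ℝ) (v : R3) (g : Fin 3 → HR) :
    fieldConst c v * ∑ k, ‖g k‖ ^ 2 ≤ fieldL c v g := by
  have h := norm_sum_smul_sq_le (fun k => v k / c) g
  have e : ∑ k, (v k / c) ^ 2 = ‖v‖ ^ 2 / c ^ 2 := by
    rw [EuclideanSpace.norm_sq_eq, Finset.sum_div]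
    refine Finset.sum_congr rfl fun k _ => ?_
    rw [div_pow, Real.norm_eq_abs, sq_abs]
  rw [e] at h
  rw [fieldConst, fieldL, mul_assoc]
  gcongr
  linarith

lemma fieldL_nonneg {c : ℝ} {v : R3} (hvc : ‖v‖ < c) (g : Fin 3 → HR) : 0 ≤ fieldL c v g :=
  (mul_nonneg (fieldConst_pos hvc).le (Finset.sum_nonneg fun _ _ => sq_nonneg _)).trans
    (fieldConst_mul_le c v g)

lemma norm_I_smul (hbar : ℝ) (hh : 0 < hbar) (x : HC) :
    ‖(Complex.I * (hbar : ℂ)) • x‖ = hbar * ‖x‖ := by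
  rw [norm_smul, norm_mul, Complex.norm_I, one_mul, Complex.norm_real, Real.norm_of_nonneg hh.le]

lemma abs_momL_le {hbar : ℝ} (hh : 0 < hbar) (v : R3) (u : HC) (d : Fin 3 → HC) :
    |momL hbar v u d| ≤ ‖v‖ * ‖u‖ * (hbar * Real.sqrt (∑ k, ‖d k‖ ^ 2)) := by
  have h := norm_sum_smul_sq_le (fun k => v k) fun k => (Complex.I * (hbar : ℂ)) • d k
  simp only [norm_I_smul hbar hh, mul_pow, ← Finset.mul_sum] at h
  have e : ∑ k, v k ^ 2 = ‖v‖ ^ 2 := by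
    rw [EuclideanSpace.norm_sq_eq]
    exact Finset.sum_congr rfl fun k _ => by rw [Real.norm_eq_abs, sq_abs]
  rw [e] at h
  have h2 : ‖∑ k, v k • (Complex.I * (hbar : ℂ)) • d k‖ ≤
      ‖v‖ * (hbar * Real.sqrt (∑ k, ‖d k‖ ^ 2)) := by
    refine le_of_sq_le_sq_real ?_ (by positivity)
    rwa [mul_pow, mul_pow, Real.sq_sqrt (Finset.sum_nonneg fun _ _ => sq_nonneg _)]
  refine (abs_real_inner_le_norm _ _).trans ?_
  calc _ ≤ ‖u‖ * (‖v‖ * (hbar * Real.sqrt (∑ k, ‖d k‖ ^ 2))) := by gcongr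
    _ = _ := by ring

end HilbertEnergy

/-! ### Linearity of gradients and of the products Aψ -/

section Linearity

variable {F : Type*} [NormedAddCommGroup F] [NormedSpace ℝ F] [CompleteSpace F]

lemma gradL_eq {f g : R3 → F} {k : Fin 3} (h : IsWeakPartial k f g) (hg : MemLp g 2 volume) :
    gradL f k = toL2 g :=
  (toL2_congr hg h.weakPartial_ae_eq.symm).symm

lemma memH1_of_contDiff {φ : R3 → F} (hφ : ContDiff ℝ 1 φ) (hs : HasCompactSupport φ) :
    MemH1 φ :=
  ⟨hφ.continuous.memLp_of_hasCompactSupport hs, fun k => ⟨_, isWeakPartial_of_contDiff hφ k,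
    (continuous_partial hφ (by simp) _).memLp_of_hasCompactSupport
      (hasCompactSupport_partial hs _)⟩⟩

lemma gradL_of_contDiff {φ : R3 → F} (hφ : ContDiff ℝ 1 φ) (hs : HasCompactSupport φ)
    (k : Fin 3) : gradL φ k = toL2 fun x => fderiv ℝ φ x (coordVec k) :=
  gradL_eq (isWeakPartial_of_contDiff hφ k)
    ((continuous_partial hφ (by simp) _).memLp_of_hasCompactSupport
      (hasCompactSupport_partial hs _))

lemma HasL2Derivatives.sub {f g : R3 → F} (hf : HasL2Derivatives f) (hg : HasL2Derivatives g) :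
    HasL2Derivatives (f - g) := fun k =>
  ⟨_, (hf.isWeakPartial k).sub (hg.isWeakPartial k), (hf.memLp k).sub (hg.memLp k)⟩

lemma gradL_sub {f g : R3 → F} (hf : HasL2Derivatives f) (hg : HasL2Derivatives g) (k : Fin 3) :
    gradL (f - g) k = gradL f k - gradL g k := by
  rw [gradL_eq ((hf.isWeakPartial k).sub (hg.isWeakPartial k)) ((hf.memLp k).sub (hg.memLp k))]
  exact toL2_sub (hf.memLp k) (hg.memLp k)

lemma HasL2Derivatives.const_smul {f : R3 → F} (hf : HasL2Derivatives f) (a : ℝ) :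
    HasL2Derivatives fun x => a • f x := fun k =>
  ⟨_, (hf.isWeakPartial k).const_smul a, (hf.memLp k).const_smul a⟩

lemma gradL_smul {f : R3 → F} (hf : HasL2Derivatives f) (a : ℝ) (k : Fin 3) :
    gradL (fun x => a • f x) k = a • gradL f k := by
  rw [gradL_eq ((hf.isWeakPartial k).const_smul a) ((hf.memLp k).const_smul a)]
  exact toL2_smul a (hf.memLp k)

lemma MemH1.sub {f g : R3 → F} (hf : MemH1 f) (hg : MemH1 g) : MemH1 (f - g) :=
  ⟨hf.1.sub hg.1, hf.2.sub hg.2⟩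

lemma MemH1.const_smul {f : R3 → F} (hf : MemH1 f) (a : ℝ) : MemH1 fun x => a • f x :=
  ⟨hf.1.const_smul a, hf.2.const_smul a⟩

lemma MemD1.sub {f g : R3 → F} (hf : MemD1 f) (hg : MemD1 g) : MemD1 (f - g) := by
  refine ⟨hf.1.sub hg.1, hf.2.1.sub hg.2.1, fun t ht => ?_⟩
  refine lt_of_le_of_lt (measure_mono (t := {x | t / 2 < ‖f x‖} ∪ {x | t / 2 < ‖g x‖})
    fun x hx => ?_) ((measure_union_le _ _).trans_lt (ENNReal.add_lt_top.2
      ⟨hf.2.2 _ (by positivity), hg.2.2 _ (by positivity)⟩))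
  by_contra hn
  simp only [Set.mem_union, Set.mem_ofPred_eq, not_or, not_lt, Pi.sub_apply] at hn hx
  linarith [norm_sub_le (f x) (g x), hn.1, hn.2]

lemma prodL_sub_right {A : R3 → R3} {ψ φ : R3 → C2} (hA : MemD1 A) (hψ : MemH1 ψ)
    (hφ : MemH1 φ) (k : Fin 3) : prodL A (ψ - φ) k = prodL A ψ k - prodL A φ k := by
  rw [prodL, prodL, prodL, ← toL2_sub (memLp_coord_smul hA.memLp_six hψ.1 hψ.memLp_six k)
    (memLp_coord_smul hA.memLp_six hφ.1 hφ.memLp_six k)]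
  congr 1; ext1 x; simp [smul_sub]

lemma prodL_sub_left {A B : R3 → R3} {ψ : R3 → C2} (hA : MemD1 A) (hB : MemD1 B)
    (hψ : MemH1 ψ) (k : Fin 3) : prodL (A - B) ψ k = prodL A ψ k - prodL B ψ k := by
  rw [prodL, prodL, prodL, ← toL2_sub (memLp_coord_smul hA.memLp_six hψ.1 hψ.memLp_six k)
    (memLp_coord_smul hB.memLp_six hψ.1 hψ.memLp_six k)]
  congr 1; ext1 x; simp [sub_smul]

lemma prodL_smul {A : R3 → R3} {ψ : R3 → C2} (hA : MemD1 A) (hψ : MemH1 ψ) (a : ℝ) (k : Fin 3) :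
    prodL A (fun x => a • ψ x) k = a • prodL A ψ k := by
  rw [prodL, prodL, ← toL2_smul a (memLp_coord_smul hA.memLp_six hψ.1 hψ.memLp_six k)]
  congr 1; ext1 x; rw [smul_comm]

lemma normL6_le_add {F : Type*} [NormedAddCommGroup F] {f g : R3 → F} (hf : MemLp f 6 volume)
    (hg : MemLp g 6 volume) : normL6 f ≤ normL6 g + normL6 (g - f) := by
  rw [normL6, normL6, normL6, ← ENNReal.toReal_add hg.2.ne (hg.sub hf).2.ne]
  refine ENNReal.toReal_mono (ENNReal.add_ne_top.2 ⟨hg.2.ne, (hg.sub hf).2.ne⟩) ?_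
  have := eLpNorm_sub_le hg.1 (hg.sub hf).1 (p := 6) (by norm_num)
  simpa using this

/-- The `ℓ²` norm of the derivatives. -/
def gradNorm (f : R3 → F) : ℝ := Real.sqrt (∑ k, ‖gradL f k‖ ^ 2)

lemma gradNorm_nonneg (f : R3 → F) : 0 ≤ gradNorm f := Real.sqrt_nonneg _

lemma gradNorm_sq (f : R3 → F) : gradNorm f ^ 2 = ∑ k, ‖gradL f k‖ ^ 2 :=
  Real.sq_sqrt (Finset.sum_nonneg fun _ _ => sq_nonneg _)

lemma norm_gradL_le (f : R3 → F) (k : Fin 3) : ‖gradL f k‖ ≤ gradNorm f :=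
  Real.le_sqrt_of_sq_le (Finset.single_le_sum (f := fun k => ‖gradL f k‖ ^ 2)
    (fun _ _ => sq_nonneg _) (Finset.mem_univ k))

lemma MemD1.normL6_le_gradNorm {F : Type*} [NormedAddCommGroup F] [InnerProductSpace ℝ F]
    [FiniteDimensional ℝ F] {f : R3 → F} (h : MemD1 f) :
    normL6 f ≤ sobolevConst * gradNorm f := by
  rw [gradNorm, ← gradNormSqL2_eq h.2.1]; exact h.normL6_le

lemma mixNorm_nonneg (A : R3 → R3) (ψ : R3 → C2) : 0 ≤ mixNorm A ψ := norm_nonneg _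

lemma tendsto_gradNorm_sub {f : ℕ → R3 → F} {f₀ : R3 → F} (hf : ∀ n, HasL2Derivatives (f n))
    (hf₀ : HasL2Derivatives f₀)
    (h : ∀ k, Tendsto (fun n => gradL (f n) k) atTop (𝓝 (gradL f₀ k))) :
    Tendsto (fun n => gradNorm (f n - f₀)) atTop (𝓝 0) := by
  have h1 : ∀ k, Tendsto (fun n => ‖gradL (f n - f₀) k‖ ^ 2) atTop (𝓝 0) := fun k => by
    simp only [gradL_sub (hf _) hf₀]
    simpa using (tendsto_iff_norm_sub_tendsto_zero.1 (h k)).pow 2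
  have h2 := (Real.continuous_sqrt.tendsto _).comp
    (tendsto_finsetSum Finset.univ fun k _ => h1 k)
  simpa [gradNorm, Function.comp_def] using h2

end Linearity

/-! ### The diamagnetic inequality -/

section Diamagnetic

lemma inner_I_smul_self (x : C2) : inner ℝ (imulR x) x = 0 := by
  have := imulR_antisymm x x
  rw [real_inner_comm] at this
  linarith [real_inner_comm x (imulR x)]

/-- The pointwise diamagnetic inequality. -/
lemma diamagnetic_pointwise {hbar : ℝ} (hh : 0 ≤ hbar) (a : ℝ) (x d : C2) :
    hbar * |inner ℝ x d| ≤ ‖x‖ * ‖(Complex.I * (hbar : ℂ)) • d + a • x‖ := by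
  -- Pairing with ix removes the potential, because a is real and ix is orthogonal to x in the real
  -- inner product.
  have e : inner ℝ (imulR x) ((Complex.I * (hbar : ℂ)) • d + a • x) = hbar * inner ℝ x d := by
    have h1 : (Complex.I * (hbar : ℂ)) • d = hbar • imulR d := by
      rw [imulR_apply]; ext i; simp; ring
    rw [inner_add_right, real_inner_smul_right, inner_I_smul_self, h1, real_inner_smul_right,
      imulR_antisymm, imulR_imulR, inner_neg_right]
    ring
  have h2 := abs_real_inner_le_norm (imulR x) ((Complex.I * (hbar : ℂ)) • d + a • x)
  have h3 : ‖imulR x‖ = ‖x‖ := by rw [imulR_apply, norm_smul]; simp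
  rwa [e, h3, abs_mul, abs_of_nonneg hh] at h2

/-- A smooth substitute for the modulus. -/
def smoothNorm (ε : ℝ) (φ : R3 → C2) (x : R3) : ℝ := Real.sqrt (‖φ x‖ ^ 2 + ε ^ 2) - ε

lemma contDiff_smoothNorm {ε : ℝ} (hε : 0 < ε) {φ : R3 → C2} (hφ : ContDiff ℝ 1 φ) :
    ContDiff ℝ 1 (smoothNorm ε φ) :=
  (((hφ.norm_sq ℝ).add contDiff_const).sqrt fun x => by positivity).sub contDiff_const

lemma hasCompactSupport_smoothNorm {ε : ℝ} (hε : 0 < ε) {φ : R3 → C2}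
    (hs : HasCompactSupport φ) : HasCompactSupport (smoothNorm ε φ) :=
  hs.comp_left (g := fun z : C2 => Real.sqrt (‖z‖ ^ 2 + ε ^ 2) - ε)
    (by simp [Real.sqrt_sq hε.le])

lemma fderiv_smoothNorm {ε : ℝ} (hε : 0 < ε) {φ : R3 → C2} (hφ : ContDiff ℝ 1 φ) (x y : R3) :
    fderiv ℝ (smoothNorm ε φ) x y
      = inner ℝ (φ x) (fderiv ℝ φ x y) / Real.sqrt (‖φ x‖ ^ 2 + ε ^ 2) := by
  have h1 := (hφ.differentiable (by simp) x).hasFDerivAt.norm_sq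
  have h2 := ((h1.add_const (ε ^ 2)).sqrt (by positivity)).sub_const ε
  rw [show smoothNorm ε φ = fun x => Real.sqrt (‖φ x‖ ^ 2 + ε ^ 2) - ε from rfl, h2.fderiv]
  simp only [smul_apply, ContinuousLinearMap.comp_apply, innerSL_apply_apply, smul_eq_mul]
  have : (2 : ℕ) • inner ℝ (φ x) (fderiv ℝ φ x y) = 2 * inner ℝ (φ x) (fderiv ℝ φ x y) := by
    rw [two_nsmul, two_mul]
  rw [this]
  field_simp

lemma tendsto_smoothNorm (φ : R3 → C2) (x : R3) :
    Tendsto (fun n : ℕ => smoothNorm (1 / ((n : ℝ) + 1)) φ x) atTop (𝓝 ‖φ x‖) := by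
  have h := tendsto_one_div_add_atTop_nhds_zero_nat (𝕜 := ℝ)
  have h1 : Continuous fun ε : ℝ => Real.sqrt (‖φ x‖ ^ 2 + ε ^ 2) - ε := by fun_prop
  have h2 := (h1.tendsto 0).comp h
  simpa [smoothNorm, Function.comp_def, Real.sqrt_sq] using h2

/-- The Sobolev inequality is applied to the regularized modulus, whose partial derivatives are
pointwise at most 1/ħ times the covariant ones. The regularization ε → 0 is removed by Fatou's
lemma. -/
lemma diamagnetic_of_contDiff {hbar c Q : ℝ} (hh : 0 < hbar) {A : R3 → R3} (hA : MemD1 A)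
    {φ : R3 → C2} (hφ : ContDiff ℝ 1 φ) (hs : HasCompactSupport φ) :
    hbar * normL6 φ ≤
      sobolevConst * Real.sqrt (∑ k, ‖covL hbar c Q (gradL φ) (prodL A φ) k‖ ^ 2) := by
  have hφ1 := memH1_of_contDiff hφ hs
  set W := Real.sqrt (∑ k, ‖covL hbar c Q (gradL φ) (prodL A φ) k‖ ^ 2) with hW
  have hW0 : 0 ≤ W := Real.sqrt_nonneg _
  have hK := sobolevConst_nonneg
  have hbound : ∀ n : ℕ, eLpNorm (smoothNorm (1 / ((n : ℝ) + 1)) φ) 6 volume ≤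
      ENNReal.ofReal (sobolevConst * (W / hbar)) := by
    intro n
    set ε : ℝ := 1 / ((n : ℝ) + 1) with hε
    have hε0 : 0 < ε := by positivity
    have hc1 := contDiff_smoothNorm hε0 hφ
    have hs1 := hasCompactSupport_smoothNorm hε0 hs
    have hu := memH1_of_contDiff hc1 hs1
    refine hu.memD1.sobolev.trans (ENNReal.ofReal_le_ofReal ?_)
    refine mul_le_mul_of_nonneg_left ?_ hK
    rw [gradNormSqL2_eq hu.2]
    refine (Real.sqrt_le_left (by positivity)).2 ?_
    rw [div_pow, hW, Real.sq_sqrt (Finset.sum_nonneg fun _ _ => sq_nonneg _), Finset.sum_div]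
    refine Finset.sum_le_sum fun k _ => ?_
    rw [← div_pow]
    refine pow_le_pow_left₀ (norm_nonneg _) ?_ 2
    rw [le_div_iff₀ hh, mul_comm, ← abs_of_pos hh, ← Real.norm_eq_abs, ← norm_smul,
      gradL_of_contDiff hc1 hs1]
    have hm : MemLp (fun x => fderiv ℝ (smoothNorm ε φ) x (coordVec k)) 2 volume :=
      (continuous_partial hc1 (by simp) _).memLp_of_hasCompactSupport
        (hasCompactSupport_partial hs1 _)
    rw [← toL2_smul hbar hm, ← (toL2_covDeriv hφ1 hA k).2]
    refine norm_toL2_le (hm.const_smul hbar) (toL2_covDeriv hφ1 hA k).1 ?_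
    filter_upwards [(isWeakPartial_of_contDiff hφ k).weakPartial_ae_eq] with x hx
    rw [covDeriv, hx, fderiv_smoothNorm hε0 hφ]
    have key := diamagnetic_pointwise hh.le (Q / c * A x k) (φ x) (fderiv ℝ φ x (coordVec k))
    have e : ((Q / c * A x k : ℝ) : ℂ) • φ x = (Q / c * A x k) • φ x := by ext i; simp
    rw [e, smul_eq_mul, norm_mul, norm_div, Real.norm_eq_abs, Real.norm_eq_abs,
      Real.norm_eq_abs, abs_of_pos hh, abs_of_nonneg (Real.sqrt_nonneg _), ← mul_div_assoc,
      div_le_iff₀ (Real.sqrt_pos.2 (by positivity))]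
    refine key.trans ?_
    rw [mul_comm]
    gcongr
    refine Real.le_sqrt_of_sq_le ?_
    nlinarith [sq_nonneg ε]
  have h6 : eLpNorm φ 6 volume ≤ ENNReal.ofReal (sobolevConst * (W / hbar)) := by
    rw [← eLpNorm_norm]
    exact eLpNorm_le_of_tendsto_ae
      (fun n => (contDiff_smoothNorm (by positivity) hφ).continuous.aestronglyMeasurable)
      (Eventually.of_forall fun x => tendsto_smoothNorm φ x) hbound tendsto_const_nhds
  have := ENNReal.toReal_le_of_le_ofReal (by positivity) h6
  calc hbar * normL6 φ ≤ hbar * (sobolevConst * (W / hbar)) := by gcongr; exact this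
    _ = sobolevConst * W := by field_simp

/-- The diamagnetic Sobolev inequality. -/
lemma diamagnetic {hbar c Q : ℝ} (hh : 0 < hbar) {A : R3 → R3} (hA : MemD1 A)
    {ψ : R3 → C2} (hψ : MemH1 ψ) :
    hbar * normL6 ψ ≤
      sobolevConst * Real.sqrt (∑ k, ‖covL hbar c Q (gradL ψ) (prodL A ψ) k‖ ^ 2) := by
  obtain ⟨φ, h1, h2, h3, h4⟩ := hψ.exists_seq
  have hcd : ∀ n, ContDiff ℝ 1 (φ n) := fun n => (h1 n).of_le (by simp)
  have hH : ∀ n, MemH1 (φ n) := fun n => memH1_of_contDiff (hcd n) (h2 n)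
  have h4' : ∀ k, Tendsto (fun n => gradL (φ n) k) atTop (𝓝 (gradL ψ k)) := fun k => by
    simp only [gradL_of_contDiff (hcd _) (h2 _)]; exact h4 k
  have hg := tendsto_gradNorm_sub (fun n => (hH n).2) hψ.2 h4'
  have h6 : Tendsto (fun n => normL6 (φ n - ψ)) atTop (𝓝 0) := by
    refine squeeze_zero (fun n => normL6_nonneg _)
      (fun n => ((hH n).sub hψ).memD1.normL6_le_gradNorm) ?_
    simpa using hg.const_mul sobolevConst
  have hu : Tendsto (fun n => ‖toL2 (φ n - ψ)‖) atTop (𝓝 0) := by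
    have := tendsto_iff_norm_sub_tendsto_zero.1 h3
    refine this.congr fun n => ?_
    rw [← toL2_sub (hH n).1 hψ.1]; rfl
  -- For fixed A, multiplication by A is continuous from H¹ to L²; hence the covariant derivatives
  -- of the approximants converge.
  have hmix : Tendsto (fun n => mixNorm A (φ n - ψ) ^ 2) atTop (𝓝 0) := by
    refine squeeze_zero (fun n => sq_nonneg _) (fun n => mixNorm_sq_le hA.memLp_six
      ((hH n).sub hψ).1 ((hH n).sub hψ).memLp_six) ?_
    simpa using (hu.mul h6).const_mul (normL6 A ^ 2)
  have hmix' : Tendsto (fun n => mixNorm A (φ n - ψ)) atTop (𝓝 0) := by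
    have := (Real.continuous_sqrt.tendsto 0).comp hmix
    simpa [Function.comp_def, Real.sqrt_sq (mixNorm_nonneg _ _)] using this
  have hp : ∀ k, Tendsto (fun n => prodL A (φ n) k) atTop (𝓝 (prodL A ψ k)) := fun k => by
    rw [tendsto_iff_norm_sub_tendsto_zero]
    refine squeeze_zero (fun n => norm_nonneg _) (fun n => ?_) hmix'
    rw [← prodL_sub_right hA (hH n) hψ]
    exact norm_prodL_le hA.memLp_six ((hH n).sub hψ).1 ((hH n).sub hψ).memLp_six k
  have hcov : ∀ k, Tendsto (fun n => covL hbar c Q (gradL (φ n)) (prodL A (φ n)) k) atTop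
      (𝓝 (covL hbar c Q (gradL ψ) (prodL A ψ) k)) := fun k =>
    ((h4' k).const_smul _).add ((hp k).const_smul _)
  have hR := ((Real.continuous_sqrt.tendsto _).comp (tendsto_finsetSum Finset.univ
    fun k _ => ((hcov k).norm.pow 2))).const_mul sobolevConst
  have hL : Tendsto (fun n => hbar * (normL6 ψ - normL6 (φ n - ψ))) atTop
      (𝓝 (hbar * (normL6 ψ - 0))) := (tendsto_const_nhds.sub h6).const_mul hbar
  rw [sub_zero] at hL
  refine le_of_tendsto_of_tendsto' hL hR fun n => ?_
  refine le_trans ?_ (diamagnetic_of_contDiff hh hA (hcd n) (h2 n))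
  gcongr
  linarith [normL6_le_add hψ.memLp_six (hH n).memLp_six]

end Diamagnetic

/-! ### Completing the square in the kinetic energy -/

section LowerBounds

lemma sigmaDot_add (w z : Fin 3 → HC) : sigmaDot (fun k => w k + z k) = sigmaDot w + sigmaDot z := by
  simp only [sigmaDot, map_add, Finset.sum_add_distrib]

lemma sigmaDot_smul (a : ℝ) (w : Fin 3 → HC) : sigmaDot (fun k => a • w k) = a • sigmaDot w := by
  simp only [sigmaDot, map_smul, Finset.smul_sum]

/-- The coupling term `(ψ, v · A ψ)`. -/
def coupling (v : R3) (A : R3 → R3) (ψ : R3 → C2) : ℝ :=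
  inner ℝ (toL2 ψ) (∑ k, v k • prodL A ψ k)

lemma sum_coord_sq (v : R3) : ∑ k, v k ^ 2 = ‖v‖ ^ 2 := by
  rw [EuclideanSpace.norm_sq_eq]
  exact Finset.sum_congr rfl fun k _ => by rw [Real.norm_eq_abs, sq_abs]

lemma abs_inner_sum_le {H : Type*} [NormedAddCommGroup H] [InnerProductSpace ℝ H] (v : R3)
    (u : H) (w : Fin 3 → H) :
    |inner ℝ u (∑ k, v k • w k)| ≤ ‖v‖ * ‖u‖ * Real.sqrt (∑ k, ‖w k‖ ^ 2) := by
  have h := norm_sum_smul_sq_le (fun k => v k) w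
  rw [sum_coord_sq] at h
  have h2 : ‖∑ k, v k • w k‖ ≤ ‖v‖ * Real.sqrt (∑ k, ‖w k‖ ^ 2) := by
    refine le_of_sq_le_sq_real ?_ (by positivity)
    rwa [mul_pow, Real.sq_sqrt (Finset.sum_nonneg fun _ _ => sq_nonneg _)]
  refine (abs_real_inner_le_norm _ _).trans ?_
  calc _ ≤ ‖u‖ * (‖v‖ * Real.sqrt (∑ k, ‖w k‖ ^ 2)) := by gcongr
    _ = _ := by ring

lemma abs_coupling_le (v : R3) {A : R3 → R3} (hA : MemD1 A) {ψ : R3 → C2} (hψ : MemH1 ψ) :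
    |coupling v A ψ| ≤ ‖v‖ * ‖toL2 ψ‖ * mixNorm A ψ := by
  have := abs_inner_sum_le v (toL2 ψ) (prodL A ψ)
  rwa [sum_norm_prodL_sq hA.memLp_six hψ.1 hψ.memLp_six, Real.sqrt_sq (mixNorm_nonneg _ _)]
    at this

/-- The momentum term is the pairing of ψ with the covariant derivative along v, minus Q/c times the
coupling. The first part can be absorbed by the kinetic energy, the second is the only attraction.
-/
lemma momL_eq (hbar c Q : ℝ) (v : R3) (u : HC) (d e : Fin 3 → HC) :
    momL hbar v u d = inner ℝ u (∑ k, v k • covL hbar c Q d e k)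
      - Q / c * inner ℝ u (∑ k, v k • e k) := by
  have h : ∑ k, v k • covL hbar c Q d e k
      = ∑ k, v k • (Complex.I * (hbar : ℂ)) • d k + (Q / c) • ∑ k, v k • e k := by
    simp only [covL, smul_add, Finset.sum_add_distrib, Finset.smul_sum, smul_comm (Q / c)]
  rw [h, inner_add_right, real_inner_smul_right, momL]
  ring

lemma MemH1.norm_sigmaDot_const {ψ : R3 → C2} (hψ : MemH1 ψ) (v : R3) :
    ‖sigmaDot fun k => v k • toL2 ψ‖ ^ 2 = ‖v‖ ^ 2 * ‖toL2 ψ‖ ^ 2 := by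
  have h := hψ.pauli_identity 0 v
  simp only [Complex.ofReal_zero, mul_zero, zero_smul, zero_add] at h
  rw [sigmaDot, h, ← sum_coord_sq, Finset.sum_mul]
  exact Finset.sum_congr rfl fun k _ => by rw [norm_smul, mul_pow, Real.norm_eq_abs, sq_abs]

/-- Polarization of the Pauli identity: its values at b = v and b = 0 are compared, and the terms
linear in v remain. -/
lemma MemH1.inner_sigmaDot_grad {ψ : R3 → C2} (hψ : MemH1 ψ) (hbar : ℝ) (v : R3) :
    inner ℝ (sigmaDot fun k => (Complex.I * (hbar : ℂ)) • gradL ψ k)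
        (sigmaDot fun k => v k • toL2 ψ)
      = ∑ k, v k * inner ℝ ((Complex.I * (hbar : ℂ)) • gradL ψ k) (toL2 ψ) := by
  have h1 := hψ.pauli_identity hbar v
  have h2 := hψ.pauli_identity hbar 0
  simp only [PiLp.zero_apply, zero_smul, add_zero] at h2
  have h3 := hψ.norm_sigmaDot_const v
  have e := sigmaDot_add (fun k => (Complex.I * (hbar : ℂ)) • gradL ψ k) fun k => v k • toL2 ψ
  change ‖sigmaDot fun k => (Complex.I * (hbar : ℂ)) • gradL ψ k + v k • toL2 ψ‖ ^ 2
    = ∑ k, ‖(Complex.I * (hbar : ℂ)) • gradL ψ k + v k • toL2 ψ‖ ^ 2 at h1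
  change ‖sigmaDot fun k => (Complex.I * (hbar : ℂ)) • gradL ψ k‖ ^ 2
    = ∑ k, ‖(Complex.I * (hbar : ℂ)) • gradL ψ k‖ ^ 2 at h2
  rw [e, norm_add_sq_real, h2, h3] at h1
  simp only [norm_add_sq_real, Finset.sum_add_distrib, norm_smul _ (toL2 ψ), mul_pow,
    Real.norm_eq_abs, sq_abs, ← Finset.sum_mul, sum_coord_sq, real_inner_smul_right,
    ← Finset.mul_sum] at h1
  linarith

lemma inner_pauli_prodL {A : R3 → R3} {ψ : R3 → C2} (hA : MemD1 A) (hψ : MemH1 ψ) {k l : Fin 3}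
    (hkl : k ≠ l) :
    inner ℝ (pointwiseOp (pauliR k) (prodL A ψ k)) (pointwiseOp (pauliR l) (toL2 ψ)) = 0 := by
  have hm := memLp_coord_smul hA.memLp_six hψ.1 hψ.memLp_six k
  rw [prodL, pointwiseOp_toL2 _ hm, pointwiseOp_toL2 _ hψ.1,
    inner_toL2 (f := fun x => pauliR k (A x k • ψ x)) (g := fun x => pauliR l (ψ x))
      ((pauliR k).comp_memLp' hm) ((pauliR l).comp_memLp' hψ.1)]
  simp [real_inner_smul_left, inner_pauliR_ne hkl]

lemma inner_pauli_prodL_self (A : R3 → R3) (ψ : R3 → C2) (k : Fin 3) :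
    inner ℝ (pointwiseOp (pauliR k) (prodL A ψ k)) (pointwiseOp (pauliR k) (toL2 ψ))
      = inner ℝ (prodL A ψ k) (toL2 ψ) := by
  rw [L2.inner_def, L2.inner_def]
  refine integral_congr_ae ?_
  filter_upwards [pointwiseOp_coeFn (pauliR k) (prodL A ψ k),
    pointwiseOp_coeFn (pauliR k) (toL2 ψ)] with x h1 h2
  rw [h1, h2, pauliR_symm, pauliR_sq]

/-- The off-diagonal terms vanish already pointwise, since σₖψ and σₗψ are orthogonal for k ≠ l and
Aₖ is a real scalar. -/
lemma inner_sigmaDot_prodL {A : R3 → R3} {ψ : R3 → C2} (hA : MemD1 A) (hψ : MemH1 ψ) (v : R3) :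
    inner ℝ (sigmaDot (prodL A ψ)) (sigmaDot fun k => v k • toL2 ψ)
      = ∑ k, v k * inner ℝ (prodL A ψ k) (toL2 ψ) := by
  rw [sigmaDot, sigmaDot, sum_inner]
  refine Finset.sum_congr rfl fun k _ => ?_
  rw [inner_sum, Finset.sum_eq_single k]
  · rw [map_smul, real_inner_smul_right, inner_pauli_prodL_self]
  · intro l _ hl
    rw [map_smul, real_inner_smul_right, inner_pauli_prodL hA hψ hl.symm, mul_zero]
  · simp

lemma sigmaDot_covL (hbar c Q : ℝ) (d e : Fin 3 → HC) : sigmaDot (covL hbar c Q d e)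
    = (sigmaDot fun k => (Complex.I * (hbar : ℂ)) • d k) + (Q / c) • sigmaDot e := by
  rw [← sigmaDot_smul, ← sigmaDot_add]; rfl

/-- Completing the square in the kinetic term. -/
lemma kinL_add_inner_ge {m : ℝ} (hm : 0 < m) (hbar c Q : ℝ) (j : Model) (v : R3) {A : R3 → R3}
    {ψ : R3 → C2} (hA : MemD1 A) (hψ : MemH1 ψ) :
    -(m * ‖v‖ ^ 2 * ‖toL2 ψ‖ ^ 2 / 2) ≤
      1 / (2 * m) * kinL j (covL hbar c Q (gradL ψ) (prodL A ψ))
        + inner ℝ (toL2 ψ) (∑ k, v k • covL hbar c Q (gradL ψ) (prodL A ψ) k) := by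
  set w := covL hbar c Q (gradL ψ) (prodL A ψ) with hw
  have hin : inner ℝ (toL2 ψ) (∑ k, v k • w k) = ∑ k, v k * inner ℝ (w k) (toL2 ψ) := by
    rw [inner_sum]
    exact Finset.sum_congr rfl fun k _ => by rw [real_inner_smul_right, real_inner_comm]
  -- The right side is Σₖ‖wₖ + m vₖψ‖² in the Schrödinger case and ‖σ·(w + m vψ)‖² in the Pauli
  -- case.
  have key : 0 ≤ kinL j w + 2 * m * inner ℝ (toL2 ψ) (∑ k, v k • w k)
      + m ^ 2 * (‖v‖ ^ 2 * ‖toL2 ψ‖ ^ 2) := by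
    cases j
    · have : 0 ≤ ∑ k, ‖w k + m • v k • toL2 ψ‖ ^ 2 := Finset.sum_nonneg fun _ _ => sq_nonneg _
      have e : ∀ k, ‖w k + m • v k • toL2 ψ‖ ^ 2 = ‖w k‖ ^ 2 +
          (2 * m) * (v k * inner ℝ (w k) (toL2 ψ)) + m ^ 2 * (v k ^ 2 * ‖toL2 ψ‖ ^ 2) := by
        intro k
        rw [norm_add_sq_real, norm_smul, norm_smul, mul_pow, mul_pow, Real.norm_eq_abs,
          Real.norm_eq_abs, sq_abs, sq_abs, real_inner_smul_right, real_inner_smul_right]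
        ring
      simp only [e, Finset.sum_add_distrib, ← Finset.mul_sum, ← Finset.sum_mul,
        sum_coord_sq] at this
      rw [hin, kinL]
      exact this
    · have : 0 ≤ ‖sigmaDot w + m • sigmaDot fun k => v k • toL2 ψ‖ ^ 2 := sq_nonneg _
      have e : inner ℝ (sigmaDot w) (sigmaDot fun k => v k • toL2 ψ)
          = inner ℝ (toL2 ψ) (∑ k, v k • w k) := by
        rw [hin, hw, sigmaDot_covL, inner_add_left, real_inner_smul_left,
          hψ.inner_sigmaDot_grad, inner_sigmaDot_prodL hA hψ, Finset.mul_sum,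
          ← Finset.sum_add_distrib]
        refine Finset.sum_congr rfl fun k _ => ?_
        rw [covL, inner_add_left, real_inner_smul_left]
        ring
      rw [norm_add_sq_real, real_inner_smul_right, e, norm_smul, mul_pow, Real.norm_eq_abs, sq_abs,
        hψ.norm_sigmaDot_const] at this
      rw [kinL]
      linarith
  have h2 : 0 ≤ 1 / (2 * m) * (kinL j w + 2 * m * inner ℝ (toL2 ψ) (∑ k, v k • w k)
      + m ^ 2 * (‖v‖ ^ 2 * ‖toL2 ψ‖ ^ 2)) := by positivity
  have h3 : 1 / (2 * m) * (kinL j w + 2 * m * inner ℝ (toL2 ψ) (∑ k, v k • w k)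
      + m ^ 2 * (‖v‖ ^ 2 * ‖toL2 ψ‖ ^ 2)) = 1 / (2 * m) * kinL j w
      + inner ℝ (toL2 ψ) (∑ k, v k • w k) + m * ‖v‖ ^ 2 * ‖toL2 ψ‖ ^ 2 / 2 := by
    field_simp
  linarith

/-- Energies below that of free motion, -m|v|²λ/2, can only come from the coupling. This turns a
strict bound on the infimum into a lower bound on the interaction. -/
lemma energy_ge_coupling {m : ℝ} (hm : 0 < m) {hbar c Q : ℝ} (j : Model) {v : R3}
    (hvc : ‖v‖ < c) {A : R3 → R3} {ψ : R3 → C2} (hA : MemD1 A) (hψ : MemH1 ψ) :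
    -(m * ‖v‖ ^ 2 * ‖toL2 ψ‖ ^ 2 / 2) - Q / c * coupling v A ψ ≤
      energy m hbar c Q j v (ψ, A) := by
  rw [energy_eq m hbar c Q j v hψ hA, momL_eq hbar c Q v _ _ (prodL A ψ)]
  have h1 := kinL_add_inner_ge hm hbar c Q j v hA hψ
  have h2 := fieldL_nonneg hvc (gradL A)
  rw [coupling]
  linarith

end LowerBounds

/-! ### Coercivity and the role of the critical speed -/

section Coercivity

lemma mixNorm_sq_le_grad {A : R3 → R3} {ψ : R3 → C2} (hA : MemD1 A) (hψ : MemH1 ψ) :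
    mixNorm A ψ ^ 2 ≤ sobolevConst ^ 2 * gradNorm A ^ 2 * (‖toL2 ψ‖ * normL6 ψ) := by
  refine (mixNorm_sq_le hA.memLp_six hψ.1 hψ.memLp_six).trans ?_
  rw [← mul_pow]
  have := normL6_nonneg A
  have := normL6_nonneg ψ
  gcongr
  exact hA.normL6_le_gradNorm

lemma le_half_add_of_sq_le {x a b : ℝ} (ha : 0 ≤ a) (hb : 0 ≤ b) (h : x ^ 2 ≤ a * b) :
    x ≤ (a + b) / 2 := by
  refine le_of_sq_le_sq_real (h.trans ?_) (by positivity)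
  nlinarith [sq_nonneg (a - b)]

lemma sqrt_sum_covL_bound {hbar c Q : ℝ} (hh : 0 < hbar) {A : R3 → R3} {ψ : R3 → C2}
    (hA : MemD1 A) (hψ : MemH1 ψ) (hc : 0 < c) :
    hbar * gradNorm ψ ≤
      2 * Real.sqrt (kinL .S (covL hbar c Q (gradL ψ) (prodL A ψ))) + 2 * (|Q| / c * mixNorm A ψ) := by
  set w := covL hbar c Q (gradL ψ) (prodL A ψ) with hw
  have hmix := mixNorm_nonneg A ψ
  refine le_of_sq_le_sq_real ?_ (by positivity)
  have h1 : ∀ k, (hbar * ‖gradL ψ k‖) ^ 2 ≤ 2 * ‖w k‖ ^ 2 + 2 * ((Q / c) ^ 2 * ‖prodL A ψ k‖ ^ 2) := by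
    intro k
    rw [← norm_I_smul hbar hh]
    have e : (Complex.I * (hbar : ℂ)) • gradL ψ k = w k - (Q / c) • prodL A ψ k := by
      rw [hw, covL]; abel
    have h2 := norm_sub_le (w k) ((Q / c) • prodL A ψ k)
    have h3 : ‖(Q / c) • prodL A ψ k‖ ^ 2 = (Q / c) ^ 2 * ‖prodL A ψ k‖ ^ 2 := by
      rw [norm_smul, mul_pow, Real.norm_eq_abs, sq_abs]
    rw [e, ← h3]
    calc _ ≤ (‖w k‖ + ‖(Q / c) • prodL A ψ k‖) ^ 2 := by gcongr
      _ ≤ _ := by nlinarith [sq_nonneg (‖w k‖ - ‖(Q / c) • prodL A ψ k‖)]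
  have h4 : (hbar * gradNorm ψ) ^ 2 ≤ 2 * ∑ k, ‖w k‖ ^ 2 + 2 * ((Q / c) ^ 2 * mixNorm A ψ ^ 2) := by
    rw [mul_pow, gradNorm_sq, ← sum_norm_prodL_sq hA.memLp_six hψ.1 hψ.memLp_six]
    simp only [Finset.mul_sum, ← Finset.sum_add_distrib]
    exact Finset.sum_le_sum fun k _ => by rw [← mul_pow]; exact h1 k
  have h5 : Real.sqrt (kinL .S w) ^ 2 = ∑ k, ‖w k‖ ^ 2 := Real.sq_sqrt (kinL_nonneg _ _)
  have h6 : (|Q| / c * mixNorm A ψ) ^ 2 = (Q / c) ^ 2 * mixNorm A ψ ^ 2 := by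
    rw [mul_pow, div_pow, sq_abs, div_pow]
  have h7 := Real.sqrt_nonneg (kinL .S w)
  have h8 : 0 ≤ |Q| / c * mixNorm A ψ := by positivity
  nlinarith [mul_nonneg h7 h8, sq_nonneg (Real.sqrt (kinL .S w)), sq_nonneg (|Q| / c * mixNorm A ψ)]

/-- Without a potential the Pauli and Schrödinger kinetic energies agree, so the triangle inequality
for σ·(iħ∇ψ) suffices. Both coefficients are one, which keeps the threshold sharp. -/
lemma pauli_covL_bound {hbar c Q : ℝ} (hh : 0 < hbar) {A : R3 → R3} {ψ : R3 → C2}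
    (hA : MemD1 A) (hψ : MemH1 ψ) (hc : 0 < c) :
    hbar * gradNorm ψ ≤
      Real.sqrt (kinL .P (covL hbar c Q (gradL ψ) (prodL A ψ))) + |Q| / c * mixNorm A ψ := by
  have h2 := hψ.pauli_identity hbar 0
  simp only [PiLp.zero_apply, zero_smul, add_zero] at h2
  change ‖sigmaDot fun k => (Complex.I * (hbar : ℂ)) • gradL ψ k‖ ^ 2
    = ∑ k, ‖(Complex.I * (hbar : ℂ)) • gradL ψ k‖ ^ 2 at h2
  simp only [norm_I_smul hbar hh, mul_pow, ← Finset.mul_sum] at h2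
  rw [← gradNorm_sq, ← mul_pow] at h2
  have h3 := (sq_eq_sq₀ (norm_nonneg _) (mul_nonneg hh.le (gradNorm_nonneg ψ))).1 h2
  rw [kinL, Real.sqrt_sq (norm_nonneg _), sigmaDot_covL, ← h3,
    ← norm_sigmaDot_prodL hA.memLp_six hψ.1 hψ.memLp_six]
  set x := sigmaDot fun k => (Complex.I * (hbar : ℂ)) • gradL ψ k
  set y := sigmaDot (prodL A ψ)
  have h4 := norm_sub_le (x + (Q / c) • y) ((Q / c) • y)
  rw [add_sub_cancel_right] at h4
  rwa [norm_smul (Q / c) y, Real.norm_eq_abs, abs_div, abs_of_pos hc] at h4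

/-- With b = 8πK³Q²λ/ħ the hypothesis reads |v| + b < √(b² + c²). Squaring gives |v|² + 2b|v| < c²,
which is the claim up to the factor 1/(16πc²). -/
lemma lam_condition {hbar c Q lam : ℝ} (hh : 0 < hbar) (hc : 0 < c) {v : R3}
    (h : lam ∈ Lam hbar c Q .P v) :
    ‖v‖ * (Q ^ 2 * sobolevConst ^ 3 * lam / (c ^ 2 * hbar)) ≤ fieldConst c v / 2 := by
  obtain ⟨hl, hv⟩ := h
  have hK := sobolevConst_nonneg
  simp only [thetaPlus] at hv
  set b := 8 * Real.pi * sobolevConst ^ 3 * Q ^ 2 * lam / hbar with hb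
  have hb0 : 0 ≤ b := by positivity
  have e : (8 * Real.pi) ^ 2 * sobolevConst ^ 6 * Q ^ 4 * lam ^ 2 / hbar ^ 2 = b ^ 2 := by
    rw [hb]; field_simp
  rw [e] at hv
  have h1 : (‖v‖ + b) ^ 2 < b ^ 2 + c ^ 2 := by
    have h2 : ‖v‖ + b < Real.sqrt (b ^ 2 + c ^ 2) := by linarith
    calc _ < Real.sqrt (b ^ 2 + c ^ 2) ^ 2 := by gcongr
      _ = _ := Real.sq_sqrt (by positivity)
  have h2 : ‖v‖ ^ 2 + 2 * b * ‖v‖ < c ^ 2 := by nlinarith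
  have e2 : ‖v‖ * (Q ^ 2 * sobolevConst ^ 3 * lam / (c ^ 2 * hbar))
      = 1 / (8 * Real.pi) * (b * ‖v‖ / c ^ 2) := by
    rw [hb]; field_simp
  have e3 : (1 - ‖v‖ ^ 2 / c ^ 2) / 2 = (c ^ 2 - ‖v‖ ^ 2) / 2 / c ^ 2 := by field_simp
  have h3 : b * ‖v‖ / c ^ 2 ≤ (1 - ‖v‖ ^ 2 / c ^ 2) / 2 := by
    rw [e3]
    gcongr
    linarith
  rw [e2, fieldConst]
  calc _ ≤ 1 / (8 * Real.pi) * ((1 - ‖v‖ ^ 2 / c ^ 2) / 2) := by gcongr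
    _ = _ := by ring

/-- Coercivity of the energy. -/
lemma coercive (m : ℝ) {hbar c Q : ℝ} (hh : 0 < hbar) (hc : 0 < c) (j : Model) {v : R3}
    (hvc : ‖v‖ < c) {lam : ℝ} (hlam : lam ∈ Lam hbar c Q j v) :
    ∃ κ s : ℝ, 0 ≤ κ ∧ 0 ≤ s ∧ ∀ (ψ : R3 → C2) (A : R3 → R3), MemH1 ψ → MemD1 A →
      ‖toL2 ψ‖ ^ 2 = lam → ∃ P : ℝ, 0 ≤ P ∧
        1 / (2 * m) * P ^ 2 - κ * P + fieldConst c v / 2 * gradNorm A ^ 2 ≤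
          energy m hbar c Q j v (ψ, A) ∧
        hbar * gradNorm ψ ≤ 3 * P + s * gradNorm A ^ 2 := by
  have hl : 0 < lam := hlam.1
  have hK := sobolevConst_nonneg
  have hβ := fieldConst_pos hvc
  set s₀ : ℝ := sobolevConst ^ 3 * Real.sqrt lam / hbar with hs₀
  set q : ℝ := |Q| / c with hq
  set τ : ℝ := ‖v‖ * Real.sqrt lam with hτ
  have hs0 : 0 ≤ s₀ := by positivity
  have hq0 : 0 ≤ q := by positivity
  have hτ0 : 0 ≤ τ := by positivity
  cases j
  -- The term τ comes from the pairing of ψ with the covariant derivative. The fraction is what the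
  -- arithmetic-geometric mean leaves on P once half of the field energy has been spent on the
  -- coupling.
  · refine ⟨τ + τ ^ 2 * q ^ 2 * s₀ / (2 * fieldConst c v), q ^ 2 * s₀, by positivity,
      by positivity, fun ψ A hψ hA hn => ?_⟩
    have hu : ‖toL2 ψ‖ = Real.sqrt lam := by rw [← hn, Real.sqrt_sq (norm_nonneg _)]
    set w := covL hbar c Q (gradL ψ) (prodL A ψ) with hw
    set P := Real.sqrt (kinL .S w) with hP
    have hP0 : 0 ≤ P := Real.sqrt_nonneg _
    have hPsq : P ^ 2 = kinL .S w := Real.sq_sqrt (kinL_nonneg _ _)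
    have hmix0 := mixNorm_nonneg A ψ
    have hY0 := gradNorm_nonneg A
    have hdia : hbar * normL6 ψ ≤ sobolevConst * P := diamagnetic hh hA hψ
    have hmix : mixNorm A ψ ^ 2 ≤ s₀ * gradNorm A ^ 2 * P := by
      have h6 : normL6 ψ ≤ sobolevConst * P / hbar := by
        rw [le_div_iff₀ hh, mul_comm]; exact hdia
      calc _ ≤ _ := mixNorm_sq_le_grad hA hψ
        _ ≤ sobolevConst ^ 2 * gradNorm A ^ 2 * (Real.sqrt lam * (sobolevConst * P / hbar)) := by
          rw [hu]; gcongr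
        _ = _ := by rw [hs₀]; ring
    refine ⟨P, hP0, ?_, ?_⟩
    · rw [energy_eq m hbar c Q .S v hψ hA, momL_eq hbar c Q v _ _ (prodL A ψ), ← hw, ← hPsq]
      have h1 := fieldConst_mul_le c v (gradL A)
      rw [← gradNorm_sq] at h1
      have h2 : |inner ℝ (toL2 ψ) (∑ k, v k • w k)| ≤ τ * P := by
        have := abs_inner_sum_le v (toL2 ψ) w
        rwa [hu] at this
      have h3 : |Q / c * inner ℝ (toL2 ψ) (∑ k, v k • prodL A ψ k)| ≤ τ * (q * mixNorm A ψ) := by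
        have := abs_coupling_le v hA hψ
        rw [hu] at this
        rw [abs_mul, abs_div, abs_of_pos hc]
        calc _ ≤ |Q| / c * (‖v‖ * Real.sqrt lam * mixNorm A ψ) := by gcongr; exact this
          _ = _ := by rw [hτ, hq]; ring
      -- The weights in this mean inequality are chosen so that the part in ‖∇A‖² has coefficient
      -- exactly half of `fieldConst c v`.
      have h4 : τ * (q * mixNorm A ψ) ≤
          (fieldConst c v * gradNorm A ^ 2 + τ ^ 2 * q ^ 2 * s₀ / fieldConst c v * P) / 2 := by
        refine le_half_add_of_sq_le (by positivity) (by positivity) ?_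
        calc (τ * (q * mixNorm A ψ)) ^ 2 = τ ^ 2 * q ^ 2 * mixNorm A ψ ^ 2 := by ring
          _ ≤ τ ^ 2 * q ^ 2 * (s₀ * gradNorm A ^ 2 * P) := by gcongr
          _ = _ := by field_simp
      have h5 := (abs_le.1 h2).1
      have h6 := (abs_le.1 h3).2
      have e : (τ + τ ^ 2 * q ^ 2 * s₀ / (2 * fieldConst c v)) * P
          = τ * P + τ ^ 2 * q ^ 2 * s₀ / fieldConst c v * P / 2 := by field_simp
      rw [e]
      linarith
    · have h1 := sqrt_sum_covL_bound (Q := Q) hh hA hψ hc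
      have h2 : q * mixNorm A ψ ≤ (P + q ^ 2 * s₀ * gradNorm A ^ 2) / 2 := by
        refine le_half_add_of_sq_le hP0 (by positivity) ?_
        calc (q * mixNorm A ψ) ^ 2 = q ^ 2 * mixNorm A ψ ^ 2 := by ring
          _ ≤ q ^ 2 * (s₀ * gradNorm A ^ 2 * P) := by gcongr
          _ = _ := by ring
      linarith
  -- Here the momentum term is estimated directly by τħ‖∇ψ‖, and ħ‖∇ψ‖ ≤ 2P + q²s₀‖∇A‖² explains
  -- both constants.
  · refine ⟨2 * τ, q ^ 2 * s₀, by positivity, by positivity, fun ψ A hψ hA hn => ?_⟩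
    have hu : ‖toL2 ψ‖ = Real.sqrt lam := by rw [← hn, Real.sqrt_sq (norm_nonneg _)]
    set w := covL hbar c Q (gradL ψ) (prodL A ψ) with hw
    set P := Real.sqrt (kinL .P w) with hP
    have hP0 : 0 ≤ P := Real.sqrt_nonneg _
    have hPsq : P ^ 2 = kinL .P w := Real.sq_sqrt (kinL_nonneg _ _)
    have hX0 := gradNorm_nonneg ψ
    have hmix : mixNorm A ψ ^ 2 ≤ s₀ * gradNorm A ^ 2 * (hbar * gradNorm ψ) := by
      calc _ ≤ _ := mixNorm_sq_le_grad hA hψ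
        _ ≤ sobolevConst ^ 2 * gradNorm A ^ 2 *
            (Real.sqrt lam * (sobolevConst * gradNorm ψ)) := by
          rw [hu]; gcongr; exact hψ.memD1.normL6_le_gradNorm
        _ = _ := by rw [hs₀]; field_simp
    have h2 : q * mixNorm A ψ ≤ (hbar * gradNorm ψ + q ^ 2 * s₀ * gradNorm A ^ 2) / 2 := by
      refine le_half_add_of_sq_le (by positivity) (by positivity) ?_
      calc (q * mixNorm A ψ) ^ 2 = q ^ 2 * mixNorm A ψ ^ 2 := by ring
        _ ≤ q ^ 2 * (s₀ * gradNorm A ^ 2 * (hbar * gradNorm ψ)) := by gcongr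
        _ = _ := by ring
    have h3 : hbar * gradNorm ψ ≤ 2 * P + q ^ 2 * s₀ * gradNorm A ^ 2 := by
      have := pauli_covL_bound (Q := Q) hh hA hψ hc
      linarith
    refine ⟨P, hP0, ?_, by linarith⟩
    rw [energy_eq m hbar c Q .P v hψ hA, ← hw, ← hPsq]
    have h1 := fieldConst_mul_le c v (gradL A)
    rw [← gradNorm_sq] at h1
    have h4 : |momL hbar v (toL2 ψ) (gradL ψ)| ≤ τ * (hbar * gradNorm ψ) := by
      have := abs_momL_le hh v (toL2 ψ) (gradL ψ)
      rwa [hu] at this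
    have h5 := (abs_le.1 h4).1
    have h6 : τ * (hbar * gradNorm ψ) ≤ τ * (2 * P + q ^ 2 * s₀ * gradNorm A ^ 2) := by gcongr
    -- The only place where the restriction on λ beyond positivity enters: the contribution of the
    -- momentum term to ‖∇A‖² must not exceed half of the field energy.
    have h7 : τ * (q ^ 2 * s₀) ≤ fieldConst c v / 2 := by
      refine le_trans (le_of_eq ?_) (lam_condition hh hc hlam)
      rw [hτ, hq, hs₀, div_pow, sq_abs]
      field_simp
      rw [Real.sq_sqrt hl.le]
      ring
    have h8 : τ * (q ^ 2 * s₀) * gradNorm A ^ 2 ≤ fieldConst c v / 2 * gradNorm A ^ 2 := by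
      gcongr
    linarith

end Coercivity

/-! ### Trial states: scaling, divergence free fields and plane waves -/

section Trial

section Scaling

variable {F : Type*} [NormedAddCommGroup F] [NormedSpace ℝ F] [CompleteSpace F]

lemma normSqL2_scale (f : R3 → F) {R : ℝ} (hR : 0 < R) :
    normSqL2 (fun x => f (R⁻¹ • x)) = R ^ 3 * normSqL2 f := by
  have := Measure.integral_comp_inv_smul_of_nonneg volume (fun x : R3 => ‖f x‖ ^ 2) hR.le
  simpa [normSqL2] using this

lemma contDiff_scale {f : R3 → F} {n : WithTop ℕ∞} (hf : ContDiff ℝ n f) (R : ℝ) :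
    ContDiff ℝ n fun x => f (R⁻¹ • x) := hf.comp (contDiff_id.const_smul _)

lemma hasCompactSupport_scale {f : R3 → F} (hf : HasCompactSupport f) {R : ℝ} (hR : 0 < R) :
    HasCompactSupport fun x => f (R⁻¹ • x) :=
  hf.comp_homeomorph (Homeomorph.smulOfNeZero R⁻¹ (by positivity))

lemma fderiv_scale {f : R3 → F} (hf : ContDiff ℝ 1 f) (R : ℝ) (x y : R3) :
    fderiv ℝ (fun x => f (R⁻¹ • x)) x y = R⁻¹ • fderiv ℝ f (R⁻¹ • x) y := by
  have h1 : HasFDerivAt (fun x => f (R⁻¹ • x)) _ x :=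
    (hf.differentiable (by simp) _).hasFDerivAt.comp x ((hasFDerivAt_id x).const_smul R⁻¹)
  rw [h1.fderiv]
  simp

lemma gradNorm_sq_of_contDiff {f : R3 → F} (hf : ContDiff ℝ 1 f) (hs : HasCompactSupport f) :
    gradNorm f ^ 2 = ∑ k, normSqL2 fun x => fderiv ℝ f x (coordVec k) := by
  rw [gradNorm_sq]
  refine Finset.sum_congr rfl fun k _ => ?_
  rw [gradL_of_contDiff hf hs, norm_toL2_sq]
  exact (continuous_partial hf (by simp) _).memLp_of_hasCompactSupport
    (hasCompactSupport_partial hs _)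

lemma normSqL2_smul (a : ℝ) (f : R3 → F) : normSqL2 (fun x => a • f x) = a ^ 2 * normSqL2 f := by
  simp only [normSqL2, norm_smul, mul_pow, Real.norm_eq_abs, sq_abs, integral_const_mul]

/-- In dimension three the volume contributes R³ and the squared derivative R⁻². -/
lemma gradNorm_scale_sq {f : R3 → F} (hf : ContDiff ℝ 1 f) (hs : HasCompactSupport f) {R : ℝ}
    (hR : 0 < R) (a : ℝ) :
    gradNorm (fun x => a • f (R⁻¹ • x)) ^ 2 = a ^ 2 * R * gradNorm f ^ 2 := by
  have h1 := contDiff_scale hf R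
  have h2 := hasCompactSupport_scale hs hR
  have h3 := (memH1_of_contDiff h1 h2).2
  rw [gradNorm_sq]
  simp only [gradL_smul h3, norm_smul, mul_pow, Real.norm_eq_abs, sq_abs, ← Finset.mul_sum]
  rw [← gradNorm_sq, gradNorm_sq_of_contDiff h1 h2, gradNorm_sq_of_contDiff hf hs, mul_assoc]
  congr 1
  refine Eq.trans (Finset.sum_congr rfl fun k _ => ?_) (Finset.mul_sum _ _ _).symm
  simp only [fderiv_scale hf R, normSqL2_smul]
  rw [normSqL2_scale (fun x => fderiv ℝ f x (coordVec k)) hR]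
  field_simp

end Scaling

/-- A radial profile: `1` on `(-∞, 1]`, `0` on `[2, ∞)`. -/
def profile (s : ℝ) : ℝ := Real.smoothTransition (2 - s)

lemma contDiff_profile : ContDiff ℝ ∞ profile :=
  Real.smoothTransition.contDiff.comp (contDiff_const.sub contDiff_id)

lemma contDiff_deriv_profile : ContDiff ℝ ∞ (deriv profile) :=
  (contDiff_infty_iff_deriv.1 contDiff_profile).2

lemma profile_eq_one {s : ℝ} (hs : s ≤ 1) : profile s = 1 :=
  Real.smoothTransition.one_of_one_le (by linarith)

lemma profile_eq_zero {s : ℝ} (hs : 2 ≤ s) : profile s = 0 :=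
  Real.smoothTransition.zero_of_nonpos (by linarith)

lemma deriv_profile_eq_zero_of_lt {s : ℝ} (hs : s < 1) : deriv profile s = 0 := by
  have : profile =ᶠ[𝓝 s] fun _ => 1 := by
    filter_upwards [Iio_mem_nhds hs] with y hy using profile_eq_one (le_of_lt hy)
  rw [this.deriv_eq]; simp

lemma deriv_profile_eq_zero_of_gt {s : ℝ} (hs : 2 < s) : deriv profile s = 0 := by
  have : profile =ᶠ[𝓝 s] fun _ => 0 := by
    filter_upwards [Ioi_mem_nhds hs] with y hy using profile_eq_zero (le_of_lt hy)
  rw [this.deriv_eq]; simp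

/-- A smooth compactly supported divergence free field equal to `v` on the unit ball. -/
def trialField (v x : R3) : R3 :=
  profile (‖x‖ ^ 2) • v + deriv profile (‖x‖ ^ 2) • (‖x‖ ^ 2 • v - inner ℝ v x • x)

lemma contDiff_trialField (v : R3) : ContDiff ℝ ∞ (trialField v) := by
  have h1 : ContDiff ℝ ∞ fun x : R3 => ‖x‖ ^ 2 := contDiff_norm_sq ℝ
  have h2 : ContDiff ℝ ∞ fun x : R3 => (inner ℝ v x : ℝ) := contDiff_const.inner ℝ contDiff_id
  exact ((contDiff_profile.comp h1).smul contDiff_const).add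
    ((contDiff_deriv_profile.comp h1).smul ((h1.smul contDiff_const).sub (h2.smul contDiff_id)))

lemma hasCompactSupport_trialField (v : R3) : HasCompactSupport (trialField v) := by
  refine HasCompactSupport.intro (isCompact_closedBall (0 : R3) 2) fun x hx => ?_
  have hx' : 2 < ‖x‖ := by simpa using hx
  have h2 : 2 < ‖x‖ ^ 2 := by nlinarith
  rw [trialField, profile_eq_zero h2.le, deriv_profile_eq_zero_of_gt h2]
  simp

lemma trialField_eq {v x : R3} (hx : ‖x‖ < 1) : trialField v x = v := by
  have h2 : ‖x‖ ^ 2 < 1 := by nlinarith [norm_nonneg x]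
  rw [trialField, profile_eq_one h2.le, deriv_profile_eq_zero_of_lt h2]
  simp

/-- The field is the curl of ½ p(|x|²) v × x with p the profile. Directly: the derivative of the
first term is 2p' v·x, the bracket has divergence -2 v·x, and the p'' contribution vanishes because
the bracket is orthogonal to x. -/
lemma div_trialField (v x : R3) : ∑ k, fderiv ℝ (trialField v) x (coordVec k) k = 0 := by
  have hn : HasFDerivAt (fun x : R3 => ‖x‖ ^ 2) (2 • innerSL ℝ x) x :=
    (hasStrictFDerivAt_norm_sq x).hasFDerivAt
  have hp : HasFDerivAt (fun x : R3 => profile (‖x‖ ^ 2))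
      (deriv profile (‖x‖ ^ 2) • (2 • innerSL ℝ x)) x :=
    ((contDiff_profile.differentiable (by simp)) _).hasDerivAt.comp_hasFDerivAt x hn
  have hp' : HasFDerivAt (fun x : R3 => deriv profile (‖x‖ ^ 2))
      (deriv (deriv profile) (‖x‖ ^ 2) • (2 • innerSL ℝ x)) x :=
    ((contDiff_deriv_profile.differentiable (by simp)) _).hasDerivAt.comp_hasFDerivAt x hn
  have hi : HasFDerivAt (fun x : R3 => (inner ℝ v x : ℝ)) (innerSL ℝ v) x :=
    (innerSL ℝ v).hasFDerivAt
  have h := (hp.smul_const v).add (hp'.smul ((hn.smul_const v).sub (hi.smul (hasFDerivAt_id x))))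
  have h' : HasFDerivAt (trialField v) _ x := h
  rw [h'.fderiv]
  have hs : ‖x‖ ^ 2 = x 0 ^ 2 + x 1 ^ 2 + x 2 ^ 2 := by
    rw [← sum_coord_sq, Fin.sum_univ_three]
  have hv : (inner ℝ v x : ℝ) = v 0 * x 0 + v 1 * x 1 + v 2 * x 2 := by
    simp [PiLp.inner_apply, Fin.sum_univ_three]
    ring
  simp only [Fin.sum_univ_three, add_apply, smul_apply, sub_apply,
    ContinuousLinearMap.smulRight_apply, innerSL_apply_apply, PiLp.add_apply, PiLp.smul_apply,
    PiLp.sub_apply, ContinuousLinearMap.coe_id', id_eq, EuclideanSpace.inner_single_right,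
    smul_eq_mul, Pi.sub_apply, Pi.smul_apply', hv, hs]
  simp
  ring

/-- The spin-up embedding `ℂ → ℂ²`. -/
def spinUp : ℂ →L[ℂ] C2 :=
  (ContinuousLinearMap.id ℂ ℂ).smulRight (EuclideanSpace.single (0 : Fin 2) (1 : ℂ))

lemma norm_spinUp (z : ℂ) : ‖spinUp z‖ = ‖z‖ := by
  simp [spinUp, norm_smul]

lemma inner_spinUp (z w : ℂ) : inner ℝ (spinUp z) (spinUp w) = z.re * w.re + z.im * w.im := by
  rw [inner_C2]; simp [spinUp]

/-- A plane wave. -/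
def planeWave (b : R3) (x : R3) : ℂ := Complex.exp (((inner ℝ b x : ℝ) : ℂ) * Complex.I)

lemma norm_planeWave (b x : R3) : ‖planeWave b x‖ = 1 := Complex.norm_exp_ofReal_mul_I _

/-- A modulated real profile. -/
def modulate (b : R3) (U : R3 → ℝ) (x : R3) : C2 := spinUp ((U x : ℂ) * planeWave b x)

lemma contDiff_modulate (b : R3) {U : R3 → ℝ} (hU : ContDiff ℝ 1 U) :
    ContDiff ℝ 1 (modulate b U) := by
  have h2 : ContDiff ℝ 1 fun x : R3 => (inner ℝ b x : ℝ) := contDiff_const.inner ℝ contDiff_id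
  have h3 : ContDiff ℝ 1 (planeWave b) :=
    ((Complex.ofRealCLM.contDiff.comp h2).mul contDiff_const).cexp
  exact (spinUp.restrictScalars ℝ).contDiff.comp ((Complex.ofRealCLM.contDiff.comp hU).mul h3)

lemma hasCompactSupport_modulate (b : R3) {U : R3 → ℝ} (hU : HasCompactSupport U) :
    HasCompactSupport (modulate b U) := by
  refine hU.mono fun x hx => ?_
  contrapose! hx
  simp only [Function.mem_support, not_not] at hx ⊢
  simp [modulate, hx]

lemma fderiv_modulate (b : R3) {U : R3 → ℝ} (hU : ContDiff ℝ 1 U) (x : R3) (k : Fin 3) :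
    fderiv ℝ (modulate b U) x (coordVec k)
      = spinUp (((fderiv ℝ U x (coordVec k) : ℝ) + (b k * U x : ℝ) * Complex.I)
          * planeWave b x) := by
  have hi : HasFDerivAt (fun x : R3 => (inner ℝ b x : ℝ)) (innerSL ℝ b) x :=
    (innerSL ℝ b).hasFDerivAt
  have hp : HasFDerivAt (planeWave b) _ x :=
    (((Complex.ofRealCLM.hasFDerivAt).comp x hi).mul_const Complex.I).cexp
  have hm := ((Complex.ofRealCLM.hasFDerivAt).comp x
    (hU.differentiable (by simp) x).hasFDerivAt).mul hp
  have h : HasFDerivAt (modulate b U) _ x := (spinUp.restrictScalars ℝ).hasFDerivAt.comp x hm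
  rw [h.fderiv]
  simp only [ContinuousLinearMap.comp_apply, add_apply, smul_apply,
    ContinuousLinearMap.coe_restrictScalars', innerSL_apply_apply, Complex.ofRealCLM_apply]
  congr 1
  simp [planeWave, EuclideanSpace.inner_single_right, smul_eq_mul]
  ring

end Trial

/-! ### The energy of the trial states -/

section TrialEnergy

lemma normSqL2_add_of_orthogonal {f : R3 → C2} {p q : R3 → ℝ} (hp : MemLp p 2 volume)
    (hq : MemLp q 2 volume) (h : ∀ x, ‖f x‖ ^ 2 = p x ^ 2 + q x ^ 2) :
    normSqL2 f = normSqL2 p + normSqL2 q := by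
  have hp' := (memLp_two_iff_integrable_sq_norm hp.1).1 hp
  have hq' := (memLp_two_iff_integrable_sq_norm hq.1).1 hq
  simp only [normSqL2, h]
  rw [← integral_add hp' hq']
  simp only [Real.norm_eq_abs, sq_abs]

lemma norm_spinUp_mul_planeWave_sq (b x : R3) (p q : ℝ) :
    ‖spinUp (((p : ℂ) * Complex.I + q) * planeWave b x)‖ ^ 2 = p ^ 2 + q ^ 2 := by
  rw [norm_spinUp, norm_mul, norm_planeWave, mul_one, ← Complex.normSq_eq_norm_sq,
    Complex.normSq_apply]
  simp
  ring

lemma normSqL2_modulate (b : R3) (U : R3 → ℝ) : normSqL2 (modulate b U) = normSqL2 U := by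
  simp only [normSqL2, modulate, norm_spinUp, norm_mul, norm_planeWave, mul_one,
    Complex.norm_real]

/-- Differentiating the phase produces -k v U, which combines with the constant potential s v. Up to
the phase the result has imaginary part ħ∂ᵢU and real part (s - k)vᵢU, so its squared norm has no
cross term. -/
lemma covL_modulate {hbar s k : ℝ} (hh : hbar ≠ 0) (v : R3) {U : R3 → ℝ}
    (hU : ContDiff ℝ 1 U) (hs : HasCompactSupport U) (i : Fin 3) :
    (Complex.I * (hbar : ℂ)) • gradL (modulate ((k / hbar) • v) U) i
        + (s * v i) • toL2 (modulate ((k / hbar) • v) U)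
      = toL2 fun x => spinUp ((((hbar * fderiv ℝ U x (coordVec i) : ℝ) : ℂ) * Complex.I
          + (((s - k) * v i * U x : ℝ) : ℂ)) * planeWave ((k / hbar) • v) x) := by
  have hM := contDiff_modulate ((k / hbar) • v) hU
  have hMs := hasCompactSupport_modulate ((k / hbar) • v) hs
  have h1 : MemLp (fun x => fderiv ℝ (modulate ((k / hbar) • v) U) x (coordVec i)) 2 volume :=
    (continuous_partial hM (by simp) _).memLp_of_hasCompactSupport
      (hasCompactSupport_partial hMs _)
  have h2 := (memH1_of_contDiff hM hMs).1
  have h3 := memLp_smulC (Complex.I * (hbar : ℂ)) h1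
  have h4 : MemLp (fun x => (s * v i) • modulate ((k / hbar) • v) U x) 2 volume :=
    h2.const_smul (s * v i)
  rw [gradL_of_contDiff hM hMs, ← toL2_smul _ h1, ← toL2_smul _ h2, ← toL2_add h3 h4]
  congr 1
  ext1 x
  rw [fderiv_modulate _ hU, ← map_smul, modulate, ← Complex.coe_smul, ← map_smul, ← map_add]
  congr 1
  have hh' : (hbar : ℂ) ≠ 0 := by exact_mod_cast hh
  simp only [smul_eq_mul, PiLp.smul_apply]
  push_cast
  field_simp
  linear_combination (k * (v i) * U x * planeWave ((k / hbar) • v) x : ℂ) * Complex.I_sq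

lemma normSq_covL_modulate {hbar s k : ℝ} (hh : hbar ≠ 0) (v : R3) {U : R3 → ℝ}
    (hU : ContDiff ℝ 1 U) (hs : HasCompactSupport U) (i : Fin 3) :
    ‖(Complex.I * (hbar : ℂ)) • gradL (modulate ((k / hbar) • v) U) i
        + (s * v i) • toL2 (modulate ((k / hbar) • v) U)‖ ^ 2
      = hbar ^ 2 * normSqL2 (fun x => fderiv ℝ U x (coordVec i))
        + ((s - k) * v i) ^ 2 * normSqL2 U := by
  have h1 : MemLp (fun x => fderiv ℝ U x (coordVec i)) 2 volume :=
    (continuous_partial hU (by simp) _).memLp_of_hasCompactSupport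
      (hasCompactSupport_partial hs _)
  have h2 := (memH1_of_contDiff hU hs).1
  have hn := fun x => norm_spinUp_mul_planeWave_sq ((k / hbar) • v) x
    (hbar * fderiv ℝ U x (coordVec i)) ((s - k) * v i * U x)
  have hp : Continuous (planeWave ((k / hbar) • v)) := by
    unfold planeWave; fun_prop
  have hc : Continuous fun x => spinUp ((((hbar * fderiv ℝ U x (coordVec i) : ℝ) : ℂ) * Complex.I
          + (((s - k) * v i * U x : ℝ) : ℂ)) * planeWave ((k / hbar) • v) x) := by
    have h3 := continuous_partial hU (by simp) (coordVec i)
    have h4 := hU.continuous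
    refine spinUp.continuous.comp (Continuous.mul (Continuous.add (Continuous.mul ?_
      continuous_const) ?_) hp)
    · exact Complex.continuous_ofReal.comp (continuous_const.mul h3)
    · exact Complex.continuous_ofReal.comp (continuous_const.mul h4)
  have hsup : HasCompactSupport fun x => spinUp ((((hbar * fderiv ℝ U x (coordVec i) : ℝ) : ℂ)
      * Complex.I + (((s - k) * v i * U x : ℝ) : ℂ)) * planeWave ((k / hbar) • v) x) := by
    refine hs.mono' fun x hx => ?_
    by_contra hx'
    have e1 : U x = 0 := image_eq_zero_of_notMem_tsupport hx'
    have e2 : fderiv ℝ U x = 0 := by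
      by_contra h
      exact hx' (support_fderiv_subset ℝ h)
    simp [e1, e2] at hx
  rw [covL_modulate hh v hU hs, norm_toL2_sq (hc.memLp_of_hasCompactSupport hsup),
    normSqL2_add_of_orthogonal (h1.const_mul hbar) (h2.const_mul ((s - k) * v i)) hn]
  rw [← normSqL2_smul, ← normSqL2_smul]
  rfl

lemma momL_modulate {hbar k : ℝ} (hh : hbar ≠ 0) (v : R3) {U : R3 → ℝ}
    (hU : ContDiff ℝ 1 U) (hs : HasCompactSupport U) :
    momL hbar v (toL2 (modulate ((k / hbar) • v) U)) (gradL (modulate ((k / hbar) • v) U))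
      = -(k * ‖v‖ ^ 2 * normSqL2 U) := by
  have key : ∀ i, inner ℝ (toL2 (modulate ((k / hbar) • v) U))
      ((Complex.I * (hbar : ℂ)) • gradL (modulate ((k / hbar) • v) U) i)
        = -(k * v i * normSqL2 U) := by
    intro i
    have h0 := normSq_covL_modulate (s := 0) (k := k) hh v hU hs i
    have h2 := (memH1_of_contDiff (contDiff_modulate ((k / hbar) • v) hU)
      (hasCompactSupport_modulate ((k / hbar) • v) hs)).1
    have hM := contDiff_modulate ((k / hbar) • v) hU
    have hMs := hasCompactSupport_modulate ((k / hbar) • v) hs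
    have h1 : MemLp (fun x => fderiv ℝ (modulate ((k / hbar) • v) U) x (coordVec i)) 2 volume :=
      (continuous_partial hM (by simp) _).memLp_of_hasCompactSupport
        (hasCompactSupport_partial hMs _)
    rw [gradL_of_contDiff hM hMs, ← toL2_smul _ h1, inner_toL2 h2 (memLp_smulC _ h1), normSqL2,
      ← integral_const_mul, ← integral_neg]
    refine integral_congr_ae (Eventually.of_forall fun x => ?_)
    simp only
    rw [fderiv_modulate _ hU, ← map_smul, modulate, inner_spinUp]
    have hn : (planeWave ((k / hbar) • v) x).re ^ 2 + (planeWave ((k / hbar) • v) x).im ^ 2 = 1 := by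
      have := norm_planeWave ((k / hbar) • v) x
      rw [← sq_eq_sq₀ (norm_nonneg _) zero_le_one, ← Complex.normSq_eq_norm_sq,
        Complex.normSq_apply] at this
      linarith
    simp
    field_simp
    linear_combination (-(k * v i * U x ^ 2)) * hn
  rw [momL, inner_sum]
  simp only [real_inner_smul_right, key]
  rw [← sum_coord_sq, Finset.mul_sum, Finset.sum_mul, ← Finset.sum_neg_distrib]
  exact Finset.sum_congr rfl fun i _ => by ring

/-- The potential is constant on the support of U, so the energy depends only on elementary
quantities of U, the field energy and the parameters s, k. -/
lemma energy_modulate (m c Q : ℝ) {hbar s k : ℝ} (hh : hbar ≠ 0) (j : Model) (v : R3)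
    {U : R3 → ℝ} (hU : ContDiff ℝ 1 U) (hs : HasCompactSupport U) {A : R3 → R3} (hA : MemD1 A)
    (hAU : ∀ x, U x ≠ 0 → A x = s • v) :
    energy m hbar c Q j v (modulate ((k / hbar) • v) U, A)
      = 1 / (2 * m) * (hbar ^ 2 * gradNorm U ^ 2 + (Q / c * s - k) ^ 2 * ‖v‖ ^ 2 * normSqL2 U)
        + fieldL c v (gradL A) - k * ‖v‖ ^ 2 * normSqL2 U := by
  have hM := contDiff_modulate ((k / hbar) • v) hU
  have hMs := hasCompactSupport_modulate ((k / hbar) • v) hs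
  have hH := memH1_of_contDiff hM hMs
  have hw : ∀ i, covL hbar c Q (gradL (modulate ((k / hbar) • v) U))
      (prodL A (modulate ((k / hbar) • v) U)) i
      = (Complex.I * (hbar : ℂ)) • gradL (modulate ((k / hbar) • v) U) i
        + ((Q / c * s) * v i) • toL2 (modulate ((k / hbar) • v) U) := by
    intro i
    rw [covL, prodL, show (fun x => A x i • modulate ((k / hbar) • v) U x)
      = fun x => (s * v i) • modulate ((k / hbar) • v) U x from ?_, toL2_smul _ hH.1, smul_smul,
      mul_assoc]
    ext1 x
    by_cases hx : U x = 0
    · simp [modulate, hx]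
    · rw [hAU x hx]; simp
  have hk : kinL j (covL hbar c Q (gradL (modulate ((k / hbar) • v) U))
      (prodL A (modulate ((k / hbar) • v) U)))
      = ∑ i, ‖(Complex.I * (hbar : ℂ)) • gradL (modulate ((k / hbar) • v) U) i
        + ((Q / c * s) * v i) • toL2 (modulate ((k / hbar) • v) U)‖ ^ 2 := by
    cases j
    · simp only [kinL, hw]
    -- On the support of ψ the potential is constant, so the Pauli and Schrödinger kinetic energies
    -- coincide.
    · have := hH.pauli_identity hbar ((Q / c * s) • v)
      simp only [PiLp.smul_apply, smul_eq_mul] at this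
      simp only [kinL, sigmaDot, hw]
      exact this
  rw [energy_eq m hbar c Q j v hH hA, hk, momL_modulate hh v hU hs]
  simp only [normSq_covL_modulate hh v hU hs]
  rw [Finset.sum_add_distrib, ← Finset.mul_sum, ← gradNorm_sq_of_contDiff hU hs,
    ← Finset.sum_mul]
  simp only [mul_pow]
  rw [← Finset.mul_sum, sum_coord_sq]
  ring

lemma fieldL_le (c : ℝ) (v : R3) (g : Fin 3 → HR) :
    fieldL c v g ≤ 1 / (8 * Real.pi) * ∑ k, ‖g k‖ ^ 2 := by
  rw [fieldL]
  gcongr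
  exact sub_le_self _ (sq_nonneg _)

lemma div_of_contDiff {A : R3 → R3} (hA : ContDiff ℝ 1 A)
    (h : ∀ x, ∑ k, fderiv ℝ A x (coordVec k) k = 0) :
    ∀ᵐ x, ∑ k : Fin 3, weakPartial k A x k = 0 := by
  have := fun k => (isWeakPartial_of_contDiff hA k).weakPartial_ae_eq
  filter_upwards [this 0, this 1, this 2] with x h0 h1 h2
  rw [← h x, Fin.sum_univ_three, Fin.sum_univ_three, h0, h1, h2]

/-- A rescaled bump: with the mass fixed, spreading over the scale R lowers the squared gradient
like R⁻². -/
lemma exists_trial_profile : ∃ N G : ℝ, 0 < N ∧ 0 ≤ G ∧ ∀ lam R : ℝ, 0 < lam → 0 < R →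
    ∃ U : R3 → ℝ, ContDiff ℝ 1 U ∧ HasCompactSupport U ∧ normSqL2 U = lam ∧
      gradNorm U ^ 2 = lam / N * G / R ^ 2 ∧ ∀ x, U x ≠ 0 → ‖R⁻¹ • x‖ < 1 := by
  let u : ContDiffBump (0 : R3) := ⟨1 / 4, 1 / 2, by norm_num, by norm_num⟩
  have hu : ContDiff ℝ 1 (u : R3 → ℝ) := u.contDiff
  have hus : HasCompactSupport (u : R3 → ℝ) := u.hasCompactSupport
  have hNpos : 0 < normSqL2 (u : R3 → ℝ) := by
    rw [normSqL2]
    refine (integral_pos_iff_support_of_nonneg (fun x => sq_nonneg _)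
      ((memLp_two_iff_integrable_sq_norm hu.continuous.aestronglyMeasurable).1
        (memH1_of_contDiff hu hus).1)).2 ?_
    have : Function.support (fun x => ‖u x‖ ^ 2) = Metric.ball (0 : R3) (1 / 2) := by
      rw [← u.support_eq]; ext x; simp
    rw [this]
    exact Metric.measure_ball_pos _ _ (by norm_num)
  refine ⟨_, gradNorm (u : R3 → ℝ) ^ 2, hNpos, sq_nonneg _, fun lam R hlam hR => ?_⟩
  have ha2 : Real.sqrt (lam / (R ^ 3 * normSqL2 (u : R3 → ℝ))) ^ 2
      = lam / (R ^ 3 * normSqL2 (u : R3 → ℝ)) := Real.sq_sqrt (by positivity)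
  refine ⟨fun x => Real.sqrt (lam / (R ^ 3 * normSqL2 (u : R3 → ℝ))) • u (R⁻¹ • x),
    (contDiff_scale hu R).const_smul _, (hasCompactSupport_scale hus hR).comp_left (g := fun x => _ • x) (smul_zero _), ?_, ?_, ?_⟩
  · rw [normSqL2_smul, normSqL2_scale _ hR, ha2]
    field_simp
  · rw [gradNorm_scale_sq hu hus hR, ha2]
    field_simp
  · intro x hx
    have h1 : R⁻¹ • x ∈ Function.support (u : R3 → ℝ) := fun h0 => hx (by simp [h0])
    rw [u.support_eq, Metric.mem_ball, dist_zero_right] at h1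
    exact h1.trans (by norm_num [u])

lemma exists_trial_field (v : R3) : ∃ Y : ℝ, 0 ≤ Y ∧ ∀ R s : ℝ, 0 < R →
    ∃ A : R3 → R3, MemD1 A ∧ (∀ᵐ x, ∑ k : Fin 3, weakPartial k A x k = 0) ∧
      gradNorm A ^ 2 = s ^ 2 * R * Y ∧ ∀ x, ‖R⁻¹ • x‖ < 1 → A x = s • v := by
  have hT : ContDiff ℝ 1 (trialField v) := (contDiff_trialField v).of_le (by exact_mod_cast le_top)
  have hTs := hasCompactSupport_trialField v
  refine ⟨gradNorm (trialField v) ^ 2, sq_nonneg _, fun R s hR => ?_⟩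
  have hA1 : ContDiff ℝ 1 fun x => s • trialField v (R⁻¹ • x) := (contDiff_scale hT R).const_smul _
  have hAs : HasCompactSupport fun x => s • trialField v (R⁻¹ • x) :=
    (hasCompactSupport_scale hTs hR).comp_left (g := fun x => s • x) (smul_zero _)
  refine ⟨_, (memH1_of_contDiff hA1 hAs).memD1, div_of_contDiff hA1 fun x => ?_,
    gradNorm_scale_sq hT hTs hR s, fun x hx => by rw [trialField_eq hx]⟩
  have : ∀ k, fderiv ℝ (fun x => s • trialField v (R⁻¹ • x)) x (coordVec k) k
      = (s * R⁻¹) * fderiv ℝ (trialField v) (R⁻¹ • x) (coordVec k) k := by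
    intro k
    rw [fderiv_fun_const_smul ((contDiff_scale hT R).differentiable (by simp) x), smul_apply,
      fderiv_scale hT]
    simp [mul_assoc]
  simp only [this, ← Finset.mul_sum, div_trialField, mul_zero]

/-- The infimum lies strictly below the energy of free motion. -/
lemma exists_trial {m hbar c Q lam : ℝ} (hm : 0 < m) (hh : 0 < hbar) (hc : 0 < c) (hQ : Q ≠ 0)
    (hlam : 0 < lam) (j : Model) {v : R3} (hv : 0 < ‖v‖) :
    ∃ p ∈ constraintSet lam, energy m hbar c Q j v p < -(m * ‖v‖ ^ 2 * lam / 2) := by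
  obtain ⟨N, G, hN, hG, hprof⟩ := exists_trial_profile
  obtain ⟨Y, hY, hfield⟩ := exists_trial_field v
  obtain ⟨C, hC⟩ : ∃ C, C = 1 / (8 * Real.pi) * Y := ⟨_, rfl⟩
  have hC0 : 0 ≤ C := by rw [hC]; positivity
  -- With field strength s = Qδ/R the coupling gains 2e/R and the field costs at most CQ²δ²/R. The
  -- gain is linear in δ, and this δ makes the cost at most e/R; the 1 in C + 1 avoids division by
  -- zero.
  obtain ⟨δ, hδ⟩ : ∃ δ, δ = ‖v‖ ^ 2 * lam / (2 * c * (C + 1)) := ⟨_, rfl⟩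
  have hδ0 : 0 < δ := by rw [hδ]; positivity
  obtain ⟨D, hD⟩ : ∃ D, D = hbar ^ 2 * (lam / N * G) / (2 * m) := ⟨_, rfl⟩
  have hD0 : 0 ≤ D := by rw [hD]; positivity
  obtain ⟨e, he⟩ : ∃ e, e = Q ^ 2 * δ * ‖v‖ ^ 2 * lam / (2 * c) := ⟨_, rfl⟩
  have he0 : 0 < e := by rw [he]; positivity
  -- The localization energy D/R² is of lower order, and this R makes it less than e/R.
  obtain ⟨R, hR⟩ : ∃ R, R = D / e + 1 := ⟨_, rfl⟩
  have hR0 : 0 < R := by rw [hR]; positivity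
  obtain ⟨U, hU1, hUs, hUN, hUG, hU0⟩ := hprof lam R hlam hR0
  obtain ⟨A, hAD, hdiv, hAG, hA⟩ := hfield R (Q * δ / R) hR0
  -- The minimizer in k of (Qs/c - k)²/(2m) - k.
  obtain ⟨k, hk⟩ : ∃ k, k = Q / c * (Q * δ / R) + m := ⟨_, rfl⟩
  refine ⟨(modulate ((k / hbar) • v) U, A), ⟨memH1_of_contDiff (contDiff_modulate _ hU1)
    (hasCompactSupport_modulate _ hUs), hAD, by rw [normSqL2_modulate, hUN], hdiv⟩, ?_⟩
  rw [energy_modulate m c Q hh.ne' j v hU1 hUs hAD fun x hx => hA x (hU0 x hx), hUN, hUG]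
  have hf := fieldL_le c v (gradL A)
  rw [← gradNorm_sq, hAG] at hf
  have e1 : 1 / (2 * m) * (hbar ^ 2 * (lam / N * G / R ^ 2)
      + (Q / c * (Q * δ / R) - k) ^ 2 * ‖v‖ ^ 2 * lam) = D / R ^ 2 + m * ‖v‖ ^ 2 * lam / 2 := by
    rw [hk, hD, sub_add_cancel_left]; field_simp
  have e2 : 1 / (8 * Real.pi) * ((Q * δ / R) ^ 2 * R * Y) = C * (Q ^ 2 * δ ^ 2) / R := by
    rw [hC]; field_simp
  have e3 : k * ‖v‖ ^ 2 * lam = 2 * e / R + m * ‖v‖ ^ 2 * lam := by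
    rw [hk, he]; field_simp
  have h4 : C * (Q ^ 2 * δ ^ 2) ≤ e := by
    have h5 : (C + 1) * δ = ‖v‖ ^ 2 * lam / (2 * c) := by rw [hδ]; field_simp
    have h6 : C * δ ≤ ‖v‖ ^ 2 * lam / (2 * c) := by rw [← h5, add_mul]; linarith
    calc C * (Q ^ 2 * δ ^ 2) = Q ^ 2 * δ * (C * δ) := by ring
      _ ≤ Q ^ 2 * δ * (‖v‖ ^ 2 * lam / (2 * c)) := by gcongr
      _ = e := by rw [he]; ring
  have h7 : D / R < e := by
    rw [div_lt_iff₀ hR0, hR, mul_add, mul_div_cancel₀ _ he0.ne']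
    linarith
  have h8 : D / R ^ 2 + C * (Q ^ 2 * δ ^ 2) / R < 2 * e / R := by
    calc D / R ^ 2 + C * (Q ^ 2 * δ ^ 2) / R = (D / R + C * (Q ^ 2 * δ ^ 2)) / R := by
          field_simp
      _ < 2 * e / R := by
          gcongr
          linarith
  rw [e1, e3]
  rw [e2] at hf
  linarith

end TrialEnergy

/-! ### Averaging over translates and interpolation of Lᵖ norms -/

section Nonvanishing

/-- Tonelli and translation invariance; it adds up local estimates over all centres y. -/
lemma lintegral_translate_mul {a b : R3 → ℝ≥0∞} (ha : Measurable a) (hb : AEMeasurable b volume) :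
    ∫⁻ y, ∫⁻ x, a (x - y) * b x = (∫⁻ x, a x) * ∫⁻ x, b x := by
  rw [lintegral_lintegral_swap]
  · have : ∀ x, ∫⁻ y, a (x - y) * b x = (∫⁻ y, a y) * b x := fun x => by
      have hm : Measurable fun y => a (x - y) := ha.comp (measurable_const.sub measurable_id)
      rw [lintegral_mul_const _ hm, lintegral_sub_left_eq_self a x]
    simp only [this]
    rw [lintegral_const_mul'' _ hb]
  · exact (ha.comp (measurable_snd.sub measurable_fst)).aemeasurable.mul hb.comp_snd

variable {E : Type*} [NormedAddCommGroup E]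

lemma lintegral_pow_six (f : R3 → E) : ∫⁻ x, ‖f x‖ₑ ^ 6 = eLpNorm f 6 volume ^ 6 := by
  have := eLpNorm_nnreal_pow_eq_lintegral (μ := volume) (f := f) (p := 6) (by norm_num)
  simpa using this.symm

lemma lintegral_pow_three (f : R3 → E) : ∫⁻ x, ‖f x‖ₑ ^ 3 = eLpNorm f 3 volume ^ 3 := by
  have := eLpNorm_nnreal_pow_eq_lintegral (μ := volume) (f := f) (p := 3) (by norm_num)
  simpa using this.symm

lemma lintegral_mul_sq_le {a b : R3 → ℝ≥0∞} (ha : AEMeasurable a volume)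
    (hb : AEMeasurable b volume) :
    (∫⁻ x, a x * b x) ^ 2 ≤ (∫⁻ x, a x ^ 2) * ∫⁻ x, b x ^ 2 := by
  have h := ENNReal.lintegral_mul_le_Lp_mul_Lq volume Real.HolderConjugate.two_two ha hb
  have h2 := pow_le_pow_left' h 2
  simp only [Pi.mul_apply, ENNReal.rpow_two] at h2
  refine h2.trans (le_of_eq ?_)
  rw [mul_pow, ← ENNReal.rpow_natCast, ← ENNReal.rpow_natCast, ← ENNReal.rpow_mul,
    ← ENNReal.rpow_mul]
  norm_num

/-- Cauchy-Schwarz for |f|⁴ = |f|·|f|³. -/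
lemma lintegral_pow_four_le {f : R3 → E} (hf : AEStronglyMeasurable f volume) :
    ∫⁻ x, ‖f x‖ₑ ^ 4 ≤ eLpNorm f 2 volume * eLpNorm f 6 volume ^ 3 := by
  refine le_of_sq_le_sq ?_
  have h := lintegral_mul_sq_le hf.enorm (hf.enorm.pow_const 3)
  simp only [← pow_mul, ← pow_succ'] at h
  norm_num at h
  rw [lintegral_pow_six, ← eLpNorm_two_sq] at h
  rwa [mul_pow, ← pow_mul]

lemma eLpNorm_three_pow_six_le {f : R3 → E} (hf : AEStronglyMeasurable f volume) :
    eLpNorm f 3 volume ^ 6 ≤ eLpNorm f 2 volume ^ 2 * ∫⁻ x, ‖f x‖ₑ ^ 4 := by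
  have h := lintegral_mul_sq_le hf.enorm (hf.enorm.pow_const 2)
  simp only [← pow_mul, ← pow_succ'] at h
  norm_num at h
  rwa [lintegral_pow_three, ← eLpNorm_two_sq, ← pow_mul] at h

end Nonvanishing

/-! ### A Lions type estimate: uniformly small local mass forces small interaction -/

section Nonvanishing

variable {F : Type*} [NormedAddCommGroup F] [InnerProductSpace ℝ F] [FiniteDimensional ℝ F]

lemma enorm_add_sq_le (a b : F) : ‖a + b‖ₑ ^ 2 ≤ 2 * (‖a‖ₑ ^ 2 + ‖b‖ₑ ^ 2) := by
  have h : ‖a + b‖ ^ 2 ≤ 2 * (‖a‖ ^ 2 + ‖b‖ ^ 2) := by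
    have := norm_add_le a b
    nlinarith [sq_nonneg (‖a‖ - ‖b‖), norm_nonneg (a + b), norm_nonneg a, norm_nonneg b]
  have h2 := ENNReal.ofReal_le_ofReal h
  rwa [ENNReal.ofReal_mul zero_le_two, ENNReal.ofReal_add (by positivity) (by positivity),
    ENNReal.ofReal_pow (norm_nonneg _), ENNReal.ofReal_pow (norm_nonneg _),
    ENNReal.ofReal_pow (norm_nonneg _), ofReal_norm, ofReal_norm, ofReal_norm,
    ENNReal.ofReal_ofNat] at h2

/-- The localization of `f` near `y`. -/
def localize (y : R3) (f : R3 → F) (x : R3) : F := unitBump (x - y) • f x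

lemma contDiff_unitBump_sub (y : R3) : ContDiff ℝ ∞ fun x => unitBump (x - y) :=
  unitBump.contDiff.comp (contDiff_id.sub contDiff_const)

lemma enorm_localize_le (y : R3) (f : R3 → F) (x : R3) : ‖localize y f x‖ₑ ≤ ‖f x‖ₑ := by
  rw [enorm_le_iff_norm_le, localize, norm_smul, Real.norm_of_nonneg unitBump.nonneg]
  exact mul_le_of_le_one_left (norm_nonneg _) unitBump.le_one

lemma norm_localize_le (y : R3) (f : R3 → F) (x : R3) : ‖localize y f x‖ ≤ ‖f x‖ :=
  enorm_le_iff_norm_le.1 (enorm_localize_le y f x)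

lemma exists_partial_unitBump_bound : ∃ D : ℝ, 0 ≤ D ∧ ∀ x k,
    ‖fderiv ℝ unitBump x (coordVec k)‖ ≤ D := by
  obtain ⟨D, hD, h⟩ := exists_partial_cutoff_bound
  refine ⟨D, hD, fun x k => ?_⟩
  have := h 0 x k
  have e : cutoff 0 = unitBump := by ext x; simp [cutoff]
  rw [e] at this
  simpa using this

lemma aestronglyMeasurable_localize (y : R3) {f : R3 → F} (hf : AEStronglyMeasurable f volume) :
    AEStronglyMeasurable (localize y f) volume :=
  (contDiff_unitBump_sub y).continuous.aestronglyMeasurable.smul hf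

lemma memLp_localize (y : R3) {p : ℝ≥0∞} {f : R3 → F} (hf : MemLp f p volume) :
    MemLp (localize y f) p volume :=
  hf.mono (aestronglyMeasurable_localize y hf.1) (Eventually.of_forall (norm_localize_le y f))

lemma fderiv_unitBump_sub (y x : R3) (k : Fin 3) :
    fderiv ℝ (fun x => unitBump (x - y)) x (coordVec k)
      = fderiv ℝ unitBump (x - y) (coordVec k) := by
  rw [fderiv_comp_sub]

lemma isWeakPartial_localize (y : R3) {f : R3 → F} (hf : HasL2Derivatives f) (k : Fin 3) :
    IsWeakPartial k (localize y f) fun x =>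
      fderiv ℝ unitBump (x - y) (coordVec k) • f x + unitBump (x - y) • weakPartial k f x := by
  have := (hf.isWeakPartial k).smul_of_contDiff (contDiff_unitBump_sub y)
  simp only [fderiv_unitBump_sub] at this
  exact this

lemma MemH1.localize {f : R3 → F} (hf : MemH1 f) (y : R3) : MemH1 (localize y f) := by
  obtain ⟨D, hD, h⟩ := exists_partial_unitBump_bound
  refine ⟨memLp_localize y hf.1, fun k => ⟨_, isWeakPartial_localize y hf.2 k, ?_⟩⟩
  have hc : Continuous fun x => fderiv ℝ unitBump (x - y) (coordVec k) :=
    (continuous_partial unitBump.contDiff (n := 1) (by simp) _).comp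
      (continuous_id.sub continuous_const)
  refine MemLp.add ?_ (memLp_localize y (hf.2.memLp k))
  refine (hf.1.const_smul D).mono (hc.aestronglyMeasurable.smul hf.1.1)
    (Eventually.of_forall fun x => ?_)
  rw [norm_smul, Pi.smul_apply, norm_smul, Real.norm_of_nonneg hD]
  gcongr
  exact h _ _

/-- The right side is kept as an integral of local densities in x - y, so that it can be integrated
over y. A bound by global norms would not be integrable in y. -/
lemma eLpNorm_localize_six_sq_le {f : R3 → F} (hf : MemH1 f) (y : R3) :
    eLpNorm (localize y f) 6 volume ^ 2 ≤ ENNReal.ofReal sobolevConst ^ 2 *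
      ∑ k, 2 * ((∫⁻ x, ‖fderiv ℝ unitBump (x - y) (coordVec k)‖ₑ ^ 2 * ‖f x‖ₑ ^ 2)
        + ∫⁻ x, ‖unitBump (x - y)‖ₑ ^ 2 * ‖weakPartial k f x‖ₑ ^ 2) := by
  have hl := hf.localize y
  have h1 := pow_le_pow_left' hl.memD1.sobolev 2
  refine h1.trans ?_
  rw [ENNReal.ofReal_mul sobolevConst_nonneg, mul_pow,
    ← ENNReal.ofReal_pow (Real.sqrt_nonneg _), Real.sq_sqrt (gradNormSqL2_nonneg _)]
  gcongr
  rw [gradNormSqL2, ENNReal.ofReal_sum_of_nonneg fun _ _ => normSqL2_nonneg _]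
  refine Finset.sum_le_sum fun k _ => ?_
  have hm := hl.2.memLp k
  rw [← norm_toL2_sq hm, ENNReal.ofReal_pow (norm_nonneg _), ofReal_norm_toL2 hm, eLpNorm_two_sq]
  have hc : Continuous fun x => fderiv ℝ unitBump (x - y) (coordVec k) :=
    (continuous_partial unitBump.contDiff (n := 1) (by simp) _).comp
      (continuous_id.sub continuous_const)
  have hm2 : AEMeasurable (fun x => ‖fderiv ℝ unitBump (x - y) (coordVec k)‖ₑ ^ 2 * ‖f x‖ₑ ^ 2)
      volume := (hc.measurable.enorm.pow_const 2).aemeasurable.mul (hf.1.1.enorm.pow_const 2)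
  rw [← lintegral_add_left' hm2, ← lintegral_const_mul' _ _ (by norm_num)]
  refine lintegral_mono_ae ?_
  filter_upwards [(isWeakPartial_localize y hf.2 k).weakPartial_ae_eq] with x hx
  rw [hx]
  refine (enorm_add_sq_le _ _).trans (le_of_eq ?_)
  simp only [enorm_smul, mul_pow]

/-- If the localizations of `f` are uniformly small in `L²`, then `f` is small in `L⁴`. -/
lemma lintegral_pow_four_le_of_localize {f : R3 → F} (hf : MemH1 f) {s : ℝ≥0∞}
    (hs : ∀ y, eLpNorm (localize y f) 2 volume ≤ s) :
    (∫⁻ x, ‖unitBump x‖ₑ ^ 4) * ∫⁻ x, ‖f x‖ₑ ^ 4 ≤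
      s * eLpNorm f 6 volume * (ENNReal.ofReal sobolevConst ^ 2 *
        ∑ k, 2 * ((∫⁻ x, ‖fderiv ℝ unitBump x (coordVec k)‖ₑ ^ 2) * eLpNorm f 2 volume ^ 2
          + (∫⁻ x, ‖unitBump x‖ₑ ^ 2) * eLpNorm (weakPartial k f) 2 volume ^ 2)) := by
  have hm : Measurable fun x => ‖unitBump x‖ₑ := unitBump.continuous.measurable.enorm
  have hd : ∀ k, Measurable fun x => ‖fderiv ℝ unitBump x (coordVec k)‖ₑ := fun k =>
    (continuous_partial unitBump.contDiff (n := 1) (by simp) _).measurable.enorm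
  rw [← lintegral_translate_mul (hm.pow_const 4) (hf.1.1.enorm.pow_const 4)]
  have h1 : ∀ y, ∫⁻ x, ‖unitBump (x - y)‖ₑ ^ 4 * ‖f x‖ₑ ^ 4 ≤
      s * eLpNorm f 6 volume * (ENNReal.ofReal sobolevConst ^ 2 *
      ∑ k, 2 * ((∫⁻ x, ‖fderiv ℝ unitBump (x - y) (coordVec k)‖ₑ ^ 2 * ‖f x‖ₑ ^ 2)
        + ∫⁻ x, ‖unitBump (x - y)‖ₑ ^ 2 * ‖weakPartial k f x‖ₑ ^ 2)) := by
    intro y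
    have e : ∀ x, ‖unitBump (x - y)‖ₑ ^ 4 * ‖f x‖ₑ ^ 4 = ‖localize y f x‖ₑ ^ 4 := fun x => by
      rw [localize, enorm_smul, mul_pow]
    simp only [e]
    refine (lintegral_pow_four_le (aestronglyMeasurable_localize y hf.1.1)).trans ?_
    -- Of the three L⁶ factors one is bounded by the global norm. The other two go into the
    -- localized Sobolev inequality and make the bound integrable in y.
    rw [pow_succ' _ 2, ← mul_assoc]
    gcongr
    · exact hs y
    · exact eLpNorm_mono_enorm (enorm_localize_le y f)
    · exact eLpNorm_localize_six_sq_le hf y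
  refine (lintegral_mono h1).trans (le_of_eq ?_)
  have key : ∀ (a b : R3 → ℝ≥0∞), Measurable a → AEMeasurable b volume →
      AEMeasurable (fun y => ∫⁻ x, a (x - y) * b x) volume := fun a b ha hb =>
    AEMeasurable.lintegral_prod_right' (μ := volume) (ν := volume)
      (f := fun p : R3 × R3 => a (p.2 - p.1) * b p.2)
      ((ha.comp (measurable_snd.sub measurable_fst)).aemeasurable.mul hb.comp_snd)
  have k1 := fun k => key _ _ ((hd k).pow_const 2) (hf.1.1.enorm.pow_const 2)
  have k2 := fun k => key _ _ (hm.pow_const 2) ((hf.2.memLp k).1.enorm.pow_const 2)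
  have k3 : ∀ k, AEMeasurable (fun y =>
      (∫⁻ x, ‖fderiv ℝ unitBump (x - y) (coordVec k)‖ₑ ^ 2 * ‖f x‖ₑ ^ 2)
        + ∫⁻ x, ‖unitBump (x - y)‖ₑ ^ 2 * ‖weakPartial k f x‖ₑ ^ 2) volume :=
    fun k => (k1 k).add (k2 k)
  have k4 := Finset.aemeasurable_fun_sum Finset.univ fun k _ => (k3 k).const_mul 2
  rw [lintegral_const_mul'' _ (k4.const_mul _), lintegral_const_mul'' _ k4, lintegral_finsetSum' _
    fun k _ => (k3 k).const_mul 2]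
  congr 2
  refine Finset.sum_congr rfl fun k _ => ?_
  rw [lintegral_const_mul'' _ (k3 k), lintegral_add_left' (k1 k),
    lintegral_translate_mul ((hd k).pow_const 2) (hf.1.1.enorm.pow_const 2),
    lintegral_translate_mul (hm.pow_const 2) ((hf.2.memLp k).1.enorm.pow_const 2),
    eLpNorm_two_sq volume f, eLpNorm_two_sq volume (weakPartial k f)]

lemma lintegral_enorm_pow_lt_top {f : R3 → ℝ} (hf : Continuous f) (hs : HasCompactSupport f)
    {n : ℕ} (hn : n ≠ 0) : ∫⁻ x, ‖f x‖ₑ ^ n < ⊤ := by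
  have h := ((hf.pow n).integrable_of_hasCompactSupport (μ := volume)
    (hs.comp_left (g := fun t => t ^ n) (zero_pow hn))).2
  simpa [HasFiniteIntegral, enorm_pow] using h

lemma lintegral_unitBump_pos : 0 < ∫⁻ x, ‖unitBump x‖ₑ ^ 4 := by
  rw [lintegral_pos_iff_support (unitBump.continuous.measurable.enorm.pow_const 4)]
  refine (Metric.measure_ball_pos volume (0 : R3) unitBump.rOut_pos).trans_le
    (measure_mono fun x hx => ?_)
  rw [← unitBump.support_eq] at hx
  simpa using hx

lemma eLpNorm_le_gradNorm {f : R3 → F} (hf : HasL2Derivatives f) (k : Fin 3) :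
    eLpNorm (weakPartial k f) 2 volume ≤ ENNReal.ofReal (gradNorm f) := by
  rw [← ofReal_norm_toL2 (hf.memLp k)]
  exact ENNReal.ofReal_le_ofReal (norm_gradL_le f k)

lemma exists_pow_four_bound (F : Type*) [NormedAddCommGroup F] [InnerProductSpace ℝ F]
    [FiniteDimensional ℝ F] : ∃ C : ℝ≥0∞, C ≠ ⊤ ∧ ∀ (f : R3 → F) (s M : ℝ≥0∞), MemH1 f →
    eLpNorm f 2 volume ≤ M → ENNReal.ofReal (gradNorm f) ≤ M →
    (∀ y, eLpNorm (localize y f) 2 volume ≤ s) → ∫⁻ x, ‖f x‖ₑ ^ 4 ≤ C * s * M ^ 3 := by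
  obtain ⟨W, hW⟩ : ∃ W, W = ∫⁻ x, ‖unitBump x‖ₑ ^ 4 := ⟨_, rfl⟩
  have hW0 : W ≠ 0 := hW ▸ lintegral_unitBump_pos.ne'
  have hWt : W ≠ ⊤ := hW ▸ (lintegral_enorm_pow_lt_top unitBump.continuous
    unitBump.hasCompactSupport (by norm_num)).ne
  obtain ⟨T, hT⟩ : ∃ T, T = ∑ k : Fin 3, 2 * ((∫⁻ x, ‖fderiv ℝ unitBump x (coordVec k)‖ₑ ^ 2)
    + ∫⁻ x, ‖unitBump x‖ₑ ^ 2) := ⟨_, rfl⟩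
  have hTt : T ≠ ⊤ := by
    rw [hT]
    refine (ENNReal.sum_lt_top.2 fun k _ => ENNReal.mul_lt_top (by norm_num)
      (ENNReal.add_lt_top.2 ⟨lintegral_enorm_pow_lt_top ?_ ?_ two_ne_zero,
        lintegral_enorm_pow_lt_top unitBump.continuous unitBump.hasCompactSupport
          two_ne_zero⟩)).ne
    · exact continuous_partial unitBump.contDiff (n := 1) (by simp) _
    · exact hasCompactSupport_partial unitBump.hasCompactSupport _
  refine ⟨W⁻¹ * (ENNReal.ofReal sobolevConst ^ 3 * T), ENNReal.mul_ne_top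
    (ENNReal.inv_ne_top.2 hW0) (ENNReal.mul_ne_top (by finiteness) hTt), ?_⟩
  intro f s M hf h2 hg hs
  have h6 : eLpNorm f 6 volume ≤ ENNReal.ofReal sobolevConst * M := by
    refine hf.memD1.sobolev.trans ?_
    rw [ENNReal.ofReal_mul sobolevConst_nonneg, gradNormSqL2_eq hf.2]
    gcongr
    exact hg
  have key := lintegral_pow_four_le_of_localize hf hs
  rw [← hW] at key
  have hsum : ∑ k : Fin 3, 2 * ((∫⁻ x, ‖fderiv ℝ unitBump x (coordVec k)‖ₑ ^ 2) *
        eLpNorm f 2 volume ^ 2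
      + (∫⁻ x, ‖unitBump x‖ₑ ^ 2) * eLpNorm (weakPartial k f) 2 volume ^ 2) ≤ T * M ^ 2 := by
    rw [hT, Finset.sum_mul]
    refine Finset.sum_le_sum fun k _ => ?_
    rw [mul_assoc, add_mul]
    gcongr
    exact (eLpNorm_le_gradNorm hf.2 k).trans hg
  have h1 : W * ∫⁻ x, ‖f x‖ₑ ^ 4 ≤ ENNReal.ofReal sobolevConst ^ 3 * T * s * M ^ 3 := by
    refine key.trans ?_
    calc _ ≤ s * (ENNReal.ofReal sobolevConst * M) *
        (ENNReal.ofReal sobolevConst ^ 2 * (T * M ^ 2)) := by gcongr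
      _ = _ := by ring
  calc ∫⁻ x, ‖f x‖ₑ ^ 4 = W⁻¹ * (W * ∫⁻ x, ‖f x‖ₑ ^ 4) := by
        rw [← mul_assoc, ENNReal.inv_mul_cancel hW0 hWt, one_mul]
    _ ≤ W⁻¹ * (ENNReal.ofReal sobolevConst ^ 3 * T * s * M ^ 3) := by gcongr
    _ = _ := by ring

/-- Vanishing of all localizations makes the interaction with any field vanish. -/
lemma exists_mixNorm_bound : ∃ C : ℝ, 0 ≤ C ∧ ∀ (A : R3 → R3) (ψ : R3 → C2) (s M : ℝ),
    MemD1 A → MemH1 ψ → 0 ≤ s → ‖toL2 ψ‖ ≤ M → gradNorm ψ ≤ M →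
    (∀ y, ‖toL2 (localize y ψ)‖ ≤ s) → mixNorm A ψ ^ 6 ≤ normL6 A ^ 6 * (C * s * M ^ 5) := by
  obtain ⟨C, hC, h⟩ := exists_pow_four_bound C2
  refine ⟨C.toReal, ENNReal.toReal_nonneg, fun A ψ s M hA hψ hs hM hg hy => ?_⟩
  have hM0 : 0 ≤ M := (norm_nonneg _).trans hM
  have h2 : eLpNorm ψ 2 volume ≤ ENNReal.ofReal M := by
    rw [← ofReal_norm_toL2 hψ.1]; exact ENNReal.ofReal_le_ofReal hM
  have h4 := h ψ (ENNReal.ofReal s) (ENNReal.ofReal M) hψ h2 (ENNReal.ofReal_le_ofReal hg)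
    fun y => by
      rw [← ofReal_norm_toL2 (memLp_localize y hψ.1)]; exact ENNReal.ofReal_le_ofReal (hy y)
  have h3 := eLpNorm_three_pow_six_le hψ.1.1
  have hH : eLpNorm (fun x => ‖A x‖ * ‖ψ x‖) 2 volume ≤
      eLpNorm A 6 volume * eLpNorm ψ 3 volume := by
    have := eLpNorm_smul_le_mul_eLpNorm (p := 6) (q := 3) (r := 2) hψ.1.1.norm hA.memLp_six.1.norm
    rw [eLpNorm_norm, eLpNorm_norm] at this
    exact this
  have hmem := memLp_norm_mul_norm hA.memLp_six hψ.1 hψ.memLp_six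
  have hfin : eLpNorm (fun x => ‖A x‖ * ‖ψ x‖) 2 volume ^ 6 ≤
      eLpNorm A 6 volume ^ 6 * ENNReal.ofReal (C.toReal * s * M ^ 5) := by
    calc _ ≤ (eLpNorm A 6 volume * eLpNorm ψ 3 volume) ^ 6 := by gcongr
      _ = eLpNorm A 6 volume ^ 6 * eLpNorm ψ 3 volume ^ 6 := mul_pow _ _ _
      _ ≤ eLpNorm A 6 volume ^ 6 * (ENNReal.ofReal M ^ 2 *
          (C * ENNReal.ofReal s * ENNReal.ofReal M ^ 3)) := by
            gcongr
            refine h3.trans ?_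
            gcongr
      _ = _ := by
            rw [ENNReal.ofReal_mul (by positivity), ENNReal.ofReal_mul (by positivity),
              ENNReal.ofReal_toReal hC, ENNReal.ofReal_pow hM0]
            ring
  rw [mixNorm, norm_toL2 hmem, normL6, ← ENNReal.toReal_pow, ← ENNReal.toReal_pow]
  have e : C.toReal * s * M ^ 5 = (ENNReal.ofReal (C.toReal * s * M ^ 5)).toReal :=
    (ENNReal.toReal_ofReal (by positivity)).symm
  rw [e, ← ENNReal.toReal_mul]
  exact ENNReal.toReal_mono (ENNReal.mul_lt_top (ENNReal.pow_lt_top hA.memLp_six.2)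
    ENNReal.ofReal_lt_top).ne hfin

end Nonvanishing

/-! ### Weak convergence in Hilbert space -/

section WeakConvergence

variable {H : Type*} [NormedAddCommGroup H] [InnerProductSpace ℝ H]

/-- Weak convergence of a sequence in a Hilbert space. -/
def WeakTo (x : ℕ → H) (x₀ : H) : Prop :=
  ∀ h : H, Tendsto (fun n => inner ℝ h (x n)) atTop (𝓝 (inner ℝ h x₀))

lemma WeakTo.comp {x : ℕ → H} {x₀ : H} (h : WeakTo x x₀) {φ : ℕ → ℕ} (hφ : StrictMono φ) :
    WeakTo (fun n => x (φ n)) x₀ := fun y => (h y).comp hφ.tendsto_atTop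

lemma WeakTo.sub_const {x : ℕ → H} {x₀ : H} (h : WeakTo x x₀) :
    WeakTo (fun n => x n - x₀) 0 := fun y => by
  simpa [inner_sub_right] using (h y).sub_const (inner ℝ y x₀)

lemma WeakTo.add {x y : ℕ → H} {x₀ y₀ : H} (hx : WeakTo x x₀) (hy : WeakTo y y₀) :
    WeakTo (fun n => x n + y n) (x₀ + y₀) := fun h => by
  simpa only [inner_add_right] using (hx h).add (hy h)

lemma WeakTo.sum {ι : Type*} (s : Finset ι) {x : ι → ℕ → H} {x₀ : ι → H}
    (h : ∀ i ∈ s, WeakTo (x i) (x₀ i)) : WeakTo (fun n => ∑ i ∈ s, x i n) (∑ i ∈ s, x₀ i) :=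
  fun y => by
    simpa only [inner_sum] using tendsto_finsetSum s fun i hi => h i hi y

lemma WeakTo.map {H' : Type*} [NormedAddCommGroup H'] [InnerProductSpace ℝ H'] [CompleteSpace H]
    [CompleteSpace H'] {x : ℕ → H} {x₀ : H} (h : WeakTo x x₀) (T : H →L[ℝ] H') :
    WeakTo (fun n => T (x n)) (T x₀) := fun y => by
  simpa only [ContinuousLinearMap.adjoint_inner_left] using h (ContinuousLinearMap.adjoint T y)

/-- Sequential Banach-Alaoglu in the separable Hilbert space H, transported by the Riesz
isomorphism. -/
lemma exists_weakTo_subseq [CompleteSpace H] [TopologicalSpace.SeparableSpace H] {x : ℕ → H}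
    {M : ℝ} (hx : ∀ n, ‖x n‖ ≤ M) : ∃ x₀ : H, ∃ φ : ℕ → ℕ, StrictMono φ ∧
      WeakTo (fun n => x (φ n)) x₀ := by
  have hc := WeakDual.isSeqCompact_closedBall ℝ H (0 : StrongDual ℝ H) M
  have hmem : ∀ n, StrongDual.toWeakDual (InnerProductSpace.toDual ℝ H (x n)) ∈
      WeakDual.toStrongDual ⁻¹' Metric.closedBall (0 : StrongDual ℝ H) M := fun n => by
    rw [Set.mem_preimage, mem_closedBall_zero_iff]
    exact ((InnerProductSpace.toDual ℝ H).norm_map (x n)).le.trans (hx n)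
  obtain ⟨a, -, φ, hφ, hlim⟩ := hc hmem
  refine ⟨(InnerProductSpace.toDual ℝ H).symm (WeakDual.toStrongDual a), φ, hφ, fun h => ?_⟩
  have h1 := ((WeakDual.eval_continuous h).tendsto a).comp hlim
  rw [← real_inner_comm, InnerProductSpace.toDual_symm_apply]
  refine Tendsto.congr (fun n => ?_) h1
  simp [real_inner_comm]

end WeakConvergence

/-! ### Weak limits of functions with bounded gradients -/

section WeakLimits

variable {F : Type*} [NormedAddCommGroup F] [InnerProductSpace ℝ F] [FiniteDimensional ℝ F]

lemma memLp_smul_vec {w : R3 → ℝ} (hw : MemLp w 2 volume) (e : F) :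
    MemLp (fun x => w x • e) 2 volume :=
  ((ContinuousLinearMap.id ℝ ℝ).smulRight e).comp_memLp' hw

lemma inner_integral_smul {w : R3 → ℝ} {u : R3 → F} (hw : MemLp w 2 volume)
    (hu : MemLp u 2 volume) (e : F) :
    inner ℝ e (∫ x, w x • u x) = inner ℝ (toL2 fun x => w x • e) (toL2 u) := by
  have hwe := memLp_smul_vec hw e
  have hi : Integrable fun x => w x • u x :=
    memLp_one_iff_integrable.1 (hu.smul (p := 2) (q := 2) (r := 1) hw)
  rw [inner_toL2 hwe hu, ← integral_inner hi e]
  simp only [real_inner_smul_left, real_inner_smul_right]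

lemma norm_integral_smul_le {w : R3 → ℝ} {u : R3 → F} (hw : MemLp w 2 volume)
    (hu : MemLp u 2 volume) : ‖∫ x, w x • u x‖ ≤ ‖toL2 w‖ * ‖toL2 u‖ := by
  have h : ∀ e : F, ‖e‖ ≤ 1 → inner ℝ e (∫ x, w x • u x) ≤ ‖toL2 w‖ * ‖toL2 u‖ := fun e he => by
    rw [inner_integral_smul hw hu]
    refine (real_inner_le_norm _ _).trans ?_
    gcongr
    refine norm_toL2_le (memLp_smul_vec hw e) hw (Eventually.of_forall fun x => ?_)
    rw [norm_smul]
    exact mul_le_of_le_one_right (norm_nonneg _) he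
  by_cases h0 : ∫ x, w x • u x = 0
  · rw [h0, norm_zero]; positivity
  · have := h (‖∫ x, w x • u x‖⁻¹ • ∫ x, w x • u x) (by
      rw [norm_smul, norm_inv, norm_norm, inv_mul_cancel₀ (norm_ne_zero_iff.2 h0)])
    rw [real_inner_smul_left, real_inner_self_eq_norm_sq] at this
    have hn : ‖∫ x, w x • u x‖ ≠ 0 := norm_ne_zero_iff.2 h0
    rwa [sq, inv_mul_cancel_left₀ hn] at this

lemma WeakTo.tendsto_integral {w : R3 → ℝ} {u : ℕ → R3 → F} {u₀ : R3 → F}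
    (hw : MemLp w 2 volume) (hu : ∀ n, MemLp (u n) 2 volume) (hu₀ : MemLp u₀ 2 volume)
    (h : WeakTo (fun n => toL2 (u n)) (toL2 u₀)) :
    Tendsto (fun n => ∫ x, w x • u n x) atTop (𝓝 (∫ x, w x • u₀ x)) := by
  let b := stdOrthonormalBasis ℝ F
  have e : ∀ y : F, y = ∑ i, inner ℝ (b i) y • b i := fun y => (b.sum_repr' y).symm
  rw [e (∫ x, w x • u₀ x)]
  refine Tendsto.congr (fun n => (e (∫ x, w x • u n x)).symm) ?_
  refine tendsto_finsetSum _ fun i _ => Tendsto.smul_const ?_ _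
  simp only [inner_integral_smul hw (hu _), inner_integral_smul hw hu₀]
  exact h _

variable {κ : R3 → ℝ}

lemma memLp_mul_inv {w : R3 → ℝ} (hw : Continuous w) (hs : HasCompactSupport w)
    (hκ : Continuous κ) (hpos : ∀ x, 0 < κ x) : MemLp (fun x => w x * (κ x)⁻¹) 2 volume :=
  (hw.mul (hκ.inv₀ fun x => (hpos x).ne')).memLp_of_hasCompactSupport hs.mul_right

lemma smul_eq_weighted (hpos : ∀ x, 0 < κ x) (w : R3 → ℝ) (f : R3 → F) :
    (fun x => w x • f x) = fun x => (w x * (κ x)⁻¹) • (κ x • f x) := by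
  ext1 x
  rw [smul_smul, mul_assoc, inv_mul_cancel₀ (hpos x).ne', mul_one]

/-- Fields in D¹ need not be square integrable, so weak convergence is imposed on κf for a positive
continuous weight κ. A compactly supported w is then tested through w/κ, which is in L². For spinors
κ = 1 is enough. -/
lemma WeakTo.tendsto_integral_weighted {w : R3 → ℝ} {f : ℕ → R3 → F} {f₀ : R3 → F}
    (hw : Continuous w) (hs : HasCompactSupport w) (hκ : Continuous κ) (hpos : ∀ x, 0 < κ x)
    (hf : ∀ n, MemLp (fun x => κ x • f n x) 2 volume)
    (hf₀ : MemLp (fun x => κ x • f₀ x) 2 volume)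
    (h : WeakTo (fun n => toL2 fun x => κ x • f n x) (toL2 fun x => κ x • f₀ x)) :
    Tendsto (fun n => ∫ x, w x • f n x) atTop (𝓝 (∫ x, w x • f₀ x)) := by
  simp only [smul_eq_weighted hpos w]
  exact h.tendsto_integral (memLp_mul_inv hw hs hκ hpos) hf hf₀

lemma locallyIntegrable_of_weighted (hκ : Continuous κ) (hpos : ∀ x, 0 < κ x) {f : R3 → F}
    (hf : MemLp (fun x => κ x • f x) 2 volume) : LocallyIntegrable f volume := by
  have h := locallyIntegrable_smul_of_continuous (hκ.inv₀ fun x => (hpos x).ne')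
    (hf.locallyIntegrable (by norm_num))
  refine h.congr (Eventually.of_forall fun x => ?_)
  simp only [Pi.inv_apply]
  rw [smul_smul, inv_mul_cancel₀ (hpos x).ne', one_smul]

instance : Fact ((2 : ℝ≥0∞) ≠ ⊤) := ⟨by norm_num⟩

/-- Weak compactness of sequences with bounded gradients and bounded weighted `L²` norms. -/
lemma exists_weak_limit (hκ : Continuous κ) (hpos : ∀ x, 0 < κ x) {f : ℕ → R3 → F} {M : ℝ}
    (hf : ∀ n, MemLp (fun x => κ x • f n x) 2 volume) (hd : ∀ n, HasL2Derivatives (f n))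
    (hM : ∀ n, ‖toL2 fun x => κ x • f n x‖ ≤ M) (hMd : ∀ n, gradNorm (f n) ≤ M) :
    ∃ f₀ : R3 → F, ∃ φ : ℕ → ℕ, StrictMono φ ∧ MemLp (fun x => κ x • f₀ x) 2 volume ∧
      HasL2Derivatives f₀ ∧
      WeakTo (fun n => toL2 fun x => κ x • f (φ n) x) (toL2 fun x => κ x • f₀ x) ∧
      ∀ k, WeakTo (fun n => gradL (f (φ n)) k) (gradL f₀ k) := by
  obtain ⟨u, φ, hφ, hu⟩ := exists_weakTo_subseq hM
  obtain ⟨g0, φ0, hφ0, hg0⟩ := exists_weakTo_subseq (x := fun n => gradL (f (φ n)) 0)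
    fun n => (norm_gradL_le _ _).trans (hMd _)
  obtain ⟨g1, φ1, hφ1, hg1⟩ := exists_weakTo_subseq (x := fun n => gradL (f (φ (φ0 n))) 1)
    fun n => (norm_gradL_le _ _).trans (hMd _)
  obtain ⟨g2, φ2, hφ2, hg2⟩ := exists_weakTo_subseq (x := fun n => gradL (f (φ (φ0 (φ1 n)))) 2)
    fun n => (norm_gradL_le _ _).trans (hMd _)
  have hmono : StrictMono fun n => φ (φ0 (φ1 (φ2 n))) := hφ.comp (hφ0.comp (hφ1.comp hφ2))
  have hu' : WeakTo (fun n => toL2 fun x => κ x • f (φ (φ0 (φ1 (φ2 n)))) x) u :=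
    hu.comp (hφ0.comp (hφ1.comp hφ2))
  obtain ⟨g, hg⟩ : ∃ g : Fin 3 → Lp F 2 (volume : Measure R3), ∀ k,
      WeakTo (fun n => gradL (f (φ (φ0 (φ1 (φ2 n))))) k) (g k) := by
    refine ⟨![g0, g1, g2], fun k => ?_⟩
    fin_cases k
    · exact hg0.comp (hφ1.comp hφ2)
    · exact hg1.comp hφ2
    · exact hg2
  -- The candidate limit is u/κ, where u is the weak limit of the weighted sequence.
  have e : (fun x => κ x • (κ x)⁻¹ • u x) = (u : R3 → F) := by
    ext1 x
    rw [smul_smul, mul_inv_cancel₀ (hpos x).ne', one_smul]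
  have hmem : MemLp (fun x => κ x • (κ x)⁻¹ • u x) 2 volume := by rw [e]; exact Lp.memLp u
  have hwu : WeakTo (fun n => toL2 fun x => κ x • f (φ (φ0 (φ1 (φ2 n)))) x)
      (toL2 fun x => κ x • (κ x)⁻¹ • u x) := by rw [e, toL2_coeFn]; exact hu'
  have hwp : ∀ k, IsWeakPartial k (fun x => (κ x)⁻¹ • u x) (g k) := by
    intro k
    refine ⟨locallyIntegrable_of_weighted hκ hpos hmem,
      (Lp.memLp (g k)).locallyIntegrable (by norm_num), fun χ hχ hs => ?_⟩
    have c1 := continuous_partial hχ (by simp) (coordVec k)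
    have c2 := hasCompactSupport_partial hs (coordVec k)
    -- The defining identity of the weak derivative is linear in the function and in its derivative,
    -- so it survives both weak limits.
    have t1 := hwu.tendsto_integral_weighted c1 c2 hκ hpos (fun n => hf _) hmem
    have hgk : WeakTo (fun n => toL2 (weakPartial k (f (φ (φ0 (φ1 (φ2 n)))))))
      (toL2 (g k)) := by rw [toL2_coeFn]; exact hg k
    have t2 := (hgk.tendsto_integral (hχ.continuous.memLp_of_hasCompactSupport hs)
      (fun n => (hd _).memLp k) (Lp.memLp (g k))).neg
    refine tendsto_nhds_unique t1 (t2.congr fun n => ?_)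
    exact (((hd _).isWeakPartial k).2.2 χ hχ hs).symm
  refine ⟨fun x => (κ x)⁻¹ • u x, _, hmono, hmem, fun k => ⟨_, hwp k, Lp.memLp _⟩, hwu,
    fun k => ?_⟩
  rw [gradL_eq (hwp k) (Lp.memLp _), toL2_coeFn]
  exact hg k

end WeakLimits

/-! ### Local strong convergence in the manner of Rellich -/

section Rellich

variable {F : Type*} [NormedAddCommGroup F] [InnerProductSpace ℝ F] [FiniteDimensional ℝ F]
  {κ : R3 → ℝ}

lemma continuous_mollKernel_sub (j : ℕ) (x : R3) : Continuous fun t => mollKernel j (x - t) :=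
  (contDiff_mollKernel j).continuous.comp (continuous_const.sub continuous_id)

lemma hasCompactSupport_mollKernel_sub (j : ℕ) (x : R3) :
    HasCompactSupport fun t => mollKernel j (x - t) :=
  (hasCompactSupport_mollKernel j).comp_homeomorph (Homeomorph.subLeft x)

lemma tendsto_moll_of_weakTo (hκ : Continuous κ) (hpos : ∀ x, 0 < κ x) {r : ℕ → R3 → F}
    (hr : ∀ n, MemLp (fun x => κ x • r n x) 2 volume)
    (hw : WeakTo (fun n => toL2 fun x => κ x • r n x) 0) (j : ℕ) (x : R3) :
    Tendsto (fun n => moll j (r n) x) atTop (𝓝 0) := by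
  have h0 : (0 : Lp F 2 (volume : Measure R3)) = toL2 fun x => κ x • (0 : F) := by
    simp only [smul_zero, toL2_zero]
  rw [h0] at hw
  have := hw.tendsto_integral_weighted (continuous_mollKernel_sub j x)
    (hasCompactSupport_mollKernel_sub j x) hκ hpos hr (f₀ := fun _ => 0) (by simp)
  simpa only [moll_eq_integral_swap, smul_zero, integral_zero] using this

/-- Cauchy-Schwarz for the kernel divided by κ. On bounded sets this gives the uniform bound needed
for dominated convergence of the mollified sequence. -/
lemma exists_moll_bound (hκ : Continuous κ) (hpos : ∀ x, 0 < κ x) (j : ℕ) (R : ℝ) :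
    ∃ C : ℝ, 0 ≤ C ∧ ∀ (f : R3 → F) (x : R3), MemLp (fun x => κ x • f x) 2 volume → ‖x‖ ≤ R →
      ‖moll j f x‖ ≤ C * ‖toL2 fun x => κ x • f x‖ := by
  obtain ⟨S, hS⟩ := (contDiff_mollKernel j).continuous.bounded_above_of_compact_support
    (hasCompactSupport_mollKernel j)
  obtain ⟨N, hN⟩ := exists_nat_ge R
  obtain ⟨B, hB⟩ := (isCompact_closedBall (0 : R3) (N + 1)).exists_bound_of_continuousOn
    (hκ.inv₀ fun x => (hpos x).ne').continuousOn
  have hS0 : 0 ≤ S := (norm_nonneg _).trans (hS 0)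
  have hB0 : 0 ≤ B := (norm_nonneg _).trans (hB 0 (by simp; positivity))
  have hcut : MemLp (fun t => (S * B) * cutoff N t) 2 volume :=
    ((contDiff_cutoff N).continuous.memLp_of_hasCompactSupport
      (hasCompactSupport_cutoff N)).const_mul _
  refine ⟨‖toL2 fun t => (S * B) * cutoff N t‖, norm_nonneg _, fun f x hf hx => ?_⟩
  rw [moll_eq_integral_swap, smul_eq_weighted hpos (fun t => mollKernel j (x - t)) f]
  have hm := memLp_mul_inv (continuous_mollKernel_sub j x) (hasCompactSupport_mollKernel_sub j x)
    hκ hpos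
  refine (norm_integral_smul_le hm hf).trans ?_
  gcongr
  refine norm_toL2_le hm hcut (Eventually.of_forall fun t => ?_)
  by_cases ht : ‖t‖ ≤ N + 1
  · rw [cutoff_eq_one ht, norm_mul, mul_one, Real.norm_of_nonneg (mul_nonneg hS0 hB0)]
    exact mul_le_mul (hS _) (hB t (by simpa using ht)) (norm_nonneg _) hS0
  -- The kernel has radius at most 1 and ‖x‖ ≤ N, so only points t in the ball of radius N + 1
  -- contribute.
  · have h1 : 1 ≤ ‖x - t‖ := by
      have := norm_sub_norm_le t x
      rw [norm_sub_rev] at this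
      push Not at ht
      linarith
    rw [mollKernel_eq_zero (h1.trans' (by
      rw [div_le_one (by positivity)]; linarith [(Nat.cast_nonneg j : (0 : ℝ) ≤ j)])), zero_mul,
      norm_zero]
    exact norm_nonneg _

lemma tendsto_cutoff_moll (hκ : Continuous κ) (hpos : ∀ x, 0 < κ x) {r : ℕ → R3 → F} {M : ℝ}
    (hr : ∀ n, MemLp (fun x => κ x • r n x) 2 volume)
    (hM : ∀ n, ‖toL2 fun x => κ x • r n x‖ ≤ M)
    (hw : WeakTo (fun n => toL2 fun x => κ x • r n x) 0) (j N : ℕ) :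
    Tendsto (fun n => eLpNorm (fun x => cutoff N x • moll j (r n) x) 2 volume) atTop (𝓝 0) := by
  obtain ⟨R, hR⟩ := (hasCompactSupport_cutoff N).isCompact.isBounded.subset_closedBall (0 : R3)
  obtain ⟨C, hC, hb⟩ := exists_moll_bound (F := F) hκ hpos j R
  have hM0 : 0 ≤ M := (norm_nonneg _).trans (hM 0)
  have hcont : ∀ n, Continuous (moll j (r n)) := fun n =>
    (contDiff_moll j (locallyIntegrable_of_weighted hκ hpos (hr n))).continuous
  refine tendsto_zero_of_sq ?_
  simp only [eLpNorm_two_sq]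
  have := tendsto_lintegral_of_dominated_convergence (μ := (volume : Measure R3))
    (F := fun n x => ‖cutoff N x • moll j (r n) x‖ₑ ^ 2) (f := fun _ => 0)
    (bound := fun x => ‖cutoff N x‖ₑ ^ 2 * ENNReal.ofReal (C * M) ^ 2)
    (fun n => (((contDiff_cutoff N).continuous.smul (hcont n)).enorm.measurable.pow_const 2))
    (fun n => Eventually.of_forall fun x => ?_) ?_ (Eventually.of_forall fun x => ?_)
  · simpa using this
  · by_cases hx : cutoff N x = 0
    · simp [hx]
    · have hxR : ‖x‖ ≤ R := by simpa using hR (subset_tsupport _ hx)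
      beta_reduce
      rw [enorm_smul, mul_pow]
      gcongr
      rw [← ofReal_norm]
      refine ENNReal.ofReal_le_ofReal ((hb _ x (hr n) hxR).trans ?_)
      gcongr
      exact hM n
  · rw [lintegral_mul_const _ ((contDiff_cutoff N).continuous.measurable.enorm.pow_const 2)]
    exact ENNReal.mul_ne_top (lintegral_enorm_pow_lt_top (contDiff_cutoff N).continuous
      (hasCompactSupport_cutoff N) two_ne_zero).ne (by finiteness)
  · have h1 := ((tendsto_moll_of_weakTo hκ hpos hr hw j x).const_smul (cutoff N x)).enorm
    simpa using ENNReal.Tendsto.pow (n := 2) h1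

/-- Weakly null sequences with bounded gradients tend to zero in `L²` locally. -/
lemma tendsto_cutoff_of_weakTo (hκ : Continuous κ) (hpos : ∀ x, 0 < κ x) {r : ℕ → R3 → F}
    {M : ℝ} (hr : ∀ n, MemLp (fun x => κ x • r n x) 2 volume) (hd : ∀ n, HasL2Derivatives (r n))
    (hM : ∀ n, ‖toL2 fun x => κ x • r n x‖ ≤ M) (hMd : ∀ n, gradNorm (r n) ≤ M)
    (hw : WeakTo (fun n => toL2 fun x => κ x • r n x) 0) (N : ℕ) :
    Tendsto (fun n => eLpNorm (fun x => cutoff N x • r n x) 2 volume) atTop (𝓝 0) := by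
  have hloc := fun n => locallyIntegrable_of_weighted hκ hpos (hr n)
  have hmoll : ∀ j n, eLpNorm (fun x => r n x - moll j (r n) x) 2 volume ≤
      ENNReal.ofReal (1 / ((j : ℝ) + 1)) * (3 * ENNReal.ofReal M) := fun j n => by
    refine (eLpNorm_sub_moll_le_grad j (hd n).isWeakPartial).trans ?_
    gcongr
    calc ∑ k, eLpNorm (weakPartial k (r n)) 2 volume
        ≤ ∑ _k : Fin 3, ENNReal.ofReal M := Finset.sum_le_sum fun k _ =>
          (eLpNorm_le_gradNorm (hd n) k).trans (ENNReal.ofReal_le_ofReal (hMd n))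
      _ = 3 * ENNReal.ofReal M := by simp
  rw [ENNReal.tendsto_nhds_zero]
  intro ε hε
  -- The scale j is fixed first: the gradient bound makes the mollification error small uniformly in
  -- n. For this j the mollified sequence tends to zero on the support of the cutoff.
  obtain ⟨j, hj⟩ := (ENNReal.tendsto_nhds_zero.1 (tendsto_ofReal_div_mul (D := 1)
    (a := 3 * ENNReal.ofReal M) (by finiteness)) (ε / 2) (ENNReal.half_pos hε.ne')).exists
  filter_upwards [ENNReal.tendsto_nhds_zero.1 (tendsto_cutoff_moll hκ hpos hr hM hw j N) (ε / 2)
    (ENNReal.half_pos hε.ne')] with n hn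
  have hc := (contDiff_cutoff N).continuous.aestronglyMeasurable (μ := volume)
  have hmm := (contDiff_moll j (hloc n)).continuous.aestronglyMeasurable (μ := volume)
  have e : (fun x => cutoff N x • r n x) = (fun x => cutoff N x • (r n x - moll j (r n) x))
      + fun x => cutoff N x • moll j (r n) x := by
    ext1 x; simp [smul_sub]
  rw [e, ← ENNReal.add_halves ε]
  refine (eLpNorm_add_le (hc.smul ((hloc n).aestronglyMeasurable.sub hmm)) (hc.smul hmm)
    (by norm_num)).trans (add_le_add ?_ hn)
  exact (eLpNorm_cutoff_smul_le N 2 _).trans ((hmoll j n).trans hj)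

end Rellich

/-! ### Products of a fixed function with a locally vanishing sequence -/

section Products

variable {E E' : Type*} [NormedAddCommGroup E] [NormedSpace ℝ E] [NormedAddCommGroup E']
  [NormedSpace ℝ E'] {p q : ℝ≥0∞}

lemma exists_cutoff_bound {f : R3 → E} (hf : Continuous f) (hs : HasCompactSupport f) :
    ∃ (C : ℝ) (N : ℕ), 0 ≤ C ∧ ∀ x, ‖f x‖ ≤ C * cutoff N x := by
  obtain ⟨C, hC⟩ := hf.bounded_above_of_compact_support hs
  obtain ⟨R, hR⟩ := hs.isCompact.isBounded.subset_closedBall (0 : R3)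
  obtain ⟨N, hN⟩ := exists_nat_ge R
  have hC0 : 0 ≤ C := (norm_nonneg _).trans (hC 0)
  refine ⟨C, N, hC0, fun x => ?_⟩
  by_cases hx : f x = 0
  · rw [hx, norm_zero]; exact mul_nonneg hC0 (cutoff_nonneg _ _)
  · have hxR : ‖x‖ ≤ R := by simpa using hR (subset_tsupport _ hx)
    rw [cutoff_eq_one (by linarith), mul_one]
    exact hC x

/-- The product of a fixed function and a bounded sequence that vanishes locally in `L²`. -/
lemma tendsto_eLpNorm_mul [ENNReal.HolderTriple p q 2] (hp : p ≠ ⊤) {f : R3 → E}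
    {g : ℕ → R3 → E'} (hf : MemLp f p volume) (hg : ∀ n, AEStronglyMeasurable (g n) volume)
    {M : ℝ≥0∞} (hM : M ≠ ⊤) (hgM : ∀ n, eLpNorm (g n) q volume ≤ M)
    (hloc : ∀ N, Tendsto (fun n => eLpNorm (fun x => cutoff N x • g n x) 2 volume) atTop (𝓝 0)) :
    Tendsto (fun n => eLpNorm (fun x => ‖f x‖ * ‖g n x‖) 2 volume) atTop (𝓝 0) := by
  rw [ENNReal.tendsto_nhds_zero]
  intro ε hε
  obtain ⟨δ, hδ, hδM⟩ : ∃ δ : ℝ≥0∞, δ ≠ 0 ∧ δ * M ≤ ε / 2 := by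
    rcases eq_or_ne M 0 with h0 | h0
    · exact ⟨1, one_ne_zero, by simp [h0]⟩
    · exact ⟨ε / 2 / M, (ENNReal.div_pos (ENNReal.half_pos hε.ne').ne' hM).ne',
        (ENNReal.div_mul_cancel h0 hM).le⟩
  -- The fixed factor is approximated by a continuous function of compact support. The error is
  -- controlled by the uniform bound on gₙ, the main part by local convergence.
  obtain ⟨h, hs, hfh, hcont, hh⟩ := hf.exists_hasCompactSupport_eLpNorm_sub_le hp hδ
  obtain ⟨C, N, hC, hb⟩ := exists_cutoff_bound hcont hs
  have t := ENNReal.Tendsto.const_mul (hloc N) (a := ENNReal.ofReal C)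
    (Or.inr ENNReal.ofReal_ne_top)
  rw [mul_zero, ENNReal.tendsto_nhds_zero] at t
  filter_upwards [t (ε / 2) (ENNReal.half_pos hε.ne')] with n hn
  have m1 : AEStronglyMeasurable (fun x => ‖f x - h x‖ * ‖g n x‖) volume :=
    (hf.1.sub hh.1).norm.mul (hg n).norm
  have m2 : AEStronglyMeasurable (fun x => (C * cutoff N x) * ‖g n x‖) volume :=
    ((contDiff_cutoff N).continuous.aestronglyMeasurable.const_mul C).mul (hg n).norm
  calc eLpNorm (fun x => ‖f x‖ * ‖g n x‖) 2 volume
      ≤ eLpNorm ((fun x => ‖f x - h x‖ * ‖g n x‖) + fun x => (C * cutoff N x) * ‖g n x‖)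
          2 volume := by
        refine eLpNorm_mono_real fun x => ?_
        rw [Pi.add_apply, norm_mul, norm_norm, norm_norm, ← add_mul]
        gcongr
        have := norm_add_le (f x - h x) (h x)
        rw [sub_add_cancel] at this
        linarith [hb x]
    _ ≤ _ := eLpNorm_add_le m1 m2 (by norm_num)
    _ ≤ ε / 2 + ε / 2 := by
        refine add_le_add ?_ ?_
        · have hH := eLpNorm_smul_le_mul_eLpNorm (p := p) (q := q) (r := 2) (hg n).norm
            (hf.1.sub hh.1).norm
          rw [eLpNorm_norm, eLpNorm_norm] at hH
          refine (hH.trans ?_).trans hδM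
          exact mul_le_mul' hfh (hgM n)
        · refine le_trans (le_of_eq ?_) hn
          have e : ∀ x, ‖(C * cutoff N x) * ‖g n x‖‖ = ‖C • (cutoff N x • g n x)‖ := fun x => by
            rw [norm_smul, norm_smul, norm_mul, norm_mul, norm_norm, mul_assoc]
          rw [eLpNorm_congr_norm_ae (Eventually.of_forall e)]
          have := eLpNorm_const_smul C (fun x => cutoff N x • g n x) 2 (volume : Measure R3)
          rw [← ofReal_norm, Real.norm_of_nonneg hC] at this
          exact this
    _ = ε := ENNReal.add_halves ε

end Products

/-! ### Compactness of bounded sequences in H¹ and D¹ -/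

section Compactness

variable {F : Type*} [NormedAddCommGroup F] [InnerProductSpace ℝ F] [FiniteDimensional ℝ F]

/-- A positive weight in `L³`. -/
def weight (x : R3) : ℝ := (1 + ‖x‖ ^ 2)⁻¹

lemma weight_pos (x : R3) : 0 < weight x := by unfold weight; positivity

lemma continuous_weight : Continuous weight := by
  unfold weight
  have h : Continuous fun x : R3 => 1 + ‖x‖ ^ 2 := continuous_const.add (continuous_norm.pow 2)
  exact h.inv₀ fun x => by positivity

lemma memLp_weight : MemLp weight 3 volume := by
  refine (integrable_norm_rpow_iff continuous_weight.aestronglyMeasurable (by norm_num)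
    (by norm_num)).1 ?_
  -- The cube of the weight is (1 + |x|²)^(-6/2), integrable because 6 exceeds the dimension 3.
  have h := integrable_rpow_neg_one_add_norm_sq (E := R3) (μ := volume) (r := 6) (by simp; norm_num)
  refine h.congr (Eventually.of_forall fun x => ?_)
  beta_reduce
  have hp : (0 : ℝ) ≤ 1 + ‖x‖ ^ 2 := by positivity
  rw [Real.norm_of_nonneg (weight_pos x).le, weight, ← Real.rpow_neg_one,
    ← Real.rpow_mul hp]
  norm_num

lemma memLp_weight_smul {f : R3 → F} (hf : MemLp f 6 volume) :
    MemLp (fun x => weight x • f x) 2 volume :=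
  hf.smul (p := 3) (q := 6) (r := 2) memLp_weight

lemma norm_weight_smul_le {f : R3 → F} (hf : MemLp f 6 volume) :
    ‖toL2 fun x => weight x • f x‖ ≤ (eLpNorm weight 3 volume).toReal * normL6 f := by
  rw [norm_toL2 (memLp_weight_smul hf), normL6, ← ENNReal.toReal_mul]
  exact ENNReal.toReal_mono (ENNReal.mul_lt_top memLp_weight.2 hf.2).ne
    (eLpNorm_smul_le_mul_eLpNorm hf.1 memLp_weight.1)

lemma gradNorm_le_of_forall {f : R3 → F} {M : ℝ} (h : ∀ k, ‖gradL f k‖ ≤ M) :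
    gradNorm f ≤ 3 * M := by
  have hM : 0 ≤ M := (norm_nonneg _).trans (h 0)
  refine le_of_sq_le_sq_real ?_ (by positivity)
  rw [gradNorm_sq]
  calc ∑ k, ‖gradL f k‖ ^ 2 ≤ ∑ _k : Fin 3, M ^ 2 := by
        gcongr with k
        exact h k
    _ ≤ (3 * M) ^ 2 := by simp; nlinarith [sq_nonneg M]

lemma gradNorm_sub_le {f g : R3 → F} (hf : HasL2Derivatives f) (hg : HasL2Derivatives g) :
    gradNorm (f - g) ≤ 3 * (gradNorm f + gradNorm g) :=
  gradNorm_le_of_forall fun k => by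
    rw [gradL_sub hf hg]
    exact (norm_sub_le _ _).trans (add_le_add (norm_gradL_le _ _) (norm_gradL_le _ _))

lemma exists_local_limit {κ : R3 → ℝ} (hκ : Continuous κ) (hpos : ∀ x, 0 < κ x)
    {f : ℕ → R3 → F} {M : ℝ}
    (hf : ∀ n, MemLp (fun x => κ x • f n x) 2 volume) (hd : ∀ n, HasL2Derivatives (f n))
    (hM : ∀ n, ‖toL2 fun x => κ x • f n x‖ ≤ M) (hMd : ∀ n, gradNorm (f n) ≤ M) :
    ∃ f₀ : R3 → F, ∃ φ : ℕ → ℕ, StrictMono φ ∧ MemLp (fun x => κ x • f₀ x) 2 volume ∧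
      HasL2Derivatives f₀ ∧
      WeakTo (fun n => toL2 fun x => κ x • f (φ n) x) (toL2 fun x => κ x • f₀ x) ∧
      (∀ k, WeakTo (fun n => gradL (f (φ n)) k) (gradL f₀ k)) ∧
      ∀ N, Tendsto (fun n => eLpNorm (fun x => cutoff N x • (f (φ n) - f₀) x) 2 volume)
        atTop (𝓝 0) := by
  obtain ⟨f₀, φ, hφ, hf₀, hd₀, hw, hwd⟩ := exists_weak_limit hκ hpos hf hd hM hMd
  refine ⟨f₀, φ, hφ, hf₀, hd₀, hw, hwd, fun N => ?_⟩
  have e : ∀ n, (fun x => κ x • (f (φ n) - f₀) x)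
      = fun x => κ x • f (φ n) x - κ x • f₀ x := fun n => by
    ext1 x; simp [smul_sub]
  have hm : ∀ n, MemLp (fun x => κ x • (f (φ n) - f₀) x) 2 volume := fun n => by
    rw [e]; exact (hf _).sub hf₀
  have et : ∀ n, (toL2 fun x => κ x • (f (φ n) - f₀) x)
      = (toL2 fun x => κ x • f (φ n) x) - toL2 fun x => κ x • f₀ x := fun n => by
    rw [e, toL2_sub (hf _) hf₀]
  set M' := (M + ‖toL2 fun x => κ x • f₀ x‖) + 3 * (M + gradNorm f₀) with hM'
  have hM0 : 0 ≤ M := (norm_nonneg _).trans (hM 0)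
  have hg0 := gradNorm_nonneg f₀
  refine tendsto_cutoff_of_weakTo hκ hpos (M := M') hm (fun n => (hd _).sub hd₀) (fun n => ?_)
    (fun n => ?_) ?_ N
  · rw [et]
    have := norm_sub_le (toL2 fun x => κ x • f (φ n) x) (toL2 fun x => κ x • f₀ x)
    have := hM (φ n)
    rw [hM']
    linarith
  · have h1 := gradNorm_sub_le (hd (φ n)) hd₀
    have := hMd (φ n)
    have := norm_nonneg (toL2 fun x => κ x • f₀ x)
    rw [hM']
    linarith
  · simp only [et]
    exact hw.sub_const

lemma MemH1.exists_local_limit {ψ : ℕ → R3 → F} {M : ℝ} (h : ∀ n, MemH1 (ψ n))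
    (hM : ∀ n, ‖toL2 (ψ n)‖ ≤ M) (hMd : ∀ n, gradNorm (ψ n) ≤ M) :
    ∃ ψ₀ : R3 → F, ∃ φ : ℕ → ℕ, StrictMono φ ∧ MemH1 ψ₀ ∧
      WeakTo (fun n => toL2 (ψ (φ n))) (toL2 ψ₀) ∧
      (∀ k, WeakTo (fun n => gradL (ψ (φ n)) k) (gradL ψ₀ k)) ∧
      ∀ N, Tendsto (fun n => eLpNorm (fun x => cutoff N x • (ψ (φ n) - ψ₀) x) 2 volume)
        atTop (𝓝 0) := by
  obtain ⟨ψ₀, φ, hφ, h1, h2, h3, h4⟩ := MaxwellPauli.exists_local_limit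
    (κ := fun _ => 1) (f := ψ) (M := M) continuous_const (fun _ => one_pos)
    (fun n => by simpa only [one_smul] using (h n).1) (fun n => (h n).2)
    (fun n => by simpa only [one_smul] using hM n) hMd
  simp only [one_smul] at h1 h3
  exact ⟨ψ₀, φ, hφ, ⟨h1, h2⟩, h3, h4⟩

/-- On each cutoff a subsequence converges almost everywhere, so Fatou's lemma preserves the bound;
letting the cutoffs grow removes them. -/
lemma eLpNorm_le_of_local_limit {f : ℕ → R3 → F} {f₀ : R3 → F} {p M : ℝ≥0∞}
    (hf : ∀ n, AEStronglyMeasurable (f n) volume) (hf₀ : AEStronglyMeasurable f₀ volume)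
    (hM : ∀ n, eLpNorm (f n) p volume ≤ M)
    (h : ∀ N, Tendsto (fun n => eLpNorm (fun x => cutoff N x • (f n - f₀) x) 2 volume)
      atTop (𝓝 0)) : eLpNorm f₀ p volume ≤ M := by
  have hc : ∀ N, AEStronglyMeasurable (cutoff N) volume := fun N =>
    (contDiff_cutoff N).continuous.aestronglyMeasurable
  have key : ∀ N, eLpNorm (fun x => cutoff N x • f₀ x) p volume ≤ M := by
    intro N
    have hm : TendstoInMeasure volume (fun n x => cutoff N x • f n x) atTop
        (fun x => cutoff N x • f₀ x) := by
      refine tendstoInMeasure_of_tendsto_eLpNorm (p := 2) (by norm_num)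
        (fun n => (hc N).smul (hf n)) ((hc N).smul hf₀) ?_
      refine (h N).congr fun n => ?_
      congr 1; ext1 x; simp [smul_sub]
    obtain ⟨ns, -, hlim⟩ := hm.exists_seq_tendsto_ae
    exact eLpNorm_le_of_tendsto_ae (b := fun _ => M) (fun n => (hc N).smul (hf (ns n))) hlim
      (fun n => (eLpNorm_cutoff_smul_le N p _).trans (hM _)) tendsto_const_nhds
  refine eLpNorm_le_of_tendsto_ae (b := fun _ => M) (fun N => (hc N).smul hf₀)
    (Eventually.of_forall fun x => ?_) key tendsto_const_nhds
  refine tendsto_const_nhds.congr' ?_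
  filter_upwards [eventually_cutoff_eq_one x] with N hN
  rw [Pi.smul_apply', hN, one_smul]

/-- An L³ weight turns the L⁶ bound of Sobolev into a weighted L² bound. The limit inherits the L⁶
bound, and for this reason it vanishes at infinity. -/
lemma MemD1.exists_local_limit {A : ℕ → R3 → F} {M : ℝ} (h : ∀ n, MemD1 (A n))
    (hMd : ∀ n, gradNorm (A n) ≤ M) :
    ∃ A₀ : R3 → F, ∃ φ : ℕ → ℕ, StrictMono φ ∧ MemD1 A₀ ∧
      (∀ k, WeakTo (fun n => gradL (A (φ n)) k) (gradL A₀ k)) ∧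
      ∀ N, Tendsto (fun n => eLpNorm (fun x => cutoff N x • (A (φ n) - A₀) x) 2 volume)
        atTop (𝓝 0) := by
  have h6 : ∀ n, normL6 (A n) ≤ sobolevConst * M := fun n =>
    (h n).normL6_le_gradNorm.trans (mul_le_mul_of_nonneg_left (hMd n) sobolevConst_nonneg)
  have hM0 : 0 ≤ M := (gradNorm_nonneg _).trans (hMd 0)
  have hs := sobolevConst_nonneg
  set W := (eLpNorm weight 3 volume).toReal with hW
  have hW0 : 0 ≤ W := ENNReal.toReal_nonneg
  obtain ⟨A₀, φ, hφ, h1, h2, -, h4, h5⟩ := MaxwellPauli.exists_local_limit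
    (κ := weight) (f := A) (M := W * (sobolevConst * M) + M) continuous_weight weight_pos
    (fun n => memLp_weight_smul (h n).memLp_six) (fun n => (h n).2.1)
    (fun n => (norm_weight_smul_le (h n).memLp_six).trans (by
      have := mul_le_mul_of_nonneg_left (h6 n) hW0
      linarith)) (fun n => (hMd n).trans (by linarith [mul_nonneg hW0 (mul_nonneg hs hM0)]))
  have hloc := locallyIntegrable_of_weighted continuous_weight weight_pos h1
  have hm : MemLp A₀ 6 volume := ⟨hloc.aestronglyMeasurable, lt_of_le_of_lt
    (eLpNorm_le_of_local_limit (fun n => (h (φ n)).memLp_six.1) hloc.aestronglyMeasurable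
      (M := ENNReal.ofReal (sobolevConst * M)) (fun n => by
        rw [← ENNReal.ofReal_toReal (h (φ n)).memLp_six.2.ne]
        exact ENNReal.ofReal_le_ofReal (h6 _)) h5) ENNReal.ofReal_lt_top⟩
  exact ⟨A₀, φ, hφ, ⟨hloc, h2, fun t ht => measure_level_lt_top (by norm_num) (by norm_num) hm ht⟩,
    h4, h5⟩

end Compactness

/-! ### Asymptotic orthogonality -/

section HilbertSplitting

variable {H : Type*} [NormedAddCommGroup H] [InnerProductSpace ℝ H]

lemma WeakTo.exists_bound [CompleteSpace H] {x : ℕ → H} {x₀ : H} (h : WeakTo x x₀) :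
    ∃ C, ∀ n, ‖x n‖ ≤ C := by
  obtain ⟨C, hC⟩ := banach_steinhaus (g := fun n => InnerProductSpace.toDual ℝ H (x n))
    fun y => by
      obtain ⟨C, hC⟩ := (Metric.isBounded_range_of_tendsto _ (h y)).exists_norm_le
      refine ⟨C, fun n => ?_⟩
      rw [InnerProductSpace.toDual_apply_apply, real_inner_comm]
      exact hC _ ⟨n, rfl⟩
  exact ⟨C, fun n => by simpa using hC n⟩

lemma weakTo_zero_of_dense {x : ℕ → H} {C : ℝ} (hC : ∀ n, ‖x n‖ ≤ C)
    (h : ∀ y : H, ∀ ε > 0, ∃ z, ‖y - z‖ ≤ ε ∧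
      Tendsto (fun n => inner ℝ z (x n)) atTop (𝓝 0)) : WeakTo x 0 := by
  intro y
  rw [inner_zero_right, Metric.tendsto_atTop]
  intro ε hε
  have hC0 : 0 ≤ C := (norm_nonneg _).trans (hC 0)
  obtain ⟨z, hz, ht⟩ := h y (ε / 2 / (C + 1)) (by positivity)
  obtain ⟨N, hN⟩ := Metric.tendsto_atTop.1 ht (ε / 2) (by positivity)
  refine ⟨N, fun n hn => ?_⟩
  have h1 := hN n hn
  rw [dist_zero_right] at h1 ⊢
  have h2 : ‖inner ℝ (y - z) (x n)‖ ≤ ε / 2 := by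
    refine (norm_inner_le_norm _ _).trans ?_
    calc ‖y - z‖ * ‖x n‖ ≤ ε / 2 / (C + 1) * (C + 1) := by
          gcongr
          exact (hC n).trans (by linarith)
      _ = ε / 2 := by field_simp
  have e : inner ℝ y (x n) = inner ℝ (y - z) (x n) + inner ℝ z (x n) := by
    rw [inner_sub_left, sub_add_cancel]
  rw [e]
  linarith [norm_add_le (inner ℝ (y - z) (x n)) (inner ℝ z (x n))]

/-- Asymptotic orthogonality of a fixed vector and a weakly null sequence. -/
lemma tendsto_norm_sq_split [CompleteSpace H] (w : H) {x e : ℕ → H} (hx : WeakTo x 0)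
    (he : Tendsto e atTop (𝓝 0)) :
    Tendsto (fun n => ‖w + x n + e n‖ ^ 2 - ‖w‖ ^ 2 - ‖x n‖ ^ 2) atTop (𝓝 0) := by
  obtain ⟨C, hC⟩ := hx.exists_bound
  have h1 : Tendsto (fun n => inner ℝ w (x n)) atTop (𝓝 0) := by simpa using hx w
  have h2 : Tendsto (fun n => inner ℝ (w + x n) (e n)) atTop (𝓝 0) := by
    refine squeeze_zero_norm (a := fun n => (‖w‖ + C) * ‖e n‖) (fun n => ?_)
      (by simpa using he.norm.const_mul (‖w‖ + C))
    refine (norm_inner_le_norm _ _).trans ?_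
    gcongr
    exact (norm_add_le _ _).trans (by linarith [hC n])
  have h3 : Tendsto (fun n => ‖e n‖ ^ 2) atTop (𝓝 0) := by simpa using he.norm.pow 2
  have h4 := ((h1.const_mul 2).add (h2.const_mul 2)).add h3
  simp only [mul_zero, add_zero] at h4
  refine h4.congr fun n => ?_
  rw [norm_add_sq_real, norm_add_sq_real]
  ring

lemma tendsto_norm_sq_split' [CompleteSpace H] (w : H) {x : ℕ → H} (hx : WeakTo x 0) :
    Tendsto (fun n => ‖w + x n‖ ^ 2 - ‖w‖ ^ 2 - ‖x n‖ ^ 2) atTop (𝓝 0) := by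
  simpa using tendsto_norm_sq_split w hx (e := fun _ => 0) tendsto_const_nhds

end HilbertSplitting

/-! ### Limits of the products Aψ -/

section ProductLimits

lemma MemLp.memLp_three {E : Type*} [NormedAddCommGroup E] {f : R3 → E} (h2 : MemLp f 2 volume)
    (h6 : MemLp f 6 volume) : MemLp f 3 volume := by
  refine ⟨h2.1, ?_⟩
  have h := (eLpNorm_three_pow_six_le h2.1).trans
    (mul_le_mul_right (lintegral_pow_four_le h2.1) _)
  have h' : eLpNorm f 3 volume ^ 6 < ⊤ := h.trans_lt (ENNReal.mul_lt_top
    (ENNReal.pow_lt_top h2.2) (ENNReal.mul_lt_top h2.2 (ENNReal.pow_lt_top h6.2)))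
  exact (ENNReal.pow_lt_top_iff.1 h').resolve_right (by norm_num)

lemma eLpNorm_three_le {E : Type*} [NormedAddCommGroup E] {f : R3 → E}
    (hf : AEStronglyMeasurable f volume) {M : ℝ≥0∞} (h2 : eLpNorm f 2 volume ≤ M)
    (h6 : eLpNorm f 6 volume ≤ M) : eLpNorm f 3 volume ≤ M := by
  have h := (eLpNorm_three_pow_six_le hf).trans (mul_le_mul_right (lintegral_pow_four_le hf) _)
  have h' : eLpNorm f 3 volume ^ 6 ≤ M ^ 6 := by
    refine h.trans ?_
    calc _ ≤ M ^ 2 * (M * M ^ 3) := by gcongr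
      _ = M ^ 6 := by ring
  exact (ENNReal.pow_le_pow_left_iff (by norm_num)).1 h'

lemma tendsto_mixNorm_left {B : ℕ → R3 → R3} {ψ : R3 → C2} {M : ℝ}
    (hB : ∀ n, MemD1 (B n)) (h2 : MemLp ψ 2 volume) (h6 : MemLp ψ 6 volume)
    (hM : ∀ n, normL6 (B n) ≤ M)
    (hloc : ∀ N, Tendsto (fun n => eLpNorm (fun x => cutoff N x • B n x) 2 volume)
      atTop (𝓝 0)) : Tendsto (fun n => mixNorm (B n) ψ) atTop (𝓝 0) := by
  have h := tendsto_eLpNorm_mul (p := 3) (q := 6) (by norm_num) (MemLp.memLp_three h2 h6)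
    (fun n => (hB n).memLp_six.1) (M := ENNReal.ofReal M) ENNReal.ofReal_ne_top (fun n => by
      rw [← ENNReal.ofReal_toReal (hB n).memLp_six.2.ne]
      exact ENNReal.ofReal_le_ofReal (hM n)) hloc
  have h' := (ENNReal.tendsto_toReal ENNReal.zero_ne_top).comp h
  refine h'.congr fun n => ?_
  rw [mixNorm, norm_toL2 (memLp_norm_mul_norm (hB n).memLp_six h2 h6)]
  simp only [Function.comp_apply, mul_comm]

lemma tendsto_mixNorm_right {A : R3 → R3} {ρ : ℕ → R3 → C2} {M : ℝ}
    (hA : MemD1 A) (hρ : ∀ n, MemH1 (ρ n)) (hM2 : ∀ n, ‖toL2 (ρ n)‖ ≤ M)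
    (hM6 : ∀ n, normL6 (ρ n) ≤ M)
    (hloc : ∀ N, Tendsto (fun n => eLpNorm (fun x => cutoff N x • ρ n x) 2 volume)
      atTop (𝓝 0)) : Tendsto (fun n => mixNorm A (ρ n)) atTop (𝓝 0) := by
  have h := tendsto_eLpNorm_mul (p := 6) (q := 3) (by norm_num) hA.memLp_six
    (fun n => (hρ n).1.1) (M := ENNReal.ofReal M) ENNReal.ofReal_ne_top (fun n => by
      refine eLpNorm_three_le (hρ n).1.1 ?_ ?_
      · rw [← ofReal_norm_toL2 (hρ n).1]
        exact ENNReal.ofReal_le_ofReal (hM2 n)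
      · rw [← ENNReal.ofReal_toReal (hρ n).memLp_six.2.ne]
        exact ENNReal.ofReal_le_ofReal (hM6 n)) hloc
  have h' := (ENNReal.tendsto_toReal ENNReal.zero_ne_top).comp h
  refine h'.congr fun n => ?_
  rw [mixNorm, norm_toL2 (memLp_norm_mul_norm hA.memLp_six (hρ n).1 (hρ n).memLp_six)]
  rfl

lemma inner_prodL {A : R3 → R3} {ψ φ : R3 → C2} (hA : MemLp A 6 volume) (h2 : MemLp ψ 2 volume)
    (h6 : MemLp ψ 6 volume) (h2' : MemLp φ 2 volume) (h6' : MemLp φ 6 volume) (k : Fin 3) :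
    inner ℝ (toL2 φ) (prodL A ψ k) = inner ℝ (prodL A φ k) (toL2 ψ) := by
  rw [prodL, prodL, inner_toL2 h2' (memLp_coord_smul hA h2 h6 k),
    inner_toL2 (memLp_coord_smul hA h2' h6' k) h2]
  simp only [real_inner_smul_left, real_inner_smul_right]

/-- The products are bounded in L², so test functions h of compact support suffice. For these (h,
Bₙρₙ) = (Bₙh, ρₙ), and Bₙh tends to zero strongly. -/
lemma weakTo_prodL {B : ℕ → R3 → R3} {ρ : ℕ → R3 → C2} {M : ℝ}
    (hB : ∀ n, MemD1 (B n)) (hρ : ∀ n, MemH1 (ρ n)) (hM : ∀ n, normL6 (B n) ≤ M)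
    (hM2 : ∀ n, ‖toL2 (ρ n)‖ ≤ M) (hM6 : ∀ n, normL6 (ρ n) ≤ M)
    (hloc : ∀ N, Tendsto (fun n => eLpNorm (fun x => cutoff N x • B n x) 2 volume)
      atTop (𝓝 0)) (k : Fin 3) : WeakTo (fun n => prodL (B n) (ρ n) k) 0 := by
  have hM0 : 0 ≤ M := (norm_nonneg _).trans (hM2 0)
  refine weakTo_zero_of_dense (C := M ^ 2) (fun n => ?_) fun y ε hε => ?_
  · refine (norm_prodL_le (hB n).memLp_six (hρ n).1 (hρ n).memLp_six k).trans ?_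
    refine le_of_sq_le_sq_real ?_ (by positivity)
    refine (mixNorm_sq_le (hB n).memLp_six (hρ n).1 (hρ n).memLp_six).trans ?_
    calc _ ≤ M ^ 2 * (M * M) := by
          have := normL6_nonneg (B n)
          have := normL6_nonneg (ρ n)
          gcongr
          · exact hM n
          · exact hM2 n
          · exact hM6 n
      _ = (M ^ 2) ^ 2 := by ring
  · obtain ⟨h, hs, hyh, hc, hm⟩ := (Lp.memLp y).exists_hasCompactSupport_eLpNorm_sub_le
      (by norm_num) (ENNReal.ofReal_pos.2 hε).ne'
    have h6 : MemLp h 6 volume := hc.memLp_of_hasCompactSupport hs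
    refine ⟨toL2 h, ?_, ?_⟩
    · have := norm_toL2_sub_le (Lp.memLp y) hm hε.le hyh
      rwa [toL2_coeFn, norm_sub_rev] at this
    · have t := tendsto_mixNorm_left hB hm h6 hM hloc
      refine squeeze_zero_norm (a := fun n => mixNorm (B n) h * M) (fun n => ?_)
        (by simpa using t.mul_const M)
      rw [inner_prodL (hB n).memLp_six (hρ n).1 (hρ n).memLp_six hm h6]
      refine (norm_inner_le_norm _ _).trans ?_
      exact mul_le_mul (norm_prodL_le (hB n).memLp_six hm h6 k) (hM2 n) (norm_nonneg _)
        (mixNorm_nonneg _ _)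

end ProductLimits

/-! ### Asymptotic splitting of the energy -/

section EnergySplitting

lemma WeakTo.sigmaDot {w : ℕ → Fin 3 → HC} (h : ∀ k, WeakTo (fun n => w n k) 0) :
    WeakTo (fun n => sigmaDot (w n)) 0 := by
  have := WeakTo.sum Finset.univ fun k _ => (h k).map (pointwiseOp (pauliR k))
  simpa [MaxwellPauli.sigmaDot] using this

lemma WeakTo.real_smul {H : Type*} [NormedAddCommGroup H] [InnerProductSpace ℝ H] {x : ℕ → H}
    (h : WeakTo x 0) (a : ℝ) : WeakTo (fun n => a • x n) 0 := fun y => by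
  simpa [real_inner_smul_right] using (h y).const_mul a

lemma WeakTo.I_mul_smul {x : ℕ → HC} (h : WeakTo x 0) (hbar : ℝ) :
    WeakTo (fun n => (Complex.I * (hbar : ℂ)) • x n) 0 := by
  have h' := h.map (pointwiseOp imulR)
  rw [map_zero] at h'
  have := h'.real_smul hbar
  simpa only [I_mul_smul_HC] using this

lemma tendsto_kinL_split (j : Model) (w : Fin 3 → HC) {x e : ℕ → Fin 3 → HC}
    (hx : ∀ k, WeakTo (fun n => x n k) 0) (he : ∀ k, Tendsto (fun n => e n k) atTop (𝓝 0)) :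
    Tendsto (fun n => kinL j (fun k => w k + x n k + e n k) - kinL j w - kinL j (x n))
      atTop (𝓝 0) := by
  cases j
  · have := tendsto_finsetSum Finset.univ fun k _ => tendsto_norm_sq_split (w k) (hx k) (he k)
    simpa only [kinL, Finset.sum_sub_distrib, Finset.sum_const_zero] using this
  · have hs : Tendsto (fun n => sigmaDot (e n)) atTop (𝓝 0) := by
      have := tendsto_finsetSum Finset.univ fun k _ =>
        ((pointwiseOp (pauliR k)).continuous.tendsto 0).comp (he k)
      simpa [sigmaDot, Function.comp_def] using this
    have := tendsto_norm_sq_split (sigmaDot w) (WeakTo.sigmaDot hx) hs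
    simpa only [kinL, sigmaDot_add] using this

lemma tendsto_fieldL_split (c : ℝ) (v : R3) (g : Fin 3 → HR) {x : ℕ → Fin 3 → HR}
    (hx : ∀ k, WeakTo (fun n => x n k) 0) :
    Tendsto (fun n => fieldL c v (fun k => g k + x n k) - fieldL c v g - fieldL c v (x n))
      atTop (𝓝 0) := by
  have h1 := tendsto_finsetSum Finset.univ fun k _ => tendsto_norm_sq_split' (g k) (hx k)
  have hw : WeakTo (fun n => ∑ k, (v k / c) • x n k) 0 := by
    simpa using WeakTo.sum Finset.univ fun k _ => (hx k).real_smul (v k / c)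
  have h2 := tendsto_norm_sq_split' (∑ k, (v k / c) • g k) hw
  have h3 := (h1.sub h2).const_mul (1 / (8 * Real.pi))
  simp only [Finset.sum_const_zero, sub_zero, mul_zero, Finset.sum_sub_distrib] at h3
  refine h3.congr fun n => ?_
  simp only [fieldL, smul_add, Finset.sum_add_distrib]
  ring

lemma tendsto_momL_split (hbar : ℝ) (v : R3) (u : HC) (d : Fin 3 → HC) {x : ℕ → HC}
    {y : ℕ → Fin 3 → HC} (hx : WeakTo x 0) (hy : ∀ k, WeakTo (fun n => y n k) 0) :
    Tendsto (fun n => momL hbar v (u + x n) (fun k => d k + y n k) - momL hbar v u d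
      - momL hbar v (x n) (y n)) atTop (𝓝 0) := by
  have hw : WeakTo (fun n => ∑ k, v k • (Complex.I * (hbar : ℂ)) • y n k) 0 := by
    simpa using WeakTo.sum Finset.univ fun k _ => ((hy k).I_mul_smul hbar).real_smul (v k)
  have h1 := (hw u).add (hx (∑ k, v k • (Complex.I * (hbar : ℂ)) • d k))
  simp only [inner_zero_right, add_zero] at h1
  refine h1.congr fun n => ?_
  simp only [momL, smul_add, Finset.sum_add_distrib, inner_add_left, inner_add_right]
  rw [real_inner_comm (x n)]
  ring

lemma weakTo_gradL_sub {F : Type*} [NormedAddCommGroup F] [InnerProductSpace ℝ F]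
    [FiniteDimensional ℝ F] {f : ℕ → R3 → F} {f₀ : R3 → F} (hf : ∀ n, HasL2Derivatives (f n))
    (hf₀ : HasL2Derivatives f₀) {k : Fin 3} (h : WeakTo (fun n => gradL (f n) k) (gradL f₀ k)) :
    WeakTo (fun n => gradL (f n - f₀) k) 0 := by
  simp only [gradL_sub (hf _) hf₀]
  exact h.sub_const

lemma toL2_sub' {F : Type*} [NormedAddCommGroup F] {f g : R3 → F} (hf : MemLp f 2 volume)
    (hg : MemLp g 2 volume) : toL2 (f - g) = toL2 f - toL2 g := toL2_sub hf hg

/-- With ρ = ψ - ψ₀ and B = A - A₀ the product Aψ is A₀ψ₀ + Bρ + (A₀ρ + Bψ₀). Along the sequence Bρ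
is only weakly null and belongs to the energy of the remainder, whereas the bracket is strongly
null. -/
lemma covL_split {hbar c Q : ℝ} {A A₀ : R3 → R3} {ψ ψ₀ : R3 → C2} (hA : MemD1 A)
    (hA₀ : MemD1 A₀) (hψ : MemH1 ψ) (hψ₀ : MemH1 ψ₀) :
    covL hbar c Q (gradL ψ) (prodL A ψ) = fun k =>
      covL hbar c Q (gradL ψ₀) (prodL A₀ ψ₀) k
        + covL hbar c Q (gradL (ψ - ψ₀)) (prodL (A - A₀) (ψ - ψ₀)) k
        + (Q / c) • (prodL A₀ (ψ - ψ₀) k + prodL (A - A₀) ψ₀ k) := by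
  ext1 k
  simp only [covL, gradL_sub hψ.2 hψ₀.2, prodL_sub_left hA hA₀ (hψ.sub hψ₀),
    prodL_sub_left hA hA₀ hψ₀, prodL_sub_right hA hψ hψ₀, prodL_sub_right hA₀ hψ hψ₀]
  module

/-- Along weakly convergent sequences the energy splits asymptotically. -/
lemma tendsto_energy_split (m hbar c Q : ℝ) (j : Model) (v : R3) {A : ℕ → R3 → R3} {A₀ : R3 → R3}
    {ψ : ℕ → R3 → C2} {ψ₀ : R3 → C2} {M : ℝ} (hA : ∀ n, MemD1 (A n)) (hA₀ : MemD1 A₀)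
    (hψ : ∀ n, MemH1 (ψ n)) (hψ₀ : MemH1 ψ₀) (hM : ∀ n, ‖toL2 (ψ n)‖ ≤ M)
    (hMψ : ∀ n, gradNorm (ψ n) ≤ M) (hMA : ∀ n, gradNorm (A n) ≤ M)
    (hw : WeakTo (fun n => toL2 (ψ n)) (toL2 ψ₀))
    (hwψ : ∀ k, WeakTo (fun n => gradL (ψ n) k) (gradL ψ₀ k))
    (hwA : ∀ k, WeakTo (fun n => gradL (A n) k) (gradL A₀ k))
    (hlψ : ∀ N, Tendsto (fun n => eLpNorm (fun x => cutoff N x • (ψ n - ψ₀) x) 2 volume)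
      atTop (𝓝 0))
    (hlA : ∀ N, Tendsto (fun n => eLpNorm (fun x => cutoff N x • (A n - A₀) x) 2 volume)
      atTop (𝓝 0)) :
    Tendsto (fun n => energy m hbar c Q j v (ψ n, A n) - energy m hbar c Q j v (ψ₀, A₀)
      - energy m hbar c Q j v (ψ n - ψ₀, A n - A₀)) atTop (𝓝 0) := by
  have hρ : ∀ n, MemH1 (ψ n - ψ₀) := fun n => (hψ n).sub hψ₀
  have hB : ∀ n, MemD1 (A n - A₀) := fun n => (hA n).sub hA₀
  have hK := sobolevConst_nonneg
  have hM0 : 0 ≤ M := (norm_nonneg _).trans (hM 0)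
  have g1 := gradNorm_nonneg ψ₀
  have g2 := gradNorm_nonneg A₀
  obtain ⟨L, hL1, hL2, hL3⟩ : ∃ L : ℝ, M + ‖toL2 ψ₀‖ ≤ L ∧
      sobolevConst * (3 * (M + gradNorm ψ₀)) ≤ L ∧ sobolevConst * (3 * (M + gradNorm A₀)) ≤ L :=
    ⟨max (M + ‖toL2 ψ₀‖) (max (sobolevConst * (3 * (M + gradNorm ψ₀)))
      (sobolevConst * (3 * (M + gradNorm A₀)))), le_max_left _ _,
      (le_max_left _ _).trans (le_max_right _ _), (le_max_right _ _).trans (le_max_right _ _)⟩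
  have b2 : ∀ n, ‖toL2 (ψ n - ψ₀)‖ ≤ L := fun n => by
    rw [toL2_sub' (hψ n).1 hψ₀.1]
    exact (norm_sub_le _ _).trans (by linarith [hM n])
  have b6 : ∀ n, normL6 (ψ n - ψ₀) ≤ L := fun n => by
    refine ((hρ n).memD1.normL6_le_gradNorm.trans ?_).trans hL2
    gcongr
    exact (gradNorm_sub_le (hψ n).2 hψ₀.2).trans (by linarith [hMψ n])
  have a6 : ∀ n, normL6 (A n - A₀) ≤ L := fun n => by
    refine ((hB n).normL6_le_gradNorm.trans ?_).trans hL3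
    gcongr
    exact (gradNorm_sub_le (hA n).2.1 hA₀.2.1).trans (by linarith [hMA n])
  have wρ : WeakTo (fun n => toL2 (ψ n - ψ₀)) 0 := by
    simp only [toL2_sub' (hψ _).1 hψ₀.1]
    exact hw.sub_const
  have wgρ := fun k => weakTo_gradL_sub (fun n => (hψ n).2) hψ₀.2 (hwψ k)
  have wgB := fun k => weakTo_gradL_sub (fun n => (hA n).2.1) hA₀.2.1 (hwA k)
  have wp := fun k => weakTo_prodL hB hρ a6 b2 b6 hlA k
  have wc : ∀ k, WeakTo (fun n => covL hbar c Q (gradL (ψ n - ψ₀))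
      (prodL (A n - A₀) (ψ n - ψ₀)) k) 0 := fun k => by
    have := ((wgρ k).I_mul_smul hbar).add ((wp k).real_smul (Q / c))
    rwa [add_zero] at this
  have t1 := tendsto_mixNorm_right hA₀ hρ b2 b6 hlψ
  have t2 := tendsto_mixNorm_left hB hψ₀.1 hψ₀.memLp_six a6 hlA
  have p1 : ∀ k, Tendsto (fun n => prodL A₀ (ψ n - ψ₀) k) atTop (𝓝 0) := fun k =>
    squeeze_zero_norm (fun n => norm_prodL_le hA₀.memLp_six (hρ n).1 (hρ n).memLp_six k) t1
  have p2 : ∀ k, Tendsto (fun n => prodL (A n - A₀) ψ₀ k) atTop (𝓝 0) := fun k =>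
    squeeze_zero_norm (fun n => norm_prodL_le (hB n).memLp_six hψ₀.1 hψ₀.memLp_six k) t2
  have he : ∀ k, Tendsto (fun n => (Q / c) • (prodL A₀ (ψ n - ψ₀) k + prodL (A n - A₀) ψ₀ k))
      atTop (𝓝 0) := fun k => by
    simpa using ((p1 k).add (p2 k)).const_smul (Q / c)
  have s1 := tendsto_kinL_split j (covL hbar c Q (gradL ψ₀) (prodL A₀ ψ₀)) wc he
  have s2 := tendsto_fieldL_split c v (gradL A₀) wgB
  have s3 := tendsto_momL_split hbar v (toL2 ψ₀) (gradL ψ₀) wρ wgρ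
  have s := ((s1.const_mul (1 / (2 * m))).add s2).add s3
  simp only [mul_zero, add_zero] at s
  refine s.congr fun n => ?_
  rw [energy_eq m hbar c Q j v (hψ n) (hA n), energy_eq m hbar c Q j v hψ₀ hA₀,
    energy_eq m hbar c Q j v (hρ n) (hB n), covL_split (hA n) hA₀ (hψ n) hψ₀]
  have e1 : (fun k => gradL A₀ k + gradL (A n - A₀) k) = gradL (A n) := by
    ext1 k; rw [gradL_sub (hA n).2.1 hA₀.2.1]; abel
  have e2 : (fun k => gradL ψ₀ k + gradL (ψ n - ψ₀) k) = gradL (ψ n) := by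
    ext1 k; rw [gradL_sub (hψ n).2 hψ₀.2]; abel
  have e3 : toL2 ψ₀ + toL2 (ψ n - ψ₀) = toL2 (ψ n) := by
    rw [toL2_sub' (hψ n).1 hψ₀.1]; abel
  rw [e1, e2, e3]
  ring

end EnergySplitting

/-! ### Translation invariance -/

section Translation

variable {F : Type*} [NormedAddCommGroup F] [NormedSpace ℝ F] [CompleteSpace F]

/-- Translation of a function. -/
def shift (y : R3) (f : R3 → F) (x : R3) : F := f (x + y)

lemma quasiMeasurePreserving_add (y : R3) :
    Measure.QuasiMeasurePreserving (fun x : R3 => x + y) volume volume :=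
  (measurePreserving_add_right volume y).quasiMeasurePreserving

lemma memLp_shift {p : ℝ≥0∞} {f : R3 → F} (hf : MemLp f p volume) (y : R3) :
    MemLp (shift y f) p volume :=
  hf.comp_measurePreserving (measurePreserving_add_right volume y)

lemma HasL2Derivatives.shift {f : R3 → F} (hf : HasL2Derivatives f) (y : R3) :
    HasL2Derivatives (shift y f) := fun k =>
  ⟨_, (hf.isWeakPartial k).translate y, memLp_shift (hf.memLp k) y⟩

lemma weakPartial_shift {f : R3 → F} (hf : HasL2Derivatives f) (y : R3) (k : Fin 3) :
    weakPartial k (shift y f) =ᵐ[volume] shift y (weakPartial k f) :=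
  ((hf.isWeakPartial k).translate y).weakPartial_ae_eq

lemma integral_shift (f : R3 → F) (y : R3) : ∫ x, shift y f x = ∫ x, f x :=
  integral_add_right_eq_self f y

lemma normSqL2_shift (f : R3 → F) (y : R3) : normSqL2 (shift y f) = normSqL2 f :=
  integral_add_right_eq_self (fun x => ‖f x‖ ^ 2) y

lemma normSqL2_congr {f g : R3 → F} (h : f =ᵐ[volume] g) : normSqL2 f = normSqL2 g := by
  refine integral_congr_ae ?_
  filter_upwards [h] with x hx
  rw [hx]

lemma MemH1.shift {f : R3 → F} (hf : MemH1 f) (y : R3) : MemH1 (shift y f) :=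
  ⟨memLp_shift hf.1 y, hf.2.shift y⟩

lemma MemD1.shift {f : R3 → F} (hf : MemD1 f) (y : R3) : MemD1 (shift y f) :=
  ⟨locallyIntegrable_comp_add hf.1 y, hf.2.1.shift y, fun t ht => by
    have := measure_preimage_add_right volume y {x | t < ‖f x‖}
    exact this.trans_lt (hf.2.2 t ht)⟩

lemma gradNormSqL2_shift {f : R3 → F} (hf : HasL2Derivatives f) (y : R3) :
    gradNormSqL2 (shift y f) = gradNormSqL2 f := by
  refine Finset.sum_congr rfl fun k _ => ?_
  rw [normSqL2_congr (weakPartial_shift hf y k), normSqL2_shift]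

lemma covDeriv_shift (hbar c Q : ℝ) (A : R3 → R3) {ψ : R3 → C2} (hψ : HasL2Derivatives ψ)
    (y : R3) (k : Fin 3) : covDeriv hbar c Q (shift y A) (shift y ψ) k
      =ᵐ[volume] shift y (covDeriv hbar c Q A ψ k) := by
  filter_upwards [weakPartial_shift hψ y k] with x hx
  rw [covDeriv, hx]
  rfl

lemma ae_all_fin {p : Fin 3 → R3 → Prop} (h : ∀ k, ∀ᵐ x, p k x) : ∀ᵐ x, ∀ k, p k x :=
  ae_all_iff.2 h

lemma energy_shift (m hbar c Q : ℝ) (j : Model) (v : R3) {A : R3 → R3} {ψ : R3 → C2}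
    (hA : HasL2Derivatives A) (hψ : HasL2Derivatives ψ) (y : R3) :
    energy m hbar c Q j v (shift y ψ, shift y A) = energy m hbar c Q j v (ψ, A) := by
  have hk : kineticNormSq hbar c Q j (shift y A) (shift y ψ) = kineticNormSq hbar c Q j A ψ := by
    cases j
    · refine Finset.sum_congr rfl fun k _ => ?_
      rw [normSqL2_congr (covDeriv_shift hbar c Q A hψ y k), normSqL2_shift]
    · simp only [kineticNormSq]
      rw [← normSqL2_shift (pauliDeriv hbar c Q A ψ) y]
      refine normSqL2_congr ?_
      filter_upwards [ae_all_fin (covDeriv_shift hbar c Q A hψ y)] with x hx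
      rw [pauliDeriv]
      simp only [hx]
      rfl
  have hd : normSqL2 (fun x => ∑ k : Fin 3, (v k / c) • weakPartial k (shift y A) x)
      = normSqL2 fun x => ∑ k : Fin 3, (v k / c) • weakPartial k A x := by
    rw [← normSqL2_shift (fun x => ∑ k : Fin 3, (v k / c) • weakPartial k A x) y]
    refine normSqL2_congr ?_
    filter_upwards [ae_all_fin (weakPartial_shift hA y)] with x hx
    simp only [hx]
    rfl
  have hm : ∫ x, inner ℂ (shift y ψ x)
        ((Complex.I * (hbar : ℂ)) • ∑ k : Fin 3, ((v k : ℝ) : ℂ) • weakPartial k (shift y ψ) x)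
      = ∫ x, inner ℂ (ψ x)
        ((Complex.I * (hbar : ℂ)) • ∑ k : Fin 3, ((v k : ℝ) : ℂ) • weakPartial k ψ x) := by
    rw [← integral_shift (fun x => inner ℂ (ψ x)
      ((Complex.I * (hbar : ℂ)) • ∑ k : Fin 3, ((v k : ℝ) : ℂ) • weakPartial k ψ x)) y]
    refine integral_congr_ae ?_
    filter_upwards [ae_all_fin (weakPartial_shift hψ y)] with x hx
    simp only [hx]
    rfl
  simp only [energy, hk, hd, hm, gradNormSqL2_shift hA]

lemma shift_mem_constraintSet {lam : ℝ} {p : (R3 → C2) × (R3 → R3)} (hp : p ∈ constraintSet lam)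
    (y : R3) : (shift y p.1, shift y p.2) ∈ constraintSet lam := by
  obtain ⟨h1, h2, h3, h4⟩ := hp
  refine ⟨h1.shift y, h2.shift y, (normSqL2_shift _ _).trans h3, ?_⟩
  filter_upwards [ae_all_fin (weakPartial_shift h2.2.1 y),
    (quasiMeasurePreserving_add y).ae h4] with x hx hx'
  simp only [hx]
  exact hx'

end Translation

/-! ### Stability of the divergence constraint -/

section Divergence

/-- Expressed as the vanishing of a continuous linear map on the L² gradients, the constraint is
visibly stable under weak limits and differences. -/
lemma ae_div_eq_zero_iff {A : R3 → R3} (hA : HasL2Derivatives A) :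
    (∀ᵐ x, ∑ k : Fin 3, weakPartial k A x k = 0) ↔
      ∑ k : Fin 3, (EuclideanSpace.proj k : R3 →L[ℝ] ℝ).compLpL 2 volume (gradL A k) = 0 := by
  have hp : ∀ k ∈ Finset.univ, MemLp (fun x => (EuclideanSpace.proj k : R3 →L[ℝ] ℝ)
      (weakPartial k A x)) 2 volume := fun k _ =>
    (EuclideanSpace.proj k : R3 →L[ℝ] ℝ).comp_memLp' (hA.memLp k)
  have e : ∑ k : Fin 3, (EuclideanSpace.proj k : R3 →L[ℝ] ℝ).compLpL 2 volume (gradL A k)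
      = toL2 fun x => ∑ k : Fin 3, (EuclideanSpace.proj k : R3 →L[ℝ] ℝ) (weakPartial k A x) := by
    rw [toL2_sum _ hp]
    exact Finset.sum_congr rfl fun k _ => (toL2_clm _ (hA.memLp k)).symm
  have hs := memLp_sum Finset.univ hp
  rw [e, Lp.eq_zero_iff_ae_eq_zero]
  constructor
  · intro h
    filter_upwards [h, coeFn_toL2 hs] with x h1 h2
    rw [h2]; exact h1
  · intro h
    filter_upwards [h, coeFn_toL2 hs] with x h1 h2
    rw [h2] at h1; exact h1

lemma ae_div_eq_zero_of_weakTo {A : ℕ → R3 → R3} {A₀ : R3 → R3}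
    (hA : ∀ n, HasL2Derivatives (A n)) (hA₀ : HasL2Derivatives A₀)
    (hw : ∀ k, WeakTo (fun n => gradL (A n) k) (gradL A₀ k))
    (h : ∀ n, ∀ᵐ x, ∑ k : Fin 3, weakPartial k (A n) x k = 0) :
    ∀ᵐ x, ∑ k : Fin 3, weakPartial k A₀ x k = 0 := by
  rw [ae_div_eq_zero_iff hA₀]
  have t := WeakTo.sum Finset.univ fun k _ =>
    (hw k).map ((EuclideanSpace.proj k : R3 →L[ℝ] ℝ).compLpL 2 volume)
  simp only [fun n => (ae_div_eq_zero_iff (hA n)).1 (h n)] at t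
  refine ext_inner_left ℝ fun y => ?_
  exact tendsto_nhds_unique (t y) tendsto_const_nhds

lemma ae_div_sub {A B : R3 → R3} (hA : HasL2Derivatives A) (hB : HasL2Derivatives B)
    (h : ∀ᵐ x, ∑ k : Fin 3, weakPartial k A x k = 0)
    (h' : ∀ᵐ x, ∑ k : Fin 3, weakPartial k B x k = 0) :
    ∀ᵐ x, ∑ k : Fin 3, weakPartial k (A - B) x k = 0 := by
  rw [ae_div_eq_zero_iff (hA.sub hB)]
  simp only [gradL_sub hA hB, map_sub, Finset.sum_sub_distrib, (ae_div_eq_zero_iff hA).1 h,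
    (ae_div_eq_zero_iff hB).1 h', sub_zero]

end Divergence

/-! ### Bounds on states of low energy and the scaling inequality -/

section Minimizer

variable {m hbar c Q lam : ℝ} {j : Model} {v : R3}

lemma norm_toL2_sq_of_mem {ψ : R3 → C2} {A : R3 → R3} (hp : (ψ, A) ∈ constraintSet lam) :
    ‖toL2 ψ‖ ^ 2 = lam := (norm_toL2_sq hp.1.1).trans hp.2.2.1

lemma norm_toL2_of_mem {ψ : R3 → C2} {A : R3 → R3} (hp : (ψ, A) ∈ constraintSet lam) :
    ‖toL2 ψ‖ = Real.sqrt lam := by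
  rw [← norm_toL2_sq_of_mem hp, Real.sqrt_sq (norm_nonneg _)]

/-- The coercivity estimate with the square completed in P. It yields the lower bound on the energy
and, on energy sublevels, bounds on P and ‖∇A‖ and hence on ‖∇ψ‖. -/
lemma exists_energy_bounds (hm : 0 < m) (hh : 0 < hbar) (hc : 0 < c) (hvc : ‖v‖ < c)
    (hlam : lam ∈ Lam hbar c Q j v) :
    BddBelow (energy m hbar c Q j v '' constraintSet lam) ∧
      ∀ E : ℝ, ∃ M : ℝ, ∀ ψ A, (ψ, A) ∈ constraintSet lam →
        energy m hbar c Q j v (ψ, A) ≤ E → gradNorm ψ ≤ M ∧ gradNorm A ≤ M := by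
  obtain ⟨κ, s, hκ, hs, h⟩ := coercive m hh hc j hvc hlam
  have hβ := fieldConst_pos hvc
  have key : ∀ ψ A, (ψ, A) ∈ constraintSet lam → ∃ P : ℝ, 0 ≤ P ∧
      1 / (2 * m) * (P - m * κ) ^ 2 + fieldConst c v / 2 * gradNorm A ^ 2 ≤
        energy m hbar c Q j v (ψ, A) + m * κ ^ 2 / 2 ∧
      hbar * gradNorm ψ ≤ 3 * P + s * gradNorm A ^ 2 := by
    intro ψ A hp
    obtain ⟨P, hP, h1, h2⟩ := h ψ A hp.1 hp.2.1 (norm_toL2_sq_of_mem hp)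
    refine ⟨P, hP, ?_, h2⟩
    have e : 1 / (2 * m) * (P - m * κ) ^ 2 = 1 / (2 * m) * P ^ 2 - κ * P + m * κ ^ 2 / 2 := by
      field_simp; ring
    rw [e]
    linarith
  refine ⟨⟨-(m * κ ^ 2 / 2), ?_⟩, fun E => ?_⟩
  · rintro _ ⟨⟨ψ, A⟩, hp, rfl⟩
    obtain ⟨P, -, h1, -⟩ := key ψ A hp
    have : 0 ≤ 1 / (2 * m) * (P - m * κ) ^ 2 + fieldConst c v / 2 * gradNorm A ^ 2 := by
      positivity
    linarith
  · obtain ⟨E', hE'⟩ : ∃ E', E' = E + m * κ ^ 2 / 2 := ⟨_, rfl⟩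
    obtain ⟨Y, hY⟩ : ∃ Y, Y = 2 * E' / fieldConst c v := ⟨_, rfl⟩
    obtain ⟨P₀, hP₀⟩ : ∃ P₀, P₀ = m * κ + Real.sqrt (2 * m * E') := ⟨_, rfl⟩
    refine ⟨max ((3 * P₀ + s * Y) / hbar) (Real.sqrt Y), fun ψ A hp hE => ?_⟩
    obtain ⟨P, hP, h1, h2⟩ := key ψ A hp
    have q1 : 0 ≤ 1 / (2 * m) * (P - m * κ) ^ 2 := by positivity
    have q2 : 0 ≤ fieldConst c v / 2 * gradNorm A ^ 2 := by positivity
    have hYle : gradNorm A ^ 2 ≤ Y := by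
      rw [hY, le_div_iff₀ hβ]
      linarith
    have hPle : P ≤ P₀ := by
      have h3 : (P - m * κ) ^ 2 ≤ 2 * m * E' := by
        have h4 : 1 / (2 * m) * (P - m * κ) ^ 2 ≤ E' := by linarith
        rw [one_div, inv_mul_le_iff₀ (by positivity)] at h4
        exact h4
      have := Real.le_sqrt_of_sq_le h3
      linarith
    refine ⟨le_max_of_le_left ?_, le_max_of_le_right (Real.le_sqrt_of_sq_le hYle)⟩
    rw [le_div_iff₀ hh]
    have := mul_le_mul_of_nonneg_left hYle hs
    linarith

lemma kinL_smul (a : ℝ) (w : Fin 3 → HC) : kinL j (fun k => a • w k) = a ^ 2 * kinL j w := by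
  cases j
  · simp only [kinL, norm_smul, mul_pow, Real.norm_eq_abs, sq_abs, Finset.mul_sum]
  · simp only [kinL, sigmaDot_smul, norm_smul, mul_pow, Real.norm_eq_abs, sq_abs]

/-- At fixed A the kinetic and momentum terms are homogeneous of degree two in ψ, and the field
energy does not involve ψ. -/
lemma energy_smul (m hbar c Q : ℝ) (j : Model) (v : R3) {A : R3 → R3} {ψ : R3 → C2}
    (hψ : MemH1 ψ) (hA : MemD1 A) (a : ℝ) :
    energy m hbar c Q j v (fun x => a • ψ x, A)
      = a ^ 2 * (energy m hbar c Q j v (ψ, A) - fieldL c v (gradL A)) + fieldL c v (gradL A) := by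
  have e1 : covL hbar c Q (gradL fun x => a • ψ x) (prodL A fun x => a • ψ x)
      = fun k => a • covL hbar c Q (gradL ψ) (prodL A ψ) k := by
    ext1 k
    rw [covL, covL, gradL_smul hψ.2, prodL_smul hA hψ, smul_add, smul_comm a, smul_comm a]
  have e2 : momL hbar v (toL2 fun x => a • ψ x) (gradL fun x => a • ψ x)
      = a ^ 2 * momL hbar v (toL2 ψ) (gradL ψ) := by
    have e3 : ∑ k, v k • (Complex.I * (hbar : ℂ)) • gradL (fun x => a • ψ x) k
        = a • ∑ k, v k • (Complex.I * (hbar : ℂ)) • gradL ψ k := by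
      rw [Finset.smul_sum]
      refine Finset.sum_congr rfl fun k _ => ?_
      rw [gradL_smul hψ.2, smul_comm _ a, smul_comm _ a]
    rw [momL, momL, e3, toL2_smul _ hψ.1, real_inner_smul_left, real_inner_smul_right]
    ring
  rw [energy_eq m hbar c Q j v (hψ.const_smul a) hA, energy_eq m hbar c Q j v hψ hA, e1, e2,
    kinL_smul]
  ring

/-- Lower bound for the energy of a state of smaller mass. -/
lemma energy_ge_of_mass_le (hm : 0 < m) (hh : 0 < hbar) (hlam : 0 < lam)
    (hbdd : BddBelow (energy m hbar c Q j v '' constraintSet lam)) {B : R3 → R3}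
    {ρ : R3 → C2} (hρ : MemH1 ρ) (hB : MemD1 B)
    (hdiv : ∀ᵐ x, ∑ k : Fin 3, weakPartial k B x k = 0) :
    ‖toL2 ρ‖ ^ 2 / lam * infEnergy m hbar c Q j v lam
        + (1 - ‖toL2 ρ‖ ^ 2 / lam) * fieldL c v (gradL B) ≤
      energy m hbar c Q j v (ρ, B) := by
  rcases eq_or_ne ‖toL2 ρ‖ 0 with h0 | h0
  -- A state of zero mass cannot be rescaled; its momentum term vanishes and only nonnegative
  -- kinetic energy is added to the field energy.
  · rw [energy_eq m hbar c Q j v hρ hB, h0]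
    have h1 := abs_momL_le hh v (toL2 ρ) (gradL ρ)
    rw [h0, mul_zero, zero_mul, abs_nonpos_iff] at h1
    rw [h1]
    have := kinL_nonneg j (covL hbar c Q (gradL ρ) (prodL B ρ))
    have : 0 ≤ 1 / (2 * m) * kinL j (covL hbar c Q (gradL ρ) (prodL B ρ)) := by positivity
    rw [zero_pow two_ne_zero, zero_div, zero_mul, sub_zero, one_mul]
    linarith
  · have hpos : 0 < ‖toL2 ρ‖ ^ 2 := by positivity
    obtain ⟨μ, hμ⟩ : ∃ μ, μ = ‖toL2 ρ‖ ^ 2 := ⟨_, rfl⟩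
    rw [← hμ] at hpos ⊢
    -- Scaling ρ to mass λ makes it a competitor for the infimum; multiplying the resulting
    -- inequality by μ/λ gives the claim.
    have ha : Real.sqrt (lam / μ) ^ 2 = lam / μ := Real.sq_sqrt (by positivity)
    have hmem : ((fun x => Real.sqrt (lam / μ) • ρ x), B) ∈ constraintSet lam := by
      refine ⟨hρ.const_smul _, hB, ?_, hdiv⟩
      simp only
      rw [normSqL2_smul, ← norm_toL2_sq hρ.1, ha, ← hμ]
      field_simp
    have h1 := csInf_le hbdd ⟨_, hmem, rfl⟩
    rw [energy_smul m hbar c Q j v hρ hB, ha] at h1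
    change infEnergy m hbar c Q j v lam ≤ _ at h1
    have h2 := mul_le_mul_of_nonneg_left h1 (div_nonneg hpos.le hlam.le)
    have e : μ / lam * (lam / μ * (energy m hbar c Q j v (ρ, B) - fieldL c v (gradL B))
        + fieldL c v (gradL B)) = energy m hbar c Q j v (ρ, B) - fieldL c v (gradL B)
          + μ / lam * fieldL c v (gradL B) := by
      field_simp
    rw [e] at h2
    linarith

/-- Below the free energy the interaction stays away from zero. -/
lemma exists_mixNorm_lower (hm : 0 < m) (hvc : ‖v‖ < c) (hQ : Q ≠ 0) (hv : 0 < ‖v‖)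
    (hlam : 0 < lam) {E : ℝ} (hE : E < -(m * ‖v‖ ^ 2 * lam / 2)) :
    ∃ η : ℝ, 0 < η ∧ ∀ ψ A, (ψ, A) ∈ constraintSet lam →
      energy m hbar c Q j v (ψ, A) ≤ E → η ≤ mixNorm A ψ := by
  have hc : 0 < c := hv.trans hvc
  obtain ⟨d, hd⟩ : ∃ d, d = |Q| / c * (‖v‖ * Real.sqrt lam) := ⟨_, rfl⟩
  have hd0 : 0 < d := by rw [hd]; positivity
  refine ⟨(-(m * ‖v‖ ^ 2 * lam / 2) - E) / d, div_pos (by linarith) hd0, fun ψ A hp hpE => ?_⟩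
  rw [div_le_iff₀ hd0]
  have h1 := energy_ge_coupling (Q := Q) (hbar := hbar) hm j hvc hp.2.1 hp.1
  have h2 := abs_coupling_le v hp.2.1 hp.1
  have hn := norm_toL2_of_mem hp
  rw [norm_toL2_sq_of_mem hp] at h1
  rw [hn] at h2
  have h3 : Q / c * coupling v A ψ ≤ |Q| / c * (‖v‖ * Real.sqrt lam * mixNorm A ψ) := by
    calc Q / c * coupling v A ψ ≤ |Q / c * coupling v A ψ| := le_abs_self _
      _ = |Q| / c * |coupling v A ψ| := by rw [abs_mul, abs_div, abs_of_pos hc]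
      _ ≤ _ := by gcongr
  rw [hd]
  have e : mixNorm A ψ * (|Q| / c * (‖v‖ * Real.sqrt lam))
      = |Q| / c * (‖v‖ * Real.sqrt lam * mixNorm A ψ) := by ring
  rw [e]
  linarith

/-- Some localization of a state with non-negligible interaction carries a fixed mass. -/
lemma exists_localize_lower {M η : ℝ} (hM : 0 ≤ M) (hη : 0 < η) : ∃ s : ℝ, 0 < s ∧
    ∀ (A : R3 → R3) (ψ : R3 → C2), MemD1 A → MemH1 ψ → ‖toL2 ψ‖ ≤ M → gradNorm ψ ≤ M →
      gradNorm A ≤ M → η ≤ mixNorm A ψ → ∃ y, s < ‖toL2 (localize y ψ)‖ := by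
  obtain ⟨C, hC, h⟩ := exists_mixNorm_bound
  have hK := sobolevConst_nonneg
  obtain ⟨D, hD⟩ : ∃ D, D = (sobolevConst * M) ^ 6 * (C * M ^ 5) := ⟨_, rfl⟩
  have hD0 : 0 ≤ D := by rw [hD]; positivity
  -- If all localizations had mass norm at most this s, the interaction bound would give η⁶ ≤ D s <
  -- η⁶. The 1 covers the case D = 0.
  refine ⟨η ^ 6 / (D + 1), by positivity, fun A ψ hA hψ h2 hg hgA hlow => ?_⟩
  by_contra! hcon
  have h1 := h A ψ _ M hA hψ (by positivity) h2 hg hcon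
  have h6 : normL6 A ≤ sobolevConst * M :=
    hA.normL6_le_gradNorm.trans (mul_le_mul_of_nonneg_left hgA hK)
  have h3 : η ^ 6 ≤ D * (η ^ 6 / (D + 1)) := by
    calc η ^ 6 ≤ mixNorm A ψ ^ 6 := by gcongr
      _ ≤ _ := h1
      _ ≤ (sobolevConst * M) ^ 6 * (C * (η ^ 6 / (D + 1)) * M ^ 5) := by
          have := normL6_nonneg A
          gcongr
      _ = _ := by rw [hD]; ring
  have h4 : D * (η ^ 6 / (D + 1)) < η ^ 6 := by
    rw [← mul_div_assoc, div_lt_iff₀ (by positivity)]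
    have : 0 < η ^ 6 := by positivity
    linarith
  linarith

lemma norm_localize_shift {ψ : R3 → C2} (hψ : MemLp ψ 2 volume) (y : R3) :
    ‖toL2 (localize 0 (shift y ψ))‖ = ‖toL2 (localize y ψ)‖ := by
  have e : localize 0 (shift y ψ) = shift y (localize y ψ) := by
    ext1 x; simp [localize, shift]
  rw [e, norm_toL2_eq_sqrt (memLp_shift (memLp_localize y hψ) y), normSqL2_shift,
    norm_toL2_eq_sqrt (memLp_localize y hψ)]

lemma localize_zero_eq (ψ : R3 → C2) : localize 0 ψ = fun x => cutoff 0 x • ψ x := by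
  ext1 x; simp [localize, cutoff]

end Minimizer

/-! ### Construction of the minimizer -/

section Existence

variable {m hbar c Q lam : ℝ} {j : Model} {v : R3}

/-- A minimizing sequence, suitably translated, carrying a fixed mass near the origin. -/
lemma exists_minimizing_sequence (hm : 0 < m) (hh : 0 < hbar) (hc : 0 < c) (hQ : Q ≠ 0)
    (hv : 0 < ‖v‖) (hvc : ‖v‖ < c) (hlam : lam ∈ Lam hbar c Q j v) :
    ∃ (ψ : ℕ → R3 → C2) (A : ℕ → R3 → R3) (M s η : ℝ), 0 < s ∧ 0 < η ∧
      (∀ n, (ψ n, A n) ∈ constraintSet lam) ∧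
      Tendsto (fun n => energy m hbar c Q j v (ψ n, A n)) atTop
        (𝓝 (infEnergy m hbar c Q j v lam)) ∧
      (∀ n, ‖toL2 (ψ n)‖ ≤ M) ∧ (∀ n, gradNorm (ψ n) ≤ M) ∧ (∀ n, gradNorm (A n) ≤ M) ∧
      (∀ n, η ≤ mixNorm (A n) (ψ n)) ∧ ∀ n, s ≤ ‖toL2 (localize 0 (ψ n))‖ := by
  obtain ⟨hbdd, hbound⟩ := exists_energy_bounds (m := m) hm hh hc hvc hlam
  obtain ⟨p₀, hp₀, hp₀E⟩ := exists_trial (c := c) hm hh hc hQ hlam.1 j hv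
  have hI : infEnergy m hbar c Q j v lam < -(m * ‖v‖ ^ 2 * lam / 2) :=
    (csInf_le hbdd ⟨p₀, hp₀, rfl⟩).trans_lt hp₀E
  -- A level strictly between the infimum and the free energy: all late terms of a minimizing
  -- sequence lie below it, and the interaction is bounded below there.
  obtain ⟨E, hIE, hE⟩ := exists_between hI
  obtain ⟨M₀, hM₀⟩ := hbound E
  obtain ⟨η, hη, hlow⟩ := exists_mixNorm_lower (hbar := hbar) (j := j) hm hvc hQ hv hlam.1 hE
  obtain ⟨M, hM0, hMM, hMl⟩ : ∃ M : ℝ, 0 ≤ M ∧ M₀ ≤ M ∧ Real.sqrt lam ≤ M :=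
    ⟨max (Real.sqrt lam) M₀, (Real.sqrt_nonneg _).trans (le_max_left _ _), le_max_right _ _,
      le_max_left _ _⟩
  obtain ⟨s, hs, hloc⟩ := exists_localize_lower hM0 hη
  have hL2 : ∀ ψ A, (ψ, A) ∈ constraintSet lam → ‖toL2 ψ‖ ≤ M := fun ψ A hp =>
    (norm_toL2_of_mem hp).trans_le hMl
  obtain ⟨u, -, hu, humem⟩ := exists_seq_tendsto_sInf
    (S := energy m hbar c Q j v '' constraintSet lam) ⟨_, p₀, hp₀, rfl⟩ hbdd
  obtain ⟨n₀, hn₀⟩ := eventually_atTop.1 (hu.eventually_le_const hIE)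
  choose p hp hpu using humem
  -- The first n₀ terms are dropped, so that every remaining energy is at most E and the bounds hold
  -- for all n. The centres y found here are then translated to the origin.
  have hy : ∀ n, ∃ y, s < ‖toL2 (localize y (p (n + n₀)).1)‖ := fun n => by
    have hle : energy m hbar c Q j v (p (n + n₀)) ≤ E := by
      rw [hpu]; exact hn₀ _ (Nat.le_add_left _ _)
    obtain ⟨h1, h2⟩ := hM₀ _ _ (hp _) hle
    exact hloc _ _ (hp _).2.1 (hp _).1 (hL2 _ _ (hp _)) (h1.trans hMM) (h2.trans hMM)
      (hlow _ _ (hp _) hle)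
  choose y hy using hy
  have hmem : ∀ n, (shift (y n) (p (n + n₀)).1, shift (y n) (p (n + n₀)).2) ∈
      constraintSet lam := fun n => shift_mem_constraintSet (hp _) _
  have hen : ∀ n, energy m hbar c Q j v (shift (y n) (p (n + n₀)).1, shift (y n) (p (n + n₀)).2)
      = u (n + n₀) := fun n => by
    rw [energy_shift m hbar c Q j v (hp _).2.1.2.1 (hp _).1.2, ← hpu]
  have hle : ∀ n, energy m hbar c Q j v
      (shift (y n) (p (n + n₀)).1, shift (y n) (p (n + n₀)).2) ≤ E := fun n => by
    rw [hen]; exact hn₀ _ (Nat.le_add_left _ _)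
  refine ⟨fun n => shift (y n) (p (n + n₀)).1, fun n => shift (y n) (p (n + n₀)).2, M, s, η, hs,
    hη, hmem, ?_, fun n => hL2 _ _ (hmem n), fun n => (hM₀ _ _ (hmem n) (hle n)).1.trans hMM,
    fun n => (hM₀ _ _ (hmem n) (hle n)).2.trans hMM, fun n => hlow _ _ (hmem n) (hle n), fun n => ?_⟩
  · simp only [hen]
    exact hu.comp (tendsto_add_atTop_nat n₀)
  · rw [norm_localize_shift (hp _).1.1]
    exact (hy n).le

/-- A minimizing sequence with its weak limit. -/
lemma exists_convergent_minimizing_sequence (hm : 0 < m) (hh : 0 < hbar) (hc : 0 < c)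
    (hQ : Q ≠ 0) (hv : 0 < ‖v‖) (hvc : ‖v‖ < c) (hlam : lam ∈ Lam hbar c Q j v) :
    ∃ (ψ : ℕ → R3 → C2) (A : ℕ → R3 → R3) (ψ₀ : R3 → C2) (A₀ : R3 → R3) (M η : ℝ), 0 < η ∧
      (∀ n, (ψ n, A n) ∈ constraintSet lam) ∧ MemH1 ψ₀ ∧ MemD1 A₀ ∧
      (∀ᵐ x, ∑ k : Fin 3, weakPartial k A₀ x k = 0) ∧ 0 < ‖toL2 ψ₀‖ ∧
      Tendsto (fun n => energy m hbar c Q j v (ψ n, A n)) atTop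
        (𝓝 (infEnergy m hbar c Q j v lam)) ∧
      Tendsto (fun n => energy m hbar c Q j v (ψ n, A n) - energy m hbar c Q j v (ψ₀, A₀)
        - energy m hbar c Q j v (ψ n - ψ₀, A n - A₀)) atTop (𝓝 0) ∧
      Tendsto (fun n => ‖toL2 (ψ n - ψ₀)‖ ^ 2) atTop (𝓝 (lam - ‖toL2 ψ₀‖ ^ 2)) ∧
      (∀ n, gradNorm (ψ n) ≤ M) ∧ (∀ n, η ≤ mixNorm (A n) (ψ n)) := by
  obtain ⟨ψ, A, M, s, η, hs, hη, hmem, hE, hM, hMψ, hMA, hmix, hloc⟩ :=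
    exists_minimizing_sequence (m := m) hm hh hc hQ hv hvc hlam
  obtain ⟨ψ₀, φ, hφ, hψ₀, hw, hwψ, hlψ⟩ :=
    MemH1.exists_local_limit (fun n => (hmem n).1) hM hMψ
  obtain ⟨A₀, χ, hχ, hA₀, hwA, hlA⟩ :=
    MemD1.exists_local_limit (A := fun n => A (φ n)) (fun n => (hmem _).2.1) fun n => hMA _
  have hψ : ∀ n, MemH1 (ψ (φ (χ n))) := fun n => (hmem _).1
  have hA : ∀ n, MemD1 (A (φ (χ n))) := fun n => (hmem _).2.1
  have hlψ' : ∀ N, Tendsto (fun n => eLpNorm (fun x => cutoff N x • (ψ (φ (χ n)) - ψ₀) x) 2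
      volume) atTop (𝓝 0) := fun N => (hlψ N).comp hχ.tendsto_atTop
  have hw' : WeakTo (fun n => toL2 (ψ (φ (χ n)))) (toL2 ψ₀) := hw.comp hχ
  have hsplit := tendsto_energy_split m hbar c Q j v hA hA₀ hψ hψ₀ (fun n => hM _)
    (fun n => hMψ _) (fun n => hMA _) hw' (fun k => (hwψ k).comp hχ) hwA hlψ' hlA
  refine ⟨fun n => ψ (φ (χ n)), fun n => A (φ (χ n)), ψ₀, A₀, M, η, hη, fun n => hmem _, hψ₀,
    hA₀, ae_div_eq_zero_of_weakTo (fun n => (hA n).2.1) hA₀.2.1 hwA fun n => (hmem _).2.2.2, ?_,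
    hE.comp (hφ.comp hχ).tendsto_atTop, hsplit, ?_, fun n => hMψ _, fun n => hmix _⟩
  · have hmc : ∀ f : R3 → C2, MemLp f 2 volume → MemLp (fun x => cutoff 0 x • f x) 2 volume :=
      fun f hf => memLp_cutoff_smul 0 hf
    have t : Tendsto (fun n => ‖toL2 fun x => cutoff 0 x • (ψ (φ (χ n)) - ψ₀) x‖) atTop (𝓝 0) := by
      refine ((ENNReal.tendsto_toReal ENNReal.zero_ne_top).comp (hlψ' 0)).congr fun n => ?_
      rw [norm_toL2 (hmc _ ((hψ n).sub hψ₀).1)]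
      rfl
    have h1 : ∀ n, s ≤ ‖toL2 (fun x => cutoff 0 x • (ψ (φ (χ n)) - ψ₀) x)‖ + ‖toL2 ψ₀‖ := by
      intro n
      refine (hloc (φ (χ n))).trans ?_
      have e : localize 0 (ψ (φ (χ n))) = fun x => (cutoff 0 x • (ψ (φ (χ n)) - ψ₀) x)
          + cutoff 0 x • ψ₀ x := by
        rw [localize_zero_eq]; ext1 x; simp [smul_sub]
      rw [e, toL2_add (hmc _ ((hψ n).sub hψ₀).1) (hmc _ hψ₀.1)]
      refine (norm_add_le _ _).trans ?_
      gcongr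
      refine norm_toL2_le (hmc _ hψ₀.1) hψ₀.1 (Eventually.of_forall fun x => ?_)
      rw [norm_smul]
      exact mul_le_of_le_one_left (norm_nonneg _) (norm_cutoff_le_one 0 x)
    -- Strong convergence near the origin transfers the mass s retained there to the limit, so ψ₀ ≠
    -- 0.
    have h2 := ge_of_tendsto' (t.add_const ‖toL2 ψ₀‖) h1
    linarith
  · have hwρ : WeakTo (fun n => toL2 (ψ (φ (χ n)) - ψ₀)) 0 := by
      simp only [toL2_sub' (hψ _).1 hψ₀.1]
      exact hw'.sub_const
    have t := (tendsto_norm_sq_split' (toL2 ψ₀) hwρ).const_sub (lam - ‖toL2 ψ₀‖ ^ 2)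
    rw [sub_zero] at t
    refine t.congr fun n => ?_
    have e : toL2 ψ₀ + toL2 (ψ (φ (χ n)) - ψ₀) = toL2 (ψ (φ (χ n))) := by
      rw [toL2_sub' (hψ n).1 hψ₀.1]; abel
    have hl : ‖toL2 (ψ (φ (χ n)))‖ ^ 2 = lam := norm_toL2_sq_of_mem (hmem (φ (χ n)))
    rw [e, hl]
    ring

lemma gradNorm_eq_of_sub {A A₀ : R3 → R3} (hA : HasL2Derivatives A) (hA₀ : HasL2Derivatives A₀)
    (h0 : gradNorm A₀ = 0) : gradNorm (A - A₀) = gradNorm A := by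
  have : ∀ k, gradL A₀ k = 0 := fun k => by
    have := norm_gradL_le A₀ k
    rw [h0] at this
    exact norm_le_zero_iff.1 this
  simp only [gradNorm, gradL_sub hA hA₀, this, sub_zero]

lemma fieldConst_mul_gradNorm_sq_le (c : ℝ) (v : R3) (A : R3 → R3) :
    fieldConst c v * gradNorm A ^ 2 ≤ fieldL c v (gradL A) := by
  rw [gradNorm_sq]; exact fieldConst_mul_le c v _

/-- Existence of a minimizer. -/
lemma exists_minimizer (hm : 0 < m) (hh : 0 < hbar) (hc : 0 < c) (hQ : Q ≠ 0)
    (hv : 0 < ‖v‖) (hvc : ‖v‖ < c) (hlam : lam ∈ Lam hbar c Q j v) :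
    ∃ p ∈ constraintSet lam, energy m hbar c Q j v p = infEnergy m hbar c Q j v lam := by
  have hl : 0 < lam := hlam.1
  have hbdd := (exists_energy_bounds (m := m) hm hh hc hvc hlam).1
  obtain ⟨ψ, A, ψ₀, A₀, M, η, hη, hmem, hψ₀, hA₀, hdiv, hpos, hE, hsplit, hmass, hMψ, hmix⟩ :=
    exists_convergent_minimizing_sequence (m := m) hm hh hc hQ hv hvc hlam
  obtain ⟨I, hI⟩ : ∃ I, I = infEnergy m hbar c Q j v lam := ⟨_, rfl⟩
  obtain ⟨α, hα⟩ : ∃ α, α = ‖toL2 ψ₀‖ ^ 2 := ⟨_, rfl⟩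
  have hα0 : 0 < α := by rw [hα]; positivity
  rw [← hα] at hmass
  rw [← hI] at hE
  have hαl : α ≤ lam := by
    have := ge_of_tendsto' hmass fun n => sq_nonneg _
    linarith
  have hlow₀ := energy_ge_of_mass_le hm hh hl hbdd hψ₀ hA₀ hdiv
  have hlow := fun n => energy_ge_of_mass_le hm hh hl hbdd ((hmem n).1.sub hψ₀)
    ((hmem n).2.1.sub hA₀) (ae_div_sub (hmem n).2.1.2.1 hA₀.2.1 (hmem n).2.2.2 hdiv)
  simp only at hlow
  rw [← hα, ← hI] at hlow₀
  simp only [← hI] at hlow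
  have hF₀ := fieldL_nonneg hvc (gradL A₀)
  have hF := fun n => fieldL_nonneg hvc (gradL (A n - A₀))
  -- The remainder has asymptotic mass λ - α < λ, so its field energy enters the scaling inequality
  -- with a coefficient that is eventually positive.
  have hmu : Tendsto (fun n => 1 - ‖toL2 (ψ n - ψ₀)‖ ^ 2 / lam) atTop (𝓝 (α / lam)) := by
    have := (hmass.div_const lam).const_sub 1
    have e : 1 - (lam - α) / lam = α / lam := by field_simp; ring
    rwa [e] at this
  have hmu_pos : ∀ᶠ n in atTop, 0 < 1 - ‖toL2 (ψ n - ψ₀)‖ ^ 2 / lam :=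
    hmu.eventually_const_lt (by positivity)
  rcases eq_or_lt_of_le hαl with heq | hlt
  · have hn : normSqL2 ψ₀ = lam := by rw [← norm_toL2_sq hψ₀.1, ← hα, heq]
    have hmem₀ : (ψ₀, A₀) ∈ constraintSet lam := ⟨hψ₀, hA₀, hn, hdiv⟩
    refine ⟨(ψ₀, A₀), hmem₀, le_antisymm ?_ (csInf_le hbdd ⟨_, hmem₀, rfl⟩)⟩
    -- If no mass is lost, the remainder has vanishing mass and its energy is asymptotically
    -- nonnegative. The limit state then has energy at most the infimum.
    have t := (hE.sub hsplit).sub ((hmass.div_const lam).mul_const I)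
    rw [heq, sub_self, zero_div, zero_mul, sub_zero, sub_zero, hI] at t
    refine ge_of_tendsto t ?_
    filter_upwards [hmu_pos] with n hn
    have := mul_nonneg hn.le (hF n)
    have := hlow n
    rw [← hI]
    linarith
  · exfalso
    -- The scaling inequality is used for the limit and for the remainder. The shares α/λ and (λ -
    -- α)/λ of the infimum cancel against the total, and only the two weighted field energies are
    -- left, with limit at most zero.
    have t : Tendsto (fun n => energy m hbar c Q j v (ψ n, A n)
        - (energy m hbar c Q j v (ψ n, A n) - energy m hbar c Q j v (ψ₀, A₀)
          - energy m hbar c Q j v (ψ n - ψ₀, A n - A₀))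
        - ‖toL2 (ψ n - ψ₀)‖ ^ 2 / lam * I - α / lam * I - (1 - α / lam) * fieldL c v (gradL A₀))
        atTop (𝓝 (-((1 - α / lam) * fieldL c v (gradL A₀)))) := by
      have := (((hE.sub hsplit).sub ((hmass.div_const lam).mul_const I)).sub_const
        (α / lam * I)).sub_const ((1 - α / lam) * fieldL c v (gradL A₀))
      have e : I - 0 - (lam - α) / lam * I - α / lam * I - (1 - α / lam) * fieldL c v (gradL A₀)
          = -((1 - α / lam) * fieldL c v (gradL A₀)) := by
        field_simp; ring
      rwa [e] at this
    have hle : ∀ n, (1 - ‖toL2 (ψ n - ψ₀)‖ ^ 2 / lam) * fieldL c v (gradL (A n - A₀)) ≤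
        energy m hbar c Q j v (ψ n, A n)
        - (energy m hbar c Q j v (ψ n, A n) - energy m hbar c Q j v (ψ₀, A₀)
          - energy m hbar c Q j v (ψ n - ψ₀, A n - A₀))
        - ‖toL2 (ψ n - ψ₀)‖ ^ 2 / lam * I - α / lam * I
        - (1 - α / lam) * fieldL c v (gradL A₀) := fun n => by
      have := hlow n
      linarith
    have hge : ∀ᶠ n in atTop, 0 ≤
        (1 - ‖toL2 (ψ n - ψ₀)‖ ^ 2 / lam) * fieldL c v (gradL (A n - A₀)) := by
      filter_upwards [hmu_pos] with n hn using mul_nonneg hn.le (hF n)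
    have hα1 : 0 < 1 - α / lam := by
      rw [sub_pos, div_lt_one hl]; exact hlt
    have hF0 : fieldL c v (gradL A₀) = 0 := by
      have h1 : 0 ≤ -((1 - α / lam) * fieldL c v (gradL A₀)) := ge_of_tendsto t (by
        filter_upwards [hge] with n hn using hn.trans (hle n))
      refine le_antisymm ?_ hF₀
      by_contra! hcon
      linarith [mul_pos hα1 hcon]
    have hg0 : gradNorm A₀ = 0 := by
      have h1 := fieldConst_mul_gradNorm_sq_le c v A₀
      rw [hF0] at h1
      have h2 : gradNorm A₀ ^ 2 ≤ 0 := by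
        by_contra! hcon
        linarith [mul_pos (fieldConst_pos hvc) hcon]
      exact pow_eq_zero_iff two_ne_zero |>.1 (le_antisymm h2 (sq_nonneg _))
    rw [hF0, mul_zero, neg_zero] at t
    have t2 := tendsto_of_tendsto_of_tendsto_of_le_of_le' tendsto_const_nhds t hge
      (Eventually.of_forall fun n => by simpa only [hF0, mul_zero] using hle n)
    -- Division by the coefficient is allowed since it tends to α/λ > 0; this is where ψ₀ ≠ 0 is
    -- needed.
    have t3 : Tendsto (fun n => fieldL c v (gradL (A n - A₀))) atTop (𝓝 0) := by
      have h1 := t2.div hmu (by positivity)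
      rw [zero_div] at h1
      refine h1.congr' ?_
      filter_upwards [hmu_pos] with n hn
      simp only [Pi.div_apply]
      rw [mul_div_cancel_left₀ _ hn.ne']
    have hK := sobolevConst_nonneg
    have hM0 : 0 ≤ M := (gradNorm_nonneg _).trans (hMψ 0)
    obtain ⟨L, hL⟩ : ∃ L, L = sobolevConst ^ 2 * (Real.sqrt lam * (sobolevConst * M)) /
      fieldConst c v := ⟨_, rfl⟩
    have hβ := fieldConst_pos hvc
    -- As ∇A₀ = 0, the field energy of Aₙ - A₀ controls ‖∇Aₙ‖ and hence the interaction, which would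
    -- tend to zero against its lower bound η.
    have hbd : ∀ n, η ^ 2 ≤ L * fieldL c v (gradL (A n - A₀)) := fun n => by
      have hn := norm_toL2_of_mem (hmem n)
      have h6 : normL6 (ψ n) ≤ sobolevConst * M :=
        (hmem n).1.memD1.normL6_le_gradNorm.trans (mul_le_mul_of_nonneg_left (hMψ n) hK)
      have hfc : gradNorm (A n) ^ 2 ≤ fieldL c v (gradL (A n - A₀)) / fieldConst c v := by
        rw [le_div_iff₀ hβ, ← gradNorm_eq_of_sub (hmem n).2.1.2.1 hA₀.2.1 hg0, mul_comm]
        exact fieldConst_mul_gradNorm_sq_le c v _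
      calc η ^ 2 ≤ mixNorm (A n) (ψ n) ^ 2 := by
            have := hmix n
            gcongr
        _ ≤ sobolevConst ^ 2 * gradNorm (A n) ^ 2 * (‖toL2 (ψ n)‖ * normL6 (ψ n)) :=
            mixNorm_sq_le_grad (hmem n).2.1 (hmem n).1
        _ ≤ sobolevConst ^ 2 * (fieldL c v (gradL (A n - A₀)) / fieldConst c v) *
            (Real.sqrt lam * (sobolevConst * M)) := by
            rw [hn]
            have := normL6_nonneg (ψ n)
            have := hF n
            gcongr
        _ = _ := by rw [hL]; ring
    have h0 := ge_of_tendsto' (t3.const_mul L) hbd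
    rw [mul_zero] at h0
    have : 0 < η ^ 2 := by positivity
    linarith

end Existence

end MaxwellPauli

end

theorem mainTheorem2 (m hbar c Q : ℝ) (hm : 0 < m) (hhbar : 0 < hbar) (hc : 0 < c) (hQ : Q ≠ 0)
    (j : MaxwellPauli.Model) (v : MaxwellPauli.R3) (hv : 0 < ‖v‖) (hvc : ‖v‖ < c)
    (lam : ℝ) (hlam : lam ∈ MaxwellPauli.Lam hbar c Q j v) :
    BddBelow (MaxwellPauli.energy m hbar c Q j v '' MaxwellPauli.constraintSet lam) ∧
      ∃ p ∈ MaxwellPauli.constraintSet lam,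
        MaxwellPauli.energy m hbar c Q j v p = MaxwellPauli.infEnergy m hbar c Q j v lam :=
  ⟨(MaxwellPauli.exists_energy_bounds hm hhbar hc hvc hlam).1,
    MaxwellPauli.exists_minimizer hm hhbar hc hQ hv hvc hlam⟩
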